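/- Let $F$ be a field of characteristic $0$; all tensor products are over $F$, and Sweedler notation $\Delta(h)=h_{(1)}\otimes h_{(2)}$ is used. Let $H$ be a pointed cocommutative Hopf algebra over $F$ and let $V$ be a finite-dimensional $H$-module with a non-degenerate symmetric bilinear form $\langle\cdot,\cdot\rangle$ which is $H$-invariant, i.e. $\langle h\cdot v,w\rangle=\langle v,S(h)\cdot w\rangle$. Let $\kappa:V\wedge V\to H$ be linear and $$A=(T(V)\rtimes H)/\big(vw-wv-\kappa(v,w):\ v,w\in V\big),$$ where $T(V)\rtimes H$ is the smash product (with $hv=(h_{(1)}\cdot v)h_{(2)}$). Assume that $A$ is a Hopf–Hecke algebra, i.e. has the PBW property: the natural surjection $S(V)\rtimes H\to\operatorname{gr}A$ is an isomorphism, where $\operatorname{gr}A$ is taken with respect to the filtration of $A$ induced by the degree in $T(V)$. Let $C=C(V)$ be the Clifford algebra with relations $vw+wv=2\langle v,w\rangle$. If $\tilde H$ is a pointed cocommutative Hopf algebra with a Hopf algebra map $\pi:\tilde H\to H$, then $\tilde H$ acts on $V$ through $\pi$, and $\tilde H$ is a $\mathbb Z/2$-graded algebra with $(-1)^{|g|}=\det(g|_V)$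 for group-like $g$ and $|x|=0$ for primitive $x$. Let $(\tilde H,\pi,\gamma)$ be a pin cover of $H$ with respect to $V$, that is: $\tilde H$ is a pointed cocommutative Hopf algebra; $\pi:\tilde H\to H$ is a surjective Hopf algebra map which is a double cover ($\tilde H\cong H\oplus H$ as coalgebras, with $\pi$ restricting to a coalgebra isomorphism on each copy of $H$); and $\gamma:\tilde H\to C$ is an algebra map which preserves the $\mathbb Z/2$-gradations and satisfies $$(-1)^{|h|}\,\pi(h)\cdot v=\gamma(h_{(1)})\,v\,\gamma(S h_{(2)})\quad\text{in } C$$ for all $v\in V$ and homogeneous $h\in\tilde H$. Put $\Delta_C:\tilde H\to H\otimes C$, $\Delta_C(h)=\pi(h_{(1)})\otimes\gamma(h_{(2)})$, and $H'=\tilde H/\ker\Delta_C$; we also write $\Delta_C$ for the induced maps from $\tilde H$ and $H'$ to $A\otimes C$. Let $(A\otimes C)_{\det}^{\mathrm{odd}}$ be the space of all $x\in A\otimes C^{\mathrm{odd}}$ such that $$\Delta_C(h_{(1)})\,x\,\Delta_C(S h_{(2)})=(-1)^{|h|}\varepsilon(h)\,x\quad\text{for all homogeneous } h\in\tilde H .$$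 Let $(v_k)_k$, $(v^k)_k$ be dual bases of $V$ with respect to $\langle\cdot,\cdot\rangle$ and let $D=\sum_k v_k\otimes v^k\in A\otimes C$ be the Dirac element. Assume that $A$ is a Barbasch–Sahi algebra, i.e. that the Parthasarathy condition holds: $$D^2\in Z(A\otimes C)+\Delta_C(\tilde H^{\mathrm{even}}).$$ **Proposition ("algebraic Vogan's conjecture").** For every $z$ in the center $Z(A)$ there are an element $a\in(A\otimes C)_{\det}^{\mathrm{odd}}$ and a uniquely determined element $\zeta(z)\in Z(H')$ such that $$z\otimes 1=\Delta_C(\zeta(z))+Da+aD .$$ Moreover, the map $\zeta:Z(A)\to Z(H')$ is a (unital) homomorphism of $F$-algebras. -/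

import Mathlib

open scoped TensorProduct

noncomputable section

namespace BarbaschSahi

/-! ### Coalgebras -/

section Coalgebra

variable (F : Type*) [Field F] {K : Type*} [AddCommGroup K] [Module F K] [Coalgebra F K]

/-- A subspace `W` with `Δ(W) ⊆ W ⊗ W`. -/
def IsSubcoalgebra (W : Submodule F K) : Prop :=
  ∀ c ∈ W, Coalgebra.comul (R := F) c ∈
    LinearMap.range (TensorProduct.map W.subtype W.subtype)

/-- A nonzero subcoalgebra without proper nonzero subcoalgebras. -/
def IsSimpleSubcoalgebra (W : Submodule F K) : Prop :=
  IsSubcoalgebra F W ∧ W ≠ ⊥ ∧ ∀ U ≤ W, IsSubcoalgebra F U → U = ⊥ ∨ U = W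

variable (K) in
/-- A coalgebra is pointed if all its simple subcoalgebras are one-dimensional. -/
def IsPointed : Prop :=
  ∀ W : Submodule F K, IsSimpleSubcoalgebra F W → Module.finrank F W = 1

end Coalgebra

/-- Primitive elements of a bialgebra: `Δ(x) = 1 ⊗ x + x ⊗ 1`. -/
def IsPrimitive (F : Type*) [Field F] {H : Type*} [Ring H] [HopfAlgebra F H] (x : H) : Prop :=
  Coalgebra.comul (R := F) x = 1 ⊗ₜ[F] x + x ⊗ₜ[F] 1

/-- For an algebra map `f : K → R` on a Hopf algebra and `x ∈ R`, the linear map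
`h ↦ f(h₍₁₎) x f(S h₍₂₎)`. -/
def conj {F : Type*} [Field F] {K : Type*} [Ring K] [HopfAlgebra F K]
    {R : Type*} [Ring R] [Algebra F R] (f : K →ₐ[F] R) (x : R) : K →ₗ[F] R :=
  TensorProduct.lift
      ((LinearMap.mul F R).compl₁₂ (LinearMap.mulRight F x ∘ₗ f.toLinearMap)
        (f.toLinearMap ∘ₗ HopfAlgebra.antipode F)) ∘ₗ
    Coalgebra.comul

section Modules

variable {F : Type*} [Field F] {H : Type*} [Ring H] [HopfAlgebra F H]
  {V : Type*} [AddCommGroup V] [Module F V]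

/-! ### Orthogonal modules and their Clifford algebras

An `H`-module structure on `V` is given as an algebra map `ρ : H → End V`. -/

/-- `B` is a non-degenerate symmetric bilinear form on `V` which is invariant under `H`:
`⟨h · v, w⟩ = ⟨v, S(h) · w⟩`. -/
structure IsOrthogonal (ρ : H →ₐ[F] Module.End F V) (B : LinearMap.BilinForm F V) : Prop where
  symm : B.IsSymm
  nondegenerate : B.Nondegenerate
  invariant : ∀ (h : H) (v w : V), B (ρ h v) w = B v (ρ (HopfAlgebra.antipode F h) w)

/-- The quadratic form `v ↦ ⟨v, v⟩`. -/
abbrev quad (B : LinearMap.BilinForm F V) : QuadraticForm F V :=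
  LinearMap.BilinMap.toQuadraticMap B

/-- The Clifford algebra `C(V)` with relations `v w + w v = 2 ⟨v, w⟩`. -/
abbrev Cl (B : LinearMap.BilinForm F V) : Type _ := CliffordAlgebra (quad B)

/-! ### The `ℤ/2`-gradation of a cocommutative Hopf algebra with an orthogonal module

This is the gradation of `H` as an algebra for which a group-like element `g` has parity
`(-1)^|g| = det (g|V)` and all primitive elements are even. (A pointed cocommutative Hopf algebra
in characteristic `0` is generated by its group-like and primitive elements, so there is at most one
such gradation.) It is realized through the character `det : H → F` by which `H` acts on the top
exterior power of `V`: the homogeneous elements are those with `h₍₁₎ det(h₍₂₎) = (-1)^|h| h`.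
That this is an algebra gradation with the prescribed values is proved below
(`one_mem_parityPart`, `mul_mem_parityPart`, `isCompl_parityPart`, `groupLike_mem_parityPart`,
`primitive_mem_parityPart`). -/

section Parity

variable [Coalgebra.IsCocomm F H]

/-- Pullback along a coalgebra map is a ring map of convolution algebras. -/
def convPullback {C D : Type*} [AddCommGroup C] [Module F C] [Coalgebra F C]
    [AddCommGroup D] [Module F D] [Coalgebra F D] (φ : D →ₗc[F] C) :
    WithConv (C →ₗ[F] F) →+* WithConv (D →ₗ[F] F) where
  toFun f := WithConv.toConv (f.ofConv ∘ₗ φ.toLinearMap)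
  map_one' := by
    ext x
    simp
  map_mul' f g := by
    rw [LinearMap.convMul_comp_coalgHom_distrib]
  map_zero' := by ext; simp
  map_add' f g := by ext; simp

variable [FiniteDimensional F V]

/-- The matrix coefficients of `V`, as elements of the commutative convolution algebra `H^*`. -/
def coeffMatrix (ρ : H →ₐ[F] Module.End F V) :
    Matrix (Fin (Module.finrank F V)) (Fin (Module.finrank F V)) (WithConv (H →ₗ[F] F)) :=
  Matrix.of fun i j => WithConv.toConv
    (((Module.finBasis F V).coord i) ∘ₗ
      (LinearMap.applyₗ ((Module.finBasis F V) j)) ∘ₗ ρ.toLinearMap)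

/-- The determinant of `V` as a linear form on `H`: the determinant, in the commutative convolution
algebra `H^*`, of the matrix of matrix coefficients. -/
def detForm (ρ : H →ₐ[F] Module.End F V) : H →ₗ[F] F := (coeffMatrix ρ).det.ofConv

/-- The twist `h ↦ h₍₁₎ det(h₍₂₎)`. -/
def twist (ρ : H →ₐ[F] Module.End F V) : H →ₗ[F] H :=
  (TensorProduct.rid F H).toLinearMap ∘ₗ LinearMap.lTensor H (detForm ρ) ∘ₗ Coalgebra.comul

/-- The homogeneous component of degree `i` of the `ℤ/2`-gradation of `H` defined by `V`. -/
def parityPart (ρ : H →ₐ[F] Module.End F V) (i : ZMod 2) : Submodule F H :=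
  LinearMap.ker (twist ρ - ((-1 : F) ^ i.val) • LinearMap.id)

theorem mem_parityPart {ρ : H →ₐ[F] Module.End F V} {i : ZMod 2} {h : H} :
    h ∈ parityPart ρ i ↔ twist ρ h = ((-1 : F) ^ i.val) • h := by
  simp [parityPart, sub_eq_zero]

theorem coeffMatrix_apply (ρ : H →ₐ[F] Module.End F V) (i j) (h : H) :
    (coeffMatrix ρ i j).ofConv h
      = (Module.finBasis F V).repr (ρ h (Module.finBasis F V j)) i := rfl

theorem detForm_groupLike (ρ : H →ₐ[F] Module.End F V) {g : H} (hg : IsGroupLikeElem F g) :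
    detForm ρ g = LinearMap.det (ρ g) := by
  let ev : WithConv (H →ₗ[F] F) →+* F :=
    { toFun := fun f => f.ofConv g
      map_one' := by simp [LinearMap.convOne_def, hg.counit_eq_one]
      map_mul' := fun f f' => by simp [LinearMap.convMul_def, hg.comul_eq_tmul_self]
      map_zero' := rfl
      map_add' := fun _ _ => rfl }
  change ev (coeffMatrix ρ).det = _
  rw [RingHom.map_det, ← LinearMap.det_toMatrix (Module.finBasis F V)]
  congr 1
  ext i j
  rw [LinearMap.toMatrix_apply]
  rfl

theorem convMul_tmul (f g : H →ₗ[F] F) (h k : H) :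
    (WithConv.toConv (LinearMap.mul' F F ∘ₗ TensorProduct.map f Coalgebra.counit) *
      WithConv.toConv (LinearMap.mul' F F ∘ₗ TensorProduct.map Coalgebra.counit g)).ofConv
        (h ⊗ₜ[F] k) = f h * g k := by
  let r := Coalgebra.Repr.arbitrary F h
  let s := Coalgebra.Repr.arbitrary F k
  rw [(r.tmul s).convMul_apply]
  have h1 := congrArg (LinearMap.mul' F F) (Coalgebra.sum_map_tmul_counit_eq f h (repr := r))
  have h2 := congrArg (LinearMap.mul' F F) (Coalgebra.sum_counit_tmul_map_eq g k (repr := s))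
  simp only [map_sum, LinearMap.mul'_apply, mul_one, one_mul] at h1 h2
  rw [← h1, ← h2, Finset.sum_mul_sum, ← Finset.sum_product']
  refine Finset.sum_congr rfl fun x _ => ?_
  simp only [Coalgebra.Repr.tmul_left, Coalgebra.Repr.tmul_right, LinearMap.comp_apply,
    TensorProduct.map_tmul, LinearMap.mul'_apply]
  ring

theorem detForm_one (ρ : H →ₐ[F] Module.End F V) : detForm ρ 1 = 1 := by
  rw [detForm_groupLike ρ (g := 1) (by constructor <;> simp [Algebra.TensorProduct.one_def])]
  simp

theorem detForm_mul (ρ : H →ₐ[F] Module.End F V) (h k : H) :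
    detForm ρ (h * k) = detForm ρ h * detForm ρ k := by
  have hc : ∀ h : H, Coalgebra.counit (R := F) h = Coalgebra.counitCoalgHom F H h := fun _ => rfl
  let p₁ : H ⊗[F] H →ₗc[F] H :=
    (Coalgebra.TensorProduct.rid F F H).toCoalgHom.comp
      (Coalgebra.TensorProduct.map (CoalgHom.id F H) (Coalgebra.counitCoalgHom F H))
  let p₂ : H ⊗[F] H →ₗc[F] H :=
    (Coalgebra.TensorProduct.lid F H).toCoalgHom.comp
      (Coalgebra.TensorProduct.map (Coalgebra.counitCoalgHom F H) (CoalgHom.id F H))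
  have key' : ∀ (f g : WithConv (H →ₗ[F] F)) (h k : H),
      (convPullback p₁ f * convPullback p₂ g).ofConv (h ⊗ₜ[F] k) = f.ofConv h * g.ofConv k := by
    intro f g h k
    rw [← convMul_tmul]
    congr 3
    · apply WithConv.ofConv_injective
      ext a b
      simp [convPullback, p₁, mul_comm]
    · apply WithConv.ofConv_injective
      ext a b
      simp [convPullback, p₂]
  have hM : (coeffMatrix ρ).map (convPullback (Bialgebra.mulCoalgHom F H)) =
      (coeffMatrix ρ).map (convPullback p₁) * (coeffMatrix ρ).map (convPullback p₂) := by
    apply Matrix.ext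
    intro i j
    apply WithConv.ofConv_injective
    apply TensorProduct.ext'
    intro x y
    have h1 := congrFun (congrFun (LinearMap.toMatrix_mul (Module.finBasis F V)
      (ρ x) (ρ y)) i) j
    rw [Matrix.mul_apply, ← map_mul] at h1
    simp only [LinearMap.toMatrix_apply, ← coeffMatrix_apply] at h1
    rw [Matrix.mul_apply, WithConv.ofConv_sum, LinearMap.sum_apply]
    refine Eq.trans ?_ (h1.trans (Finset.sum_congr rfl fun l _ => (key' _ _ x y).symm))
    rfl
  have := congrArg Matrix.det hM
  rw [Matrix.det_mul] at this
  simp only [← RingHom.mapMatrix_apply, ← RingHom.map_det] at this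
  have h2 := congrArg (fun f => f.ofConv (h ⊗ₜ[F] k)) this
  rw [key'] at h2
  exact h2

theorem detForm_sq {ρ : H →ₐ[F] Module.End F V} {B : LinearMap.BilinForm F V}
    (hB : IsOrthogonal ρ B) : (coeffMatrix ρ).det * (coeffMatrix ρ).det = 1 := by
  let b := Module.finBasis F V
  let N := LinearMap.BilinForm.toMatrix b B
  let a := algebraMap F (WithConv (H →ₗ[F] F))
  have hN : IsUnit (a.mapMatrix N).det := by
    rw [← RingHom.map_det]
    refine IsUnit.map a (isUnit_iff_ne_zero.mpr ?_)
    rw [← Matrix.nondegenerate_iff_det_ne_zero]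
    exact (LinearMap.BilinForm.nondegenerate_toMatrix_iff b).mpr hB.nondegenerate
  have key : (coeffMatrix ρ).transpose * a.mapMatrix N * coeffMatrix ρ = a.mapMatrix N := by
    apply Matrix.ext
    intro i j
    apply WithConv.ofConv_injective
    ext x
    let r := Coalgebra.Repr.arbitrary F x
    have e1 : (coeffMatrix ρ).transpose * a.mapMatrix N * coeffMatrix ρ =
        Matrix.of fun i j => ∑ l, ∑ k, B (b k) (b l) • (coeffMatrix ρ k i * coeffMatrix ρ l j) := by
      apply Matrix.ext
      intro i j
      simp only [Matrix.mul_apply, Matrix.of_apply, Finset.sum_mul, Matrix.transpose_apply]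
      refine Finset.sum_congr rfl fun l _ => Finset.sum_congr rfl fun k _ => ?_
      have : a.mapMatrix N k l = a (B (b k) (b l)) := by
        simp [N, LinearMap.BilinForm.toMatrix_apply]
      rw [this, Algebra.smul_def]
      ring
    have e2 : ∀ y z : H, ∑ l, ∑ k, B (b k) (b l) *
        ((coeffMatrix ρ k i).ofConv y * (coeffMatrix ρ l j).ofConv z) =
          B (ρ y (b i)) (ρ z (b j)) := by
      intro y z
      conv_rhs => rw [← b.sum_repr (ρ y (b i)), ← b.sum_repr (ρ z (b j))]
      simp only [map_sum, map_smul, LinearMap.sum_apply, LinearMap.smul_apply, smul_eq_mul,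
        coeffMatrix_apply]
      refine Finset.sum_congr rfl fun l _ => ?_
      rw [Finset.mul_sum]
      refine Finset.sum_congr rfl fun k _ => ?_
      simp only [b]
      ring
    have e3 : a.mapMatrix N i j = a (B (b i) (b j)) := by
      simp [N, LinearMap.BilinForm.toMatrix_apply]
    rw [e1, e3, Matrix.of_apply]
    simp only [WithConv.ofConv_sum, LinearMap.sum_apply, WithConv.ofConv_smul,
      LinearMap.smul_apply, r.convMul_apply, smul_eq_mul, Finset.mul_sum]
    have e4 := HopfAlgebra.sum_antipode_mul_eq_smul (R := F) r
    have e5 := congrArg (fun t => B (b i) (ρ t (b j))) e4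
    simp only [map_sum, map_mul, LinearMap.sum_apply, Module.End.mul_apply, map_smul, map_one,
      LinearMap.smul_apply, Module.End.one_apply, smul_eq_mul, ← hB.invariant] at e5
    have e6 : (a (B (b i) (b j))).ofConv x =
        Coalgebra.counit (R := F) x * B (b i) (b j) := by
      simp [a, LinearMap.convAlgebraMap_apply, mul_comm]
    rw [e6, ← e5]
    simp only [← e2]
    refine Eq.trans (Finset.sum_congr rfl fun l _ => Finset.sum_comm) ?_
    exact Finset.sum_comm
  have h := congrArg Matrix.det key
  rw [Matrix.det_mul, Matrix.det_mul, Matrix.det_transpose] at h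
  apply hN.mul_left_cancel
  linear_combination h

/-- The determinant of `V` is a character of `H`. -/
def detChar (ρ : H →ₐ[F] Module.End F V) : H →ₐ[F] F :=
  AlgHom.ofLinearMap (detForm ρ) (detForm_one ρ) (detForm_mul ρ)

theorem twist_one (ρ : H →ₐ[F] Module.End F V) : twist ρ 1 = 1 := by
  simp [twist, Algebra.TensorProduct.one_def, detForm_one]

theorem twist_mul (ρ : H →ₐ[F] Module.End F V) (h k : H) :
    twist ρ (h * k) = twist ρ h * twist ρ k := by
  have : ∀ h, twist ρ h = (Algebra.TensorProduct.rid F F H)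
      (Algebra.TensorProduct.map (AlgHom.id F H) (detChar ρ) (Bialgebra.comulAlgHom F H h)) :=
    fun _ => rfl
  simp only [this, map_mul]

theorem twist_twist {ρ : H →ₐ[F] Module.End F V} {B : LinearMap.BilinForm F V}
    (hB : IsOrthogonal ρ B) (h : H) : twist ρ (twist ρ h) = h := by
  let χ : WithConv (H →ₗ[F] H) := WithConv.toConv (Algebra.linearMap F H ∘ₗ detForm ρ)
  have e1 : ∀ f : H →ₗ[F] H, WithConv.toConv (f ∘ₗ twist ρ) = WithConv.toConv f * χ := by
    intro f
    apply WithConv.ofConv_injective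
    ext x
    rw [(Coalgebra.Repr.arbitrary F x).convMul_apply]
    simp [twist, ← (Coalgebra.Repr.arbitrary F x).eq, χ, Algebra.algebraMap_eq_smul_one]
  have e2 : χ * χ = 1 := by
    have h1 := LinearMap.algHom_comp_convMul_distrib (Algebra.ofId F H)
      (coeffMatrix ρ).det (coeffMatrix ρ).det
    rw [detForm_sq hB] at h1
    exact (congrArg WithConv.toConv h1).symm
  have e3 := e1 (twist ρ)
  have e4 := e1 LinearMap.id
  rw [LinearMap.id_comp] at e4
  rw [e4, mul_assoc, e2, mul_one] at e3
  exact congrArg (fun f => f.ofConv h) e3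

theorem groupLike_mem_parityPart (ρ : H →ₐ[F] Module.End F V) {g : H} (hg : IsGroupLikeElem F g)
    {i : ZMod 2} (hi : LinearMap.det (ρ g) = (-1) ^ i.val) : g ∈ parityPart ρ i := by
  rw [mem_parityPart]
  simp [twist, hg.comul_eq_tmul_self, detForm_groupLike ρ hg, hi]

theorem primitive_mem_parityPart [CharZero F] {ρ : H →ₐ[F] Module.End F V}
    {B : LinearMap.BilinForm F V} (hB : IsOrthogonal ρ B) {x : H} (hx : IsPrimitive F x) :
    x ∈ parityPart ρ 0 := by
  have hx' : Coalgebra.comul (R := F) x = 1 ⊗ₜ[F] x + x ⊗ₜ[F] 1 := hx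
  have h1 : detForm ρ x = 0 := by
    have h2 : detForm ρ x + detForm ρ x = 0 := by
      have h3 := congrArg (fun f => f.ofConv x) (detForm_sq hB)
      have h4 : Coalgebra.counit (R := F) x = 0 := by
        have h5 := Coalgebra.rTensor_counit_comul (R := F) x
        rw [hx'] at h5
        have h6 := congrArg (TensorProduct.lid F H) h5
        have h7 : Coalgebra.counit (R := F) x • (1 : H) = 0 := by simpa using h6
        simpa using congrArg (Coalgebra.counit (R := F)) h7
      have h8 : detForm ρ 1 * detForm ρ x + detForm ρ x * detForm ρ 1 =
          algebraMap F F (Coalgebra.counit (R := F) x) := by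
        refine Eq.trans ?_ h3
        change _ = LinearMap.mul' F F (TensorProduct.map (detForm ρ) (detForm ρ) _)
        rw [hx']
        simp
      simpa [h4, detForm_one] using h8
    exact self_eq_neg.mp (eq_neg_of_add_eq_zero_left h2)
  rw [mem_parityPart]
  simp [twist, hx', detForm_one, h1]

theorem one_mem_parityPart (ρ : H →ₐ[F] Module.End F V) : (1 : H) ∈ parityPart ρ 0 := by
  simp [mem_parityPart, twist_one]

theorem mul_mem_parityPart (ρ : H →ₐ[F] Module.End F V) {i j : ZMod 2} {h k : H}
    (hh : h ∈ parityPart ρ i) (hk : k ∈ parityPart ρ j) : h * k ∈ parityPart ρ (i + j) := by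
  rw [mem_parityPart] at *
  rw [twist_mul, hh, hk, smul_mul_smul_comm]
  congr 1
  rw [ZMod.val_add, ← pow_add, ← neg_one_pow_eq_pow_mod_two]

theorem isCompl_parityPart [CharZero F] {ρ : H →ₐ[F] Module.End F V}
    {B : LinearMap.BilinForm F V} (hB : IsOrthogonal ρ B) :
    IsCompl (parityPart ρ 0) (parityPart ρ 1) := by
  constructor
  · rw [Submodule.disjoint_def]
    intro h h0 h1
    rw [mem_parityPart] at h0 h1
    rw [h0] at h1
    simp [ZMod.val_one] at h1
    have h2 : (2 : F) • h = 0 := by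
      rw [two_smul]
      nth_rewrite 1 [h1]
      simp
    exact (smul_eq_zero.mp h2).resolve_left two_ne_zero
  · rw [codisjoint_iff, eq_top_iff]
    intro h _
    rw [Submodule.mem_sup]
    refine ⟨(2⁻¹ : F) • (h + twist ρ h), ?_, (2⁻¹ : F) • (h - twist ρ h), ?_, ?_⟩
    · simp [mem_parityPart, twist_twist hB, add_comm]
    · simp [mem_parityPart, twist_twist hB, ZMod.val_one]
    · rw [← smul_add]
      simp [← two_smul F h, smul_smul]

end Parity

/-! ### Hopf–Hecke algebras -/

/-- The linear map `H ⊗ H → T(V × H)`, `h ⊗ k ↦ (h · v) k`. -/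
def crossMap (ρ : H →ₐ[F] Module.End F V) (v : V) : H ⊗[F] H →ₗ[F] TensorAlgebra F (V × H) :=
  TensorProduct.lift
    ((LinearMap.mul F (TensorAlgebra F (V × H))).compl₁₂
      (TensorAlgebra.ι F ∘ₗ LinearMap.inl F V H ∘ₗ LinearMap.applyₗ v ∘ₗ ρ.toLinearMap)
      (TensorAlgebra.ι F ∘ₗ LinearMap.inr F V H))

/-- The relations of `(T(V) ⋊ H) / I_κ` between the generators `(v, 0)` and `(0, h)`:
the relations `h * k = hk`, `1 = 1_H` of the algebra `H`, the relations
`h v = (h₍₁₎ · v) h₍₂₎` of the smash product `T(V) ⋊ H`, and `v w - w v = κ(v, w)`. -/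
inductive HeckeRel (ρ : H →ₐ[F] Module.End F V) (κ : V →ₗ[F] V →ₗ[F] H) :
    TensorAlgebra F (V × H) → TensorAlgebra F (V × H) → Prop
  | one : HeckeRel ρ κ (TensorAlgebra.ι F (0, 1)) 1
  | mul (h k : H) : HeckeRel ρ κ
      (TensorAlgebra.ι F (0, h) * TensorAlgebra.ι F (0, k)) (TensorAlgebra.ι F (0, h * k))
  | cross (h : H) (v : V) : HeckeRel ρ κ
      (TensorAlgebra.ι F (0, h) * TensorAlgebra.ι F (v, 0))
      (crossMap ρ v (Coalgebra.comul (R := F) h))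
  | comm (v w : V) : HeckeRel ρ κ
      (TensorAlgebra.ι F (v, 0) * TensorAlgebra.ι F (w, 0)
        - TensorAlgebra.ι F (w, 0) * TensorAlgebra.ι F (v, 0))
      (TensorAlgebra.ι F (0, κ v w))

/-- The algebra `A_κ = (T(V) ⋊ H) / I_κ`. -/
def HeckeAlg (ρ : H →ₐ[F] Module.End F V) (κ : V →ₗ[F] V →ₗ[F] H) : Type _ :=
  RingQuot (HeckeRel ρ κ)

instance (ρ : H →ₐ[F] Module.End F V) (κ : V →ₗ[F] V →ₗ[F] H) : Ring (HeckeAlg ρ κ) :=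
  inferInstanceAs (Ring (RingQuot (HeckeRel ρ κ)))

instance (ρ : H →ₐ[F] Module.End F V) (κ : V →ₗ[F] V →ₗ[F] H) : Algebra F (HeckeAlg ρ κ) :=
  inferInstanceAs (Algebra F (RingQuot (HeckeRel ρ κ)))

namespace HeckeAlg

variable (ρ : H →ₐ[F] Module.End F V) (κ : V →ₗ[F] V →ₗ[F] H)

/-- The quotient map from the free algebra on `V ⊕ H`. -/
def mk : TensorAlgebra F (V × H) →ₐ[F] HeckeAlg ρ κ := RingQuot.mkAlgHom F (HeckeRel ρ κ)

/-- The canonical map `V → A`. -/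
def ofV : V →ₗ[F] HeckeAlg ρ κ :=
  (mk ρ κ).toLinearMap ∘ₗ TensorAlgebra.ι F ∘ₗ LinearMap.inl F V H

/-- The canonical map `H → A`. -/
def ofH : H →ₐ[F] HeckeAlg ρ κ :=
  AlgHom.ofLinearMap ((mk ρ κ).toLinearMap ∘ₗ TensorAlgebra.ι F ∘ₗ LinearMap.inr F V H)
    (by
      have := RingQuot.mkAlgHom_rel F (HeckeRel.one (ρ := ρ) (κ := κ))
      rw [map_one] at this
      exact this)
    (fun h k => by
      have := RingQuot.mkAlgHom_rel F (HeckeRel.mul (ρ := ρ) (κ := κ) h k)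
      rw [map_mul] at this
      exact this.symm)

/-- The step `F_{n-1}` of the filtration of `A` induced by the degree in the tensor factor `T(V)`:
the span of the products `v₁ ⋯ v_k h` with `k < n`. -/
def filtLT (n : ℕ) : Submodule F (HeckeAlg ρ κ) :=
  ⨆ k : Fin n, LinearMap.range (ofV ρ κ) ^ (k : ℕ) * LinearMap.range (ofH ρ κ).toLinearMap

/-- The map `T(V) ⊗ H → A`, `t ⊗ h ↦ t h`. -/
def tensorMap : TensorAlgebra F V ⊗[F] H →ₗ[F] HeckeAlg ρ κ :=
  TensorProduct.lift
    ((LinearMap.mul F (HeckeAlg ρ κ)).compl₁₂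
      (TensorAlgebra.lift F (ofV ρ κ)).toLinearMap (ofH ρ κ).toLinearMap)

end HeckeAlg

variable (F V H) in
/-- The inclusion `T^n(V) ⊗ H → T(V) ⊗ H`. -/
def tensorPowIncl (n : ℕ) :
    ↥(LinearMap.range (TensorAlgebra.ι F (M := V)) ^ n) ⊗[F] H →ₗ[F] TensorAlgebra F V ⊗[F] H :=
  LinearMap.rTensor H (LinearMap.range (TensorAlgebra.ι F (M := V)) ^ n).subtype

variable (F V H) in
/-- The projection `T^n(V) ⊗ H → S^n(V) ⊗ H`, where `S^n(V) ⊗ H ⊆ S(V) ⊗ H`. -/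
def symMap (n : ℕ) :
    ↥(LinearMap.range (TensorAlgebra.ι F (M := V)) ^ n) ⊗[F] H →ₗ[F]
      SymmetricAlgebra F V ⊗[F] H :=
  LinearMap.rTensor H (SymmetricAlgebra.algHom F V).toLinearMap ∘ₗ tensorPowIncl F H V n

/-- The map `T^n(V) ⊗ H → A / F_{n-1}`, whose image is `gr_n A = F_n / F_{n-1}`. -/
def symbolMap (ρ : H →ₐ[F] Module.End F V) (κ : V →ₗ[F] V →ₗ[F] H) (n : ℕ) :
    ↥(LinearMap.range (TensorAlgebra.ι F (M := V)) ^ n) ⊗[F] H →ₗ[F]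
      HeckeAlg ρ κ ⧸ HeckeAlg.filtLT ρ κ n :=
  (HeckeAlg.filtLT ρ κ n).mkQ ∘ₗ HeckeAlg.tensorMap ρ κ ∘ₗ tensorPowIncl F H V n

/-- The PBW property: the natural surjection `S(V) ⋊ H → gr A` is an isomorphism.
As a graded vector space, `S(V) ⋊ H` is `⨁ₙ S^n(V) ⊗ H`, and in degree `n` both
`S^n(V) ⊗ H` and `gr_n A` are quotients of `T^n(V) ⊗ H`; the natural surjection between them
is an isomorphism iff the two kernels coincide. -/
def IsPBW (ρ : H →ₐ[F] Module.End F V) (κ : V →ₗ[F] V →ₗ[F] H) : Prop :=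
  ∀ n : ℕ, LinearMap.ker (symbolMap ρ κ n) = LinearMap.ker (symMap F H V n)

/-- The data `(H, V, κ)`, with the form `B` on `V`, define a Hopf–Hecke algebra: `V` is an
orthogonal `H`-module, `κ` is a linear map `V ∧ V → H`, and `A_κ` has the PBW property. -/
structure IsHopfHecke (ρ : H →ₐ[F] Module.End F V) (B : LinearMap.BilinForm F V)
    (κ : V →ₗ[F] V →ₗ[F] H) : Prop where
  orthogonal : IsOrthogonal ρ B
  alternating : ∀ v : V, κ v v = 0
  pbw : IsPBW ρ κ

/-! ### Pin covers -/

section PinCover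

variable [FiniteDimensional F V]

/-- A pin cover `(H̃, π, γ)` of `H` with respect to the orthogonal module `V`: a pointed
cocommutative Hopf algebra `H̃` with a Hopf algebra epimorphism `π : H̃ → H` which is a double
cover (`H̃ ≅ H ⊕ H` as coalgebras, and `π` restricts to an isomorphism on each copy of `H`),
and an algebra map `γ : H̃ → C(V)` which preserves the `ℤ/2`-gradations and satisfies
`(-1)^|h| π(h) · v = γ(h₍₁₎) v γ(S h₍₂₎)` in `C(V)` for homogeneous `h`. Here `H̃` is graded via
its action on `V` through `π`. -/
structure PinCover (ρ : H →ₐ[F] Module.End F V) (B : LinearMap.BilinForm F V)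
    (K : Type*) [Ring K] [HopfAlgebra F K] [Coalgebra.IsCocomm F K] where
  pointed : IsPointed F K
  π : K →ₐc[F] H
  surjective : Function.Surjective π
  doubleCover : ∃ e : (H × H) ≃ₗc[F] K,
    Function.Bijective (fun h : H => π (e (h, 0))) ∧
      Function.Bijective (fun h : H => π (e (0, h)))
  γ : K →ₐ[F] Cl B
  graded : ∀ (i : ZMod 2), ∀ h ∈ parityPart (ρ.comp (π : K →ₐ[F] H)) i,
    γ h ∈ CliffordAlgebra.evenOdd (quad B) i
  conj_eq : ∀ (i : ZMod 2), ∀ h ∈ parityPart (ρ.comp (π : K →ₐ[F] H)) i, ∀ v : V,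
    CliffordAlgebra.ι (quad B) ((-1 : F) ^ i.val • ρ (π h) v) =
      conj γ (CliffordAlgebra.ι (quad B) v) h

namespace PinCover

variable {ρ : H →ₐ[F] Module.End F V} {B : LinearMap.BilinForm F V}
  {K : Type*} [Ring K] [HopfAlgebra F K] [Coalgebra.IsCocomm F K] (P : PinCover ρ B K)

/-- The homogeneous components of `H̃`. -/
def parity (i : ZMod 2) : Submodule F K := parityPart (ρ.comp (P.π : K →ₐ[F] H)) i

/-- The diagonal map `Δ_C : H̃ → H ⊗ C`, `h ↦ π(h₍₁₎) ⊗ γ(h₍₂₎)`. -/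
def diag : K →ₐ[F] H ⊗[F] Cl B :=
  (Algebra.TensorProduct.map (P.π : K →ₐ[F] H) P.γ).comp (Bialgebra.comulAlgHom F K)

/-- The algebra `H' = H̃ / ker Δ_C`. -/
abbrev Quot : Type _ := K ⧸ RingHom.ker P.diag

/-- `Δ_C` as a map `H̃ → A ⊗ C`. -/
def diagA (κ : V →ₗ[F] V →ₗ[F] H) : K →ₐ[F] HeckeAlg ρ κ ⊗[F] Cl B :=
  (Algebra.TensorProduct.map (HeckeAlg.ofH ρ κ) (AlgHom.id F (Cl B))).comp P.diag

/-- The map `H' → A ⊗ C` induced by `Δ_C`. -/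
def diagQuot (κ : V →ₗ[F] V →ₗ[F] H) : P.Quot →ₐ[F] HeckeAlg ρ κ ⊗[F] Cl B :=
  (Algebra.TensorProduct.map (HeckeAlg.ofH ρ κ) (AlgHom.id F (Cl B))).comp
    (Ideal.kerLiftAlg P.diag)

/-- The subspace `(A ⊗ C)_det^odd`: the elements of `A ⊗ C^odd` on which every homogeneous `h ∈ H̃`
acts by `(-1)^|h| ε(h)`, for the action `h · x = Δ_C(h₍₁₎) x Δ_C(S h₍₂₎)`. -/
def oddDet (κ : V →ₗ[F] V →ₗ[F] H) : Set (HeckeAlg ρ κ ⊗[F] Cl B) :=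
  {x | x ∈ LinearMap.range (LinearMap.lTensor (HeckeAlg ρ κ)
      (CliffordAlgebra.evenOdd (quad B) 1).subtype) ∧
    ∀ (i : ZMod 2), ∀ h ∈ P.parity i,
      conj (P.diagA κ) x h = ((-1 : F) ^ i.val * Coalgebra.counit (R := F) h) • x}

end PinCover

end PinCover

/-! ### The Dirac element -/

/-- The Dirac element `D = ∑ₖ vₖ ⊗ vᵏ ∈ A ⊗ C` of two families of vectors of `V`. -/
def dirac (ρ : H →ₐ[F] Module.End F V) (B : LinearMap.BilinForm F V) (κ : V →ₗ[F] V →ₗ[F] H)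
    {ι : Type*} [Fintype ι] (v v' : ι → V) : HeckeAlg ρ κ ⊗[F] Cl B :=
  ∑ k, HeckeAlg.ofV ρ κ (v k) ⊗ₜ[F] CliffordAlgebra.ι (quad B) (v' k)

/-- The Parthasarathy condition `D² ∈ Z(A ⊗ C) + Δ_C(H̃^even)`. -/
def Parthasarathy [FiniteDimensional F V] {ρ : H →ₐ[F] Module.End F V}
    {B : LinearMap.BilinForm F V} {K : Type*} [Ring K] [HopfAlgebra F K] [Coalgebra.IsCocomm F K]
    (P : PinCover ρ B K) (κ : V →ₗ[F] V →ₗ[F] H) (D : HeckeAlg ρ κ ⊗[F] Cl B) : Prop :=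
  ∃ c ∈ Subalgebra.center F (HeckeAlg ρ κ ⊗[F] Cl B), ∃ h ∈ P.parity 0,
    D ^ 2 = c + P.diagA κ h

end Modules

end BarbaschSahi

end

set_option linter.unusedSectionVars false

noncomputable section

/-! Let `x ↦ x^*` be the grading involution of `A ⊗ C` coming from `C`, and put `d x = D x - x^* D`
(`diracD`). For odd `a` this is `D a + a D`, and `d (z ⊗ 1) = 0` for central `z`. The Dirac element
satisfies `D Δ_C(k) = Δ_C(sgn k) D`, where `sgn` is the parity automorphism of the pin cover
(`dirac_mul_diagA`); since also `Δ_C(k)^* = Δ_C(sgn k)`, the image of `Δ_C` lies in the kernel of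
`d`. Furthermore `d²` is the commutator with `D²`. By the Parthasarathy condition it vanishes on
`detPart p`, the elements of parity `p` on which the pin cover acts by the `p`-th power of the
determinant. So the theorem is a statement about the cohomology of `d` on these subspaces: every
cocycle is `Δ_C(k) + d y`, and no nonzero `Δ_C(k)` is a coboundary.

The cohomology is computed from symbols. By PBW, symmetrization identifies `A ⊗ C` with `F[X] ⊗ (H ⊗
C)` (`acEquiv`). Modulo lower degree, `d` becomes the Koszul differential `∑ X_k ⊗ (L - R)(v'_k)`
(`symm_diracD_sub_koszulD_mem`), where `L_u` is left multiplication by `u` and `R_u (c Δ_C(k)) = c^*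
u Δ_C(k)`. The operators `L - R` and `(L + R) / 2` satisfy the canonical anticommutation relations,
and `H ⊗ C` is generated from the vacuum space `Δ_C(K)`, `K` being the pin cover. Hence the common
kernel of the annihilators is exactly `Δ_C(K)` (`mem_of_forall_annihilated`). The Koszul Laplacian
acts by `2n + 2j` on polynomials of degree `n` tensored with the `j`-th Fock level. In
characteristic zero it is invertible for `n > 0`, and so the Koszul complex is exact there
(`exists_koszul_primitive`).

The pin cover need not be semisimple, so primitives cannot be made equivariant by averaging.
Instead, the Koszul homotopy is itself equivariant up to the determinant, and the inverse of the
Laplacian is a polynomial in the Laplacian, so the explicit primitive stays in the right subspace.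
Removing leading terms one degree at a time gives `exists_eq_diagA_add`: if `x` is in `detPart p`
and `d x` has polynomial degree zero, then `x = Δ_C(k) + d y` with `y` in `detPart (p + 1)`.

Existence is the case `x = z ⊗ 1`. For uniqueness, suppose `Δ_C(k) = d a`; the same statement
applied to `a` gives `a = Δ_C(l) + d y`, so `d a = 0`. Centrality of `ζ(z)` holds because `Δ_C(ζ(z))
= z ⊗ 1 - d a` commutes with the image of `Δ_C`. Multiplicativity follows from linearity of `d` over
`z ⊗ 1` and over such even invariants, and from uniqueness.

Sweedler computations are carried out in convolution algebras of linear maps `K → R`.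
Cocommutativity makes scalar-valued functions (matrix coefficients, the determinant) central there,
and composition with the antipode inverts algebra maps. -/

namespace BarbaschSahi

section

/-! ### Convolution algebras of a cocommutative coalgebra -/

section Convolution

open WithConv

variable {F : Type*} [Field F] {K : Type*} [AddCommGroup K] [Module F K] [Coalgebra F K]
  {R : Type*} [Ring R] [Algebra F R] {R' : Type*} [Ring R'] [Algebra F R']

/-- The linear map `k ↦ ε(k) x`, as an element of the convolution algebra. -/
def convConst (F K : Type*) [Field F] [AddCommGroup K] [Module F K] [Coalgebra F K]
    {R : Type*} [Ring R] [Algebra F R] (x : R) : WithConv (K →ₗ[F] R) :=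
  toConv (LinearMap.toSpanSingleton F R x ∘ₗ Coalgebra.counit)

theorem convConst_apply (x : R) (k : K) :
    (convConst F K x).ofConv k = Coalgebra.counit (R := F) k • x := by
  simp [convConst]

/-- Post-composition of a linear map to the convolution algebra. -/
def convPost (T : R →ₗ[F] R') (f : WithConv (K →ₗ[F] R)) : WithConv (K →ₗ[F] R') :=
  toConv (T ∘ₗ f.ofConv)

@[simp]
theorem convPost_apply (T : R →ₗ[F] R') (f : WithConv (K →ₗ[F] R)) (k : K) :
    (convPost T f).ofConv k = T (f.ofConv k) := rfl

/-- By the counit axiom the constant factor absorbs one Sweedler leg. A relation such as `h x =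
(h₍₁₎ · x) h₍₂₎` thus becomes an equality of two convolution products. -/
theorem convMul_const_apply (f : WithConv (K →ₗ[F] R)) (x : R) (k : K) :
    (f * convConst F K x).ofConv k = f.ofConv k * x := by
  let r := Coalgebra.Repr.arbitrary F k
  have h := congrArg (TensorProduct.rid F K) (Coalgebra.lTensor_counit_comul (R := F) k)
  rw [← r.eq] at h
  have h' := congrArg f.ofConv h
  simp only [map_sum, LinearMap.lTensor_tmul, TensorProduct.rid_tmul, one_smul, map_smul] at h'
  rw [r.convMul_apply, ← h']
  simp [convConst_apply, Finset.sum_mul]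

theorem convConst_mul_apply (f : WithConv (K →ₗ[F] R)) (x : R) (k : K) :
    (convConst F K x * f).ofConv k = x * f.ofConv k := by
  let r := Coalgebra.Repr.arbitrary F k
  have h' := congrArg f.ofConv (Coalgebra.sum_counit_smul r)
  simp only [map_sum, map_smul] at h'
  rw [r.convMul_apply, ← h']
  simp [convConst_apply, Finset.mul_sum]

theorem convConst_mul (x y : R) :
    convConst F K (x * y) = convConst F K x * convConst F K y := by
  apply WithConv.ext
  ext k
  rw [convConst_mul_apply]
  simp [convConst_apply]

theorem convConst_one : convConst F K (1 : R) = 1 := by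
  apply WithConv.ext
  ext k
  simp [convConst_apply, LinearMap.convOne_def, Algebra.algebraMap_eq_smul_one]

theorem convConst_add (x y : R) :
    convConst F K (x + y) = convConst F K x + convConst F K y := by
  apply WithConv.ext
  ext k
  simp [convConst_apply]

theorem convConst_smul (a : F) (x : R) :
    convConst F K (a • x) = a • convConst F K x := by
  apply WithConv.ext
  ext k
  simp [convConst_apply, smul_comm a]

theorem convConst_sum {ι : Type*} (s : Finset ι) (f : ι → R) :
    convConst F K (∑ i ∈ s, f i) = ∑ i ∈ s, convConst F K (f i) := by
  apply WithConv.ext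
  ext k
  simp [convConst_apply, Finset.smul_sum]

theorem convPost_const (T : R →ₗ[F] R') (x : R) :
    convPost T (convConst F K x) = convConst F K (T x) := by
  apply WithConv.ext
  ext k
  simp [convConst_apply]

theorem convPost_add (T : R →ₗ[F] R') (f g : WithConv (K →ₗ[F] R)) :
    convPost T (f + g) = convPost T f + convPost T g := by
  apply WithConv.ext
  ext k
  simp

theorem convPost_smul (T : R →ₗ[F] R') (a : F) (f : WithConv (K →ₗ[F] R)) :
    convPost T (a • f) = a • convPost T f := by
  apply WithConv.ext
  ext k
  simp

theorem convPost_sum (T : R →ₗ[F] R') {ι : Type*} (s : Finset ι)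
    (f : ι → WithConv (K →ₗ[F] R)) :
    convPost T (∑ i ∈ s, f i) = ∑ i ∈ s, convPost T (f i) := by
  apply WithConv.ext
  ext k
  simp

theorem convPost_mul (T : R →ₐ[F] R') (f g : WithConv (K →ₗ[F] R)) :
    convPost T.toLinearMap (f * g) = convPost T.toLinearMap f * convPost T.toLinearMap g :=
  WithConv.ext (LinearMap.algHom_comp_convMul_distrib T f g)

theorem convPost_derivation {R : Type*} [CommRing R] [Algebra F R] (T : Derivation F R R)
    (f g : WithConv (K →ₗ[F] R)) :
    convPost (T : R →ₗ[F] R) (f * g) =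
      f * convPost (T : R →ₗ[F] R) g + convPost (T : R →ₗ[F] R) f * g := by
  apply WithConv.ext
  ext k
  let r := Coalgebra.Repr.arbitrary F k
  rw [convPost_apply, r.convMul_apply, WithConv.ofConv_add, LinearMap.add_apply,
    r.convMul_apply, r.convMul_apply, ← Finset.sum_add_distrib, map_sum]
  refine Finset.sum_congr rfl fun i _ => ?_
  simp [mul_comm]

/-- Cocommutativity lets the two Sweedler legs be exchanged, after which only the values have to
commute. -/
theorem convMul_comm_of_commute [Coalgebra.IsCocomm F K] {f g : WithConv (K →ₗ[F] R)}
    (h : ∀ a b, Commute (f.ofConv a) (g.ofConv b)) : f * g = g * f := by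
  apply WithConv.ext
  ext k
  let r := Coalgebra.Repr.arbitrary F k
  have e : (f * g).ofConv k =
      LinearMap.mul' F R (TensorProduct.map f.ofConv g.ofConv
        (TensorProduct.comm F K K (Coalgebra.comul k))) := by
    rw [Coalgebra.comm_comul]
    rfl
  rw [e, r.convMul_apply, ← r.eq]
  simp [(h _ _).eq]

theorem convConst_commute {f : WithConv (K →ₗ[F] R)} {x : R}
    (h : ∀ a, Commute x (f.ofConv a)) : convConst F K x * f = f * convConst F K x := by
  apply WithConv.ext
  ext k
  rw [convConst_mul_apply, convMul_const_apply, (h k).eq]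

/-- Scalar-valued linear forms in the convolution algebra of `R`-valued maps. -/
def convScalar (R : Type*) [Ring R] [Algebra F R] (r : WithConv (K →ₗ[F] F)) :
    WithConv (K →ₗ[F] R) :=
  convPost (Algebra.linearMap F R) r

theorem convScalar_apply (r : WithConv (K →ₗ[F] F)) (k : K) :
    (convScalar R r).ofConv k = r.ofConv k • 1 := by
  simp [convScalar, Algebra.algebraMap_eq_smul_one]

theorem convScalar_mul (r s : WithConv (K →ₗ[F] F)) :
    convScalar R (r * s) = convScalar R r * convScalar R s :=
  convPost_mul (Algebra.ofId F R) r s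

theorem convScalar_one : convScalar (K := K) R (1 : WithConv (K →ₗ[F] F)) = 1 := by
  apply WithConv.ext
  ext k
  simp [convScalar, LinearMap.convOne_def]

theorem convPost_scalar_mul (T : R →ₗ[F] R') (r : WithConv (K →ₗ[F] F))
    (f : WithConv (K →ₗ[F] R)) :
    convPost T (convScalar R r * f) = convScalar R' r * convPost T f := by
  apply WithConv.ext
  ext k
  let t := Coalgebra.Repr.arbitrary F k
  rw [convPost_apply, t.convMul_apply, t.convMul_apply, map_sum]
  simp [convScalar_apply]

variable [Coalgebra.IsCocomm F K]

/-- This makes the matrix coefficients of a representation and its determinant central, even when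
`R` is noncommutative. -/
theorem convScalar_comm (r : WithConv (K →ₗ[F] F)) (f : WithConv (K →ₗ[F] R)) :
    convScalar R r * f = f * convScalar R r := by
  apply convMul_comm_of_commute
  intro a b
  rw [convScalar_apply]
  exact (Commute.one_left _).smul_left _

end Convolution

end

section

/-! ### Polynomials: coalgebra actions and symmetrization -/

section Polynomial

open WithConv MvPolynomial

variable {F : Type*} [Field F] {ι : Type*}

section Symmetrize

variable [Fintype ι] {A : Type*} [Ring A] [Algebra F A]

/-- The symmetrization map in degree `n`, by recursion on `n`. -/
def symAux (g : ι → A) : ℕ → MvPolynomial ι F →ₗ[F] A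
  | 0 => Algebra.linearMap F A ∘ₗ lcoeff F 0
  | n + 1 => ((n + 1 : F)⁻¹) •
      ∑ k, LinearMap.mulLeft F (g k) ∘ₗ symAux g n ∘ₗ (pderiv k : Derivation F _ _).toLinearMap

/-- The symmetrization map `F[X] → A`, which sends `(∑ a_k X_k)^n` to `(∑ a_k g_k)^n`. -/
def symmetrize (g : ι → A) : MvPolynomial ι F →ₗ[F] A :=
  (basisMonomials ι F).constr F fun s => symAux (F := F) g s.degree (monomial s 1)

/-- `symAux g n` is defined on all polynomials but is meaningful only in degree `n`. Agreement there
makes the recursion available for arbitrary homogeneous polynomials instead of monomials only. -/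
theorem symmetrize_eq_symAux (g : ι → A) {n : ℕ} {f : MvPolynomial ι F} (hf : f.IsHomogeneous n) :
    symmetrize g f = symAux g n f := by
  conv_lhs => rw [f.as_sum]
  conv_rhs => rw [f.as_sum]
  rw [map_sum, map_sum]
  refine Finset.sum_congr rfl fun s hs => ?_
  have h1 : s.degree = n := by
    by_contra h
    exact (mem_support_iff.mp hs) (hf.coeff_eq_zero h)
  have h2 : monomial s (coeff s f) = coeff s f • monomial s (1 : F) := by
    rw [smul_monomial, smul_eq_mul, mul_one]
  rw [h2, map_smul, map_smul]
  congr 1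
  have := (basisMonomials ι F).constr_basis F (fun s => symAux (F := F) g s.degree (monomial s 1)) s
  rw [coe_basisMonomials] at this
  rw [symmetrize, this, h1]

theorem symmetrize_C (g : ι → A) (a : F) : symmetrize g (C a : MvPolynomial ι F) = a • 1 := by
  rw [symmetrize_eq_symAux g (isHomogeneous_C ι a)]
  simp [symAux, lcoeff, Algebra.algebraMap_eq_smul_one]

theorem symmetrize_one (g : ι → A) : symmetrize g (1 : MvPolynomial ι F) = 1 := by
  rw [← C_1, symmetrize_C, one_smul]

/-- A symmetrized product is the average over the choice of its leftmost factor, and the derivatives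
count these choices. All later statements about symmetrization are inductions along this recursion.
-/
theorem symmetrize_succ (g : ι → A) {n : ℕ} {f : MvPolynomial ι F}
    (hf : f.IsHomogeneous (n + 1)) :
    symmetrize g f = (n + 1 : F)⁻¹ • ∑ k, g k * symmetrize g (pderiv k f) := by
  rw [symmetrize_eq_symAux g hf]
  simp only [symAux, LinearMap.smul_apply, LinearMap.sum_apply, LinearMap.comp_apply,
    LinearMap.mulLeft_apply]
  congr 1
  refine Finset.sum_congr rfl fun k _ => ?_
  rw [symmetrize_eq_symAux g (hf.pderiv (i := k))]
  rfl

theorem smul_symmetrize [CharZero F] (g : ι → A) {n : ℕ} {f : MvPolynomial ι F}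
    (hf : f.IsHomogeneous n) :
    (n : F) • symmetrize g f = ∑ k, g k * symmetrize g (pderiv k f) := by
  cases n with
  | zero =>
    rw [← mem_homogeneousSubmodule, homogeneousSubmodule_zero] at hf
    obtain ⟨a, rfl⟩ := Submodule.mem_one.mp hf
    simp [algebraMap_eq]
  | succ n =>
    rw [symmetrize_succ g hf, smul_smul]
    have : (n + 1 : F) ≠ 0 := by exact_mod_cast n.succ_ne_zero
    push_cast
    rw [mul_inv_cancel₀ this, one_smul]

theorem symmetrize_X (g : ι → A) (i : ι) : symmetrize g (X i : MvPolynomial ι F) = g i := by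
  classical
  rw [symmetrize_succ g (n := 0) (isHomogeneous_X F i)]
  simp [pderiv_X, Pi.single_apply, apply_ite (symmetrize (F := F) g), symmetrize_one]

end Symmetrize

section Action

variable [Fintype ι] {K : Type*} [AddCommGroup K] [Module F K] [Coalgebra F K]
  [Coalgebra.IsCocomm F K]

/-- The action on polynomials of a cocommutative coalgebra `K`: `k` acts on the generators
through the matrix `r(k)`, and on products by `k (f g) = (k₍₁₎ f) (k₍₂₎ g)`. -/
def polyAction (r : ι → ι → WithConv (K →ₗ[F] F)) :
    MvPolynomial ι F →ₐ[F] WithConv (K →ₗ[F] MvPolynomial ι F) :=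
  aeval fun k => ∑ l, convScalar _ (r l k) * convConst F K (X l)

variable (r : ι → ι → WithConv (K →ₗ[F] F))

theorem polyAction_X (k : ι) :
    polyAction r (X k) = ∑ l, convScalar _ (r l k) * convConst F K (X l) := by
  simp [polyAction]

/-- The chain rule: the coalgebra acts by linear substitutions with matrix `r`, so the gradient is
transformed by `r`. For products it follows from the Leibniz rule and the multiplicativity of
`polyAction`. -/
theorem pderiv_polyAction (l : ι) (f : MvPolynomial ι F) :
    convPost (pderiv l : Derivation F (MvPolynomial ι F) (MvPolynomial ι F)).toLinearMap
      (polyAction r f) = ∑ k, convScalar _ (r l k) * polyAction r (pderiv k f) := by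
  classical
  induction f using MvPolynomial.induction_on with
  | C a =>
    have : polyAction r (C a) = a • convConst F K 1 := by
      rw [← algebraMap_eq, AlgHom.commutes, convConst_one, Algebra.algebraMap_eq_smul_one]
    rw [this, convPost_smul, convPost_const]
    have h1 : convConst F K (0 : MvPolynomial ι F) = 0 := by
      apply WithConv.ext; ext; simp [convConst_apply]
    simp [h1]
  | add p q hp hq => simp only [map_add, convPost_add, hp, hq, mul_add, Finset.sum_add_distrib]
  | mul_X p i hp =>
    have h0 : convConst F K (0 : MvPolynomial ι F) = 0 := by
      apply WithConv.ext; ext; simp [convConst_apply]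
    have h1 : convPost (pderiv l : Derivation F (MvPolynomial ι F) (MvPolynomial ι F)).toLinearMap
        (polyAction r (X i)) = convScalar _ (r l i) := by
      rw [polyAction_X, convPost_sum]
      simp only [convPost_scalar_mul, convPost_const]
      rw [Finset.sum_eq_single l]
      · simp [convConst_one]
      · intro b _ hb
        simp [pderiv_X, hb, h0]
      · simp
    rw [map_mul]
    refine (convPost_derivation (pderiv l) _ _).trans ?_
    rw [h1]
    refine (congrArg (fun t => polyAction r p * convScalar _ (r l i) + t * polyAction r (X i))
      hp).trans ?_
    simp only [Derivation.leibniz, pderiv_X, map_add, smul_eq_mul, map_mul, mul_add,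
      Finset.sum_add_distrib, Finset.sum_mul]
    congr 1
    · rw [Finset.sum_eq_single i]
      · simp [mul_comm]
      · intro b _ hb
        simp [hb.symm]
      · simp
    · refine Finset.sum_congr rfl fun k _ => ?_
      ring

variable [CharZero F]

theorem polyAction_isHomogeneous {n : ℕ} {f : MvPolynomial ι F} (hf : f.IsHomogeneous n) (k : K) :
    ((polyAction r f).ofConv k).IsHomogeneous n := by
  induction n generalizing f k with
  | zero =>
    rw [← mem_homogeneousSubmodule, homogeneousSubmodule_zero] at hf
    obtain ⟨a, rfl⟩ := Submodule.mem_one.mp hf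
    rw [AlgHom.commutes, Algebra.algebraMap_eq_smul_one, WithConv.ofConv_smul, LinearMap.smul_apply,
      ← mem_homogeneousSubmodule]
    exact Submodule.smul_mem _ _ (isHomogeneous_C ι _)
  | succ n ih =>
    -- Euler's identity writes `f` through products with a generator, on which the multiplicativity
    -- of `polyAction` can be used.
    have h1 : f = (n + 1 : F)⁻¹ • ∑ i, X i * pderiv i f := by
      rw [hf.sum_X_mul_pderiv, ← Nat.cast_smul_eq_nsmul F, smul_smul]
      have : (n + 1 : F) ≠ 0 := by exact_mod_cast n.succ_ne_zero
      push_cast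
      rw [inv_mul_cancel₀ this, one_smul]
    rw [h1, map_smul, map_sum]
    simp only [map_mul, WithConv.ofConv_smul, LinearMap.smul_apply, WithConv.ofConv_sum,
      LinearMap.sum_apply]
    rw [← mem_homogeneousSubmodule]
    refine Submodule.smul_mem _ _ (Submodule.sum_mem _ fun i _ => ?_)
    let t := Coalgebra.Repr.arbitrary F k
    rw [t.convMul_apply]
    refine Submodule.sum_mem _ fun j _ => ?_
    rw [add_comm]
    refine IsHomogeneous.mul ?_ (ih (hf.pderiv (i := i)) _)
    rw [polyAction_X, WithConv.ofConv_sum, LinearMap.sum_apply]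
    rw [← mem_homogeneousSubmodule]
    refine Submodule.sum_mem _ fun l _ => ?_
    rw [convMul_const_apply, convScalar_apply, smul_mul_assoc, one_mul]
    exact Submodule.smul_mem _ _ (isHomogeneous_X F l)

/-- If `φ` passes each generator at the cost of the matrix `r`, it passes a symmetrized polynomial
at the cost of the induced action. The induction peels off the leftmost generator on both sides; the
chain rule makes the two recursions match. -/
theorem convMul_symmetrize {A : Type*} [Ring A] [Algebra F A] (g : ι → A)
    (φ : WithConv (K →ₗ[F] A))
    (hφ : ∀ k, φ * convConst F K (g k) =
      ∑ l, convScalar A (r l k) * convConst F K (g l) * φ) {n : ℕ}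
    {f : MvPolynomial ι F} (hf : f.IsHomogeneous n) :
    φ * convConst F K (symmetrize g f) = convPost (symmetrize g) (polyAction r f) * φ := by
  induction n generalizing f with
  | zero =>
    rw [← mem_homogeneousSubmodule, homogeneousSubmodule_zero] at hf
    obtain ⟨a, rfl⟩ := Submodule.mem_one.mp hf
    rw [AlgHom.commutes, algebraMap_eq, symmetrize_C, Algebra.algebraMap_eq_smul_one,
      ← convConst_one, convPost_smul, convPost_const, symmetrize_one, convConst_smul,
      convConst_one]
    simp
  | succ n ih =>
    -- The recursion is applied after the action, which preserves degree, and the derivatives are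
    -- then moved inside by the chain rule.
    have h1 : convPost (symmetrize g) (polyAction r f) = (n + 1 : F)⁻¹ •
        ∑ l, convConst F K (g l) * ∑ k, convScalar A (r l k) *
          convPost (symmetrize g) (polyAction r (pderiv k f)) := by
      have h2 : convPost (symmetrize g) (polyAction r f) = (n + 1 : F)⁻¹ •
          ∑ l, convConst F K (g l) * convPost (symmetrize g)
            (convPost (pderiv l : Derivation F (MvPolynomial ι F) (MvPolynomial ι F)).toLinearMap
              (polyAction r f)) := by
        apply WithConv.ext
        ext k
        rw [convPost_apply, symmetrize_succ g (polyAction_isHomogeneous r hf k)]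
        simp only [WithConv.ofConv_smul, LinearMap.smul_apply, WithConv.ofConv_sum,
          LinearMap.sum_apply, convConst_mul_apply]
        rfl
      rw [h2]
      simp only [pderiv_polyAction, convPost_sum, convPost_scalar_mul]
    rw [h1, symmetrize_succ g hf, convConst_smul, convConst_sum, mul_smul_comm, smul_mul_assoc]
    congr 1
    simp only [convConst_mul, Finset.mul_sum, Finset.sum_mul, ← mul_assoc, hφ]
    rw [Finset.sum_comm]
    refine Finset.sum_congr rfl fun l _ => Finset.sum_congr rfl fun k _ => ?_
    rw [mul_assoc _ φ, ih (hf.pderiv (i := k)), convScalar_comm, mul_assoc, mul_assoc,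
      mul_assoc]

end Action

end Polynomial

end

section

/-! ### The filtration and the PBW basis of a Hopf–Hecke algebra -/

namespace HeckeAlg

variable {F : Type*} [Field F] {H : Type*} [Ring H] [HopfAlgebra F H]
  {V : Type*} [AddCommGroup V] [Module F V]
  (ρ : H →ₐ[F] Module.End F V) (κ : V →ₗ[F] V →ₗ[F] H)

theorem mk_surjective : Function.Surjective (mk ρ κ) := RingQuot.mkAlgHom_surjective F _

theorem ofH_mul_ofV (h : H) (u : V) :
    ofH ρ κ h * ofV ρ κ u = LinearMap.mul' F (HeckeAlg ρ κ)
      (TensorProduct.map (ofV ρ κ ∘ₗ LinearMap.applyₗ u ∘ₗ ρ.toLinearMap) (ofH ρ κ).toLinearMap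
        (Coalgebra.comul (R := F) h)) := by
  have h1 := RingQuot.mkAlgHom_rel F (HeckeRel.cross (ρ := ρ) (κ := κ) h u)
  rw [map_mul] at h1
  refine h1.trans ?_
  have h2 : ∀ t : H ⊗[F] H, mk ρ κ (crossMap ρ u t) = LinearMap.mul' F (HeckeAlg ρ κ)
      (TensorProduct.map (ofV ρ κ ∘ₗ LinearMap.applyₗ u ∘ₗ ρ.toLinearMap)
        (ofH ρ κ).toLinearMap t) := by
    intro t
    induction t with
    | zero => simp
    | add x y hx hy => simp only [map_add, hx, hy]
    | tmul x y => exact map_mul (mk ρ κ) _ _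
  exact h2 _

theorem ofV_mul_sub (u w : V) :
    ofV ρ κ u * ofV ρ κ w - ofV ρ κ w * ofV ρ κ u = ofH ρ κ (κ u w) := by
  have h1 := RingQuot.mkAlgHom_rel F (HeckeRel.comm (ρ := ρ) (κ := κ) u w)
  rw [map_sub, map_mul, map_mul] at h1
  exact h1

/-- Stability under the generators `V` and `H` makes `S` a left ideal, and it contains `1`. -/
theorem eq_top_of_mul_mem {S : Submodule F (HeckeAlg ρ κ)} (h1 : 1 ∈ S)
    (hV : ∀ u, ∀ a ∈ S, ofV ρ κ u * a ∈ S) (hH : ∀ h, ∀ a ∈ S, ofH ρ κ h * a ∈ S) : S = ⊤ := by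
  rw [eq_top_iff]
  rintro a -
  obtain ⟨t, rfl⟩ := mk_surjective ρ κ a
  suffices ∀ b ∈ S, mk ρ κ t * b ∈ S by simpa using this 1 h1
  induction t using TensorAlgebra.induction with
  | algebraMap r =>
    intro b hb
    rw [AlgHom.commutes, ← Algebra.smul_def]
    exact S.smul_mem r hb
  | ι x =>
    intro b hb
    have : mk ρ κ (TensorAlgebra.ι F x) = ofV ρ κ x.1 + ofH ρ κ x.2 := by
      change _ = mk ρ κ (TensorAlgebra.ι F (x.1, 0)) + mk ρ κ (TensorAlgebra.ι F (0, x.2))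
      rw [← map_add, ← map_add]
      simp
    rw [this, add_mul]
    exact S.add_mem (hV _ _ hb) (hH _ _ hb)
  | mul x y hx hy =>
    intro b hb
    rw [map_mul, mul_assoc]
    exact hx _ (hy _ hb)
  | add x y hx hy =>
    intro b hb
    rw [map_add, add_mul]
    exact S.add_mem (hx _ hb) (hy _ hb)

theorem rangeH_mul_rangeV_pow_le (n : ℕ) :
    LinearMap.range (ofH ρ κ).toLinearMap * LinearMap.range (ofV ρ κ) ^ n ≤
      LinearMap.range (ofV ρ κ) ^ n * LinearMap.range (ofH ρ κ).toLinearMap := by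
  have h1 : LinearMap.range (ofH ρ κ).toLinearMap * LinearMap.range (ofV ρ κ) ≤
      LinearMap.range (ofV ρ κ) * LinearMap.range (ofH ρ κ).toLinearMap := by
    rw [Submodule.mul_le]
    rintro _ ⟨h, rfl⟩ _ ⟨u, rfl⟩
    change ofH ρ κ h * ofV ρ κ u ∈ _
    let r := Coalgebra.Repr.arbitrary F h
    rw [ofH_mul_ofV, ← r.eq]
    simp only [map_sum]
    exact Submodule.sum_mem _ fun i _ => Submodule.mul_mem_mul ⟨_, rfl⟩ ⟨_, rfl⟩
  induction n with
  | zero => simp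
  | succ n ih =>
    calc _ = LinearMap.range (ofH ρ κ).toLinearMap * LinearMap.range (ofV ρ κ) ^ n *
          LinearMap.range (ofV ρ κ) := by rw [pow_succ, mul_assoc]
      _ ≤ LinearMap.range (ofV ρ κ) ^ n * LinearMap.range (ofH ρ κ).toLinearMap *
          LinearMap.range (ofV ρ κ) := mul_le_mul' ih le_rfl
      _ ≤ _ := by
        rw [mul_assoc, pow_succ, mul_assoc]
        exact mul_le_mul' le_rfl h1

theorem rangeH_mul_rangeH_le :
    LinearMap.range (ofH ρ κ).toLinearMap * LinearMap.range (ofH ρ κ).toLinearMap ≤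
      LinearMap.range (ofH ρ κ).toLinearMap := by
  rw [Submodule.mul_le]
  rintro _ ⟨h, rfl⟩ _ ⟨k, rfl⟩
  exact ⟨h * k, map_mul (ofH ρ κ) h k⟩

theorem filtLT_mono {m n : ℕ} (h : m ≤ n) : filtLT ρ κ m ≤ filtLT ρ κ n :=
  iSup_le fun k => le_iSup (fun k : Fin n => LinearMap.range (ofV ρ κ) ^ (k : ℕ) *
    LinearMap.range (ofH ρ κ).toLinearMap) ⟨k, k.2.trans_le h⟩

theorem rangeV_pow_mul_rangeH_le (n : ℕ) :
    LinearMap.range (ofV ρ κ) ^ n * LinearMap.range (ofH ρ κ).toLinearMap ≤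
      filtLT ρ κ (n + 1) :=
  le_iSup (fun k : Fin (n + 1) => LinearMap.range (ofV ρ κ) ^ (k : ℕ) *
    LinearMap.range (ofH ρ κ).toLinearMap) ⟨n, n.lt_succ_self⟩

theorem filtLT_succ (n : ℕ) : filtLT ρ κ (n + 1) = filtLT ρ κ n ⊔
    LinearMap.range (ofV ρ κ) ^ n * LinearMap.range (ofH ρ κ).toLinearMap := by
  apply le_antisymm
  · refine iSup_le fun k => ?_
    rcases (Nat.lt_succ_iff_lt_or_eq.mp k.2) with h | h
    · exact le_sup_of_le_left (le_iSup (fun k : Fin n => LinearMap.range (ofV ρ κ) ^ (k : ℕ) *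
        LinearMap.range (ofH ρ κ).toLinearMap) ⟨k, h⟩)
    · rw [h]
      exact le_sup_right
  · exact sup_le (filtLT_mono ρ κ n.le_succ) (rangeV_pow_mul_rangeH_le ρ κ n)

theorem filtLT_zero : filtLT ρ κ 0 = ⊥ := by
  simp [filtLT]

theorem ofV_mul_mem {n : ℕ} (u : V) {a : HeckeAlg ρ κ} (ha : a ∈ filtLT ρ κ n) :
    ofV ρ κ u * a ∈ filtLT ρ κ (n + 1) := by
  have : filtLT ρ κ n ≤ (filtLT ρ κ (n + 1)).comap (LinearMap.mulLeft F (ofV ρ κ u)) := by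
    refine iSup_le fun k => ?_
    rw [← Submodule.map_le_iff_le_comap]
    rintro _ ⟨b, hb, rfl⟩
    refine filtLT_mono ρ κ (Nat.succ_le_succ k.2) (rangeV_pow_mul_rangeH_le ρ κ (k + 1) ?_)
    rw [pow_succ', mul_assoc]
    exact Submodule.mul_mem_mul ⟨u, rfl⟩ hb
  exact this ha

theorem ofH_mul_mem {n : ℕ} (h : H) {a : HeckeAlg ρ κ} (ha : a ∈ filtLT ρ κ n) :
    ofH ρ κ h * a ∈ filtLT ρ κ n := by
  have : filtLT ρ κ n ≤ (filtLT ρ κ n).comap (LinearMap.mulLeft F (ofH ρ κ h)) := by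
    refine iSup_le fun k => ?_
    rw [← Submodule.map_le_iff_le_comap]
    rintro _ ⟨b, hb, rfl⟩
    refine filtLT_mono ρ κ (Nat.succ_le_of_lt k.2) (rangeV_pow_mul_rangeH_le ρ κ k ?_)
    refine mul_le_mul' le_rfl (rangeH_mul_rangeH_le ρ κ) ?_
    rw [← mul_assoc]
    refine mul_le_mul' (rangeH_mul_rangeV_pow_le ρ κ k) le_rfl ?_
    rw [mul_assoc]
    exact Submodule.mul_mem_mul ⟨h, rfl⟩ hb
  exact this ha

theorem mul_ofH_mem {n : ℕ} (h : H) {a : HeckeAlg ρ κ} (ha : a ∈ filtLT ρ κ n) :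
    a * ofH ρ κ h ∈ filtLT ρ κ n := by
  have : filtLT ρ κ n ≤ (filtLT ρ κ n).comap (LinearMap.mulRight F (ofH ρ κ h)) := by
    refine iSup_le fun k => ?_
    rw [← Submodule.map_le_iff_le_comap]
    rintro _ ⟨b, hb, rfl⟩
    refine filtLT_mono ρ κ (Nat.succ_le_of_lt k.2) (rangeV_pow_mul_rangeH_le ρ κ k ?_)
    refine mul_le_mul' le_rfl (rangeH_mul_rangeH_le ρ κ) ?_
    rw [← mul_assoc]
    exact Submodule.mul_mem_mul hb ⟨h, rfl⟩
  exact this ha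

theorem exists_mem_filtLT (a : HeckeAlg ρ κ) : ∃ n, a ∈ filtLT ρ κ n := by
  have hmono : Monotone (filtLT ρ κ) := fun _ _ h => filtLT_mono ρ κ h
  suffices (⨆ n, filtLT ρ κ n) = ⊤ by
    rw [← Submodule.mem_iSup_of_directed _ hmono.directed_le, this]
    trivial
  apply eq_top_of_mul_mem
  · refine Submodule.mem_iSup_of_mem 1 (rangeV_pow_mul_rangeH_le ρ κ 0 ?_)
    rw [pow_zero, one_mul]
    exact ⟨1, map_one (ofH ρ κ)⟩
  · intro u a ha
    rw [Submodule.mem_iSup_of_directed _ hmono.directed_le] at ha ⊢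
    obtain ⟨n, hn⟩ := ha
    exact ⟨n + 1, ofV_mul_mem ρ κ u hn⟩
  · intro h a ha
    rw [Submodule.mem_iSup_of_directed _ hmono.directed_le] at ha ⊢
    obtain ⟨n, hn⟩ := ha
    exact ⟨n, ofH_mul_mem ρ κ h hn⟩

/-! #### Symmetrized monomials -/

open MvPolynomial

variable {ι : Type*} [Fintype ι] (v : Module.Basis ι F V)

/-- The symmetrization map `F[X] → A`, `X_k ↦ v_k`. -/
def sym : MvPolynomial ι F →ₗ[F] HeckeAlg ρ κ := symmetrize fun k => ofV ρ κ (v k)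

variable [CharZero F]

theorem sym_mem {n : ℕ} {f : MvPolynomial ι F} (hf : f.IsHomogeneous n) :
    sym ρ κ v f ∈ filtLT ρ κ (n + 1) := by
  induction n generalizing f with
  | zero =>
    rw [← mem_homogeneousSubmodule, homogeneousSubmodule_zero] at hf
    obtain ⟨a, rfl⟩ := Submodule.mem_one.mp hf
    rw [algebraMap_eq, sym, symmetrize_C]
    refine Submodule.smul_mem _ _ (rangeV_pow_mul_rangeH_le ρ κ 0 ?_)
    rw [pow_zero, one_mul]
    exact ⟨1, map_one (ofH ρ κ)⟩
  | succ n ih =>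
    rw [sym, symmetrize_succ _ hf]
    exact Submodule.smul_mem _ _ (Submodule.sum_mem _ fun k _ =>
      ofV_mul_mem ρ κ _ (ih (hf.pderiv (i := k))))

/-- The commutator of two vectors is `κ(u, w) ∈ H`, of degree zero, so the difference loses both
degrees that the two vectors would add. -/
theorem ofV_mul_ofV_mul_sub_mem {n : ℕ} (u w : V) {a : HeckeAlg ρ κ} (ha : a ∈ filtLT ρ κ n) :
    ofV ρ κ u * (ofV ρ κ w * a) - ofV ρ κ w * (ofV ρ κ u * a) ∈ filtLT ρ κ n := by
  rw [← mul_assoc, ← mul_assoc, ← sub_mul, ofV_mul_sub]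
  exact ofH_mul_mem ρ κ _ ha

/-- Reordering factors only produces commutators, which have lower degree; hence symmetrization is
multiplicative on symbols. Both terms have degree at most `n + 1`, while their difference has degree
at most `n`. -/
theorem sym_X_mul_sub_mem (k : ι) {n : ℕ} {f : MvPolynomial ι F} (hf : f.IsHomogeneous n) :
    sym ρ κ v (X k * f) - ofV ρ κ (v k) * sym ρ κ v f ∈ filtLT ρ κ (n + 1) := by
  classical
  induction n generalizing f with
  | zero =>
    rw [← mem_homogeneousSubmodule, homogeneousSubmodule_zero] at hf
    obtain ⟨a, rfl⟩ := Submodule.mem_one.mp hf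
    have : X k * (algebraMap F (MvPolynomial ι F) a) = a • X k := by
      rw [Algebra.smul_def, mul_comm]
    rw [this, algebraMap_eq, map_smul, sym, symmetrize_X, symmetrize_C]
    simp
  | succ n ih =>
    have h1 : (X k * f).IsHomogeneous (n + 1 + 1) := by
      rw [add_comm]
      exact (isHomogeneous_X F k).mul hf
    have h2 := symmetrize_succ (fun k => ofV ρ κ (v k)) h1
    have h3 := smul_symmetrize (fun k => ofV ρ κ (v k)) hf
    have hne : ((n + 1 : ℕ) + 1 : F) ≠ 0 := by exact_mod_cast (n + 1).succ_ne_zero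
    have h4 : ∑ l, ofV ρ κ (v l) * sym ρ κ v (pderiv l (X k * f)) =
        ofV ρ κ (v k) * sym ρ κ v f + ∑ l, ofV ρ κ (v l) * sym ρ κ v (X k * pderiv l f) := by
      simp only [Derivation.leibniz, pderiv_X, map_add, smul_eq_mul, mul_add,
        Finset.sum_add_distrib]
      rw [add_comm]
      congr 1
      rw [Finset.sum_eq_single k]
      · simp
      · intro b _ hb
        simp [hb.symm]
      · simp
    -- Here `f` has degree `n + 1`. Of the `n + 2` copies of `v_k sym(f)`, one cancels against the
    -- Leibniz term with `∂_k X_k = 1`; the other `n + 1` are expanded by the recursion for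
    -- `sym(f)`.
    have h5 : sym ρ κ v (X k * f) - ofV ρ κ (v k) * sym ρ κ v f =
        ((n + 1 : ℕ) + 1 : F)⁻¹ • ∑ l, (ofV ρ κ (v l) * sym ρ κ v (X k * pderiv l f) -
          ofV ρ κ (v k) * (ofV ρ κ (v l) * sym ρ κ v (pderiv l f))) := by
      rw [Finset.sum_sub_distrib, ← Finset.mul_sum]
      have h6 : ∑ l, ofV ρ κ (v l) * sym ρ κ v (pderiv l f) =
          ((n + 1 : ℕ) : F) • sym ρ κ v f := h3.symm
      have h7 : sym ρ κ v (X k * f) = ((n + 1 : ℕ) + 1 : F)⁻¹ •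
        ∑ l, ofV ρ κ (v l) * sym ρ κ v (pderiv l (X k * f)) := h2
      rw [h6, h7, h4, eq_inv_smul_iff₀ hne, smul_sub, smul_inv_smul₀ hne, mul_smul_comm,
        add_smul, one_smul]
      abel
    rw [h5]
    refine Submodule.smul_mem _ _ (Submodule.sum_mem _ fun l _ => ?_)
    have h8 := ofV_mul_mem ρ κ (v l) (ih (hf.pderiv (i := l)))
    have h9 := ofV_mul_ofV_mul_sub_mem ρ κ (v l) (v k) (sym_mem ρ κ v (hf.pderiv (i := l)))
    have := Submodule.add_mem _ h8 (filtLT_mono ρ κ (Nat.le_succ _) h9)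
    rw [mul_sub, sub_add_sub_cancel] at this
    exact this

/-- Right multiplication by a vector has the same symbol as left multiplication. This is needed for
the term `x^* D` of the Dirac differential. -/
theorem sym_mul_sub_mem (u : V) {n : ℕ} {f : MvPolynomial ι F} (hf : f.IsHomogeneous n) :
    sym ρ κ v f * ofV ρ κ u - ofV ρ κ u * sym ρ κ v f ∈ filtLT ρ κ (n + 1) := by
  induction n generalizing f with
  | zero =>
    rw [← mem_homogeneousSubmodule, homogeneousSubmodule_zero] at hf
    obtain ⟨a, rfl⟩ := Submodule.mem_one.mp hf
    rw [algebraMap_eq, sym, symmetrize_C]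
    simp
  | succ n ih =>
    have h1 : sym ρ κ v f = (n + 1 : F)⁻¹ • ∑ k, ofV ρ κ (v k) * sym ρ κ v (pderiv k f) :=
      symmetrize_succ (fun k => ofV ρ κ (v k)) hf
    rw [h1, smul_mul_assoc, mul_smul_comm, ← smul_sub, Finset.sum_mul, Finset.mul_sum,
      ← Finset.sum_sub_distrib]
    refine Submodule.smul_mem _ _ (Submodule.sum_mem _ fun l _ => ?_)
    have h8 := ofV_mul_mem ρ κ (v l) (ih (hf.pderiv (i := l)))
    have h9 := ofV_mul_ofV_mul_sub_mem ρ κ (v l) u (sym_mem ρ κ v (hf.pderiv (i := l)))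
    have := Submodule.add_mem _ h8 (filtLT_mono ρ κ (Nat.le_succ _) h9)
    rw [mul_sub, sub_add_sub_cancel, ← mul_assoc] at this
    exact this

end HeckeAlg

end

section

/-! ### Polynomials with values in a module -/

section PolyModule

open MvPolynomial

variable {F : Type*} [Field F] {ι : Type*} {N : Type*} [AddCommGroup N] [Module F N]

variable (F ι N) in
/-- The projection of `F[X] ⊗ N` to its component of degree `n`. -/
def polyComp (n : ℕ) : MvPolynomial ι F ⊗[F] N →ₗ[F] MvPolynomial ι F ⊗[F] N :=
  LinearMap.rTensor N (homogeneousComponent n)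

theorem polyComp_tmul {m n : ℕ} {f : MvPolynomial ι F} (hf : f.IsHomogeneous m) (x : N) :
    polyComp F ι N n (f ⊗ₜ x) = if n = m then f ⊗ₜ x else 0 := by
  rw [polyComp, LinearMap.rTensor_tmul, homogeneousComponent_of_mem hf]
  split_ifs <;> simp

theorem polyComp_mem {S : Submodule F (MvPolynomial ι F ⊗[F] N)} {n : ℕ}
    (h : ∀ f : MvPolynomial ι F, f.IsHomogeneous n → ∀ x : N, f ⊗ₜ x ∈ S)
    (w : MvPolynomial ι F ⊗[F] N) : polyComp F ι N n w ∈ S := by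
  induction w with
  | zero => simp
  | add x y hx hy => rw [map_add]; exact S.add_mem hx hy
  | tmul f x => exact h _ (homogeneousComponent_isHomogeneous n f) x

theorem polyComp_polyComp (m n : ℕ) (w : MvPolynomial ι F ⊗[F] N) :
    polyComp F ι N m (polyComp F ι N n w) = if m = n then polyComp F ι N n w else 0 := by
  induction w with
  | zero => simp
  | add x y hx hy => rw [map_add, map_add, hx, hy]; split_ifs <;> simp
  | tmul f x => exact polyComp_tmul (homogeneousComponent_isHomogeneous n f) x

variable (F ι N) in
/-- The elements of degree less than `n` in `F[X] ⊗ N`. -/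
def polyLT (n : ℕ) : Submodule F (MvPolynomial ι F ⊗[F] N) :=
  ⨅ (i : ℕ) (_ : n ≤ i), LinearMap.ker (polyComp F ι N i)

theorem mem_polyLT {n : ℕ} {w : MvPolynomial ι F ⊗[F] N} :
    w ∈ polyLT F ι N n ↔ ∀ i, n ≤ i → polyComp F ι N i w = 0 := by
  simp [polyLT]

theorem polyLT_mono {m n : ℕ} (h : m ≤ n) : polyLT F ι N m ≤ polyLT F ι N n := by
  intro w hw
  rw [mem_polyLT] at hw ⊢
  exact fun i hi => hw i (h.trans hi)

theorem tmul_mem_polyLT {n : ℕ} {f : MvPolynomial ι F} (hf : f.IsHomogeneous n) (x : N) :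
    f ⊗ₜ x ∈ polyLT F ι N (n + 1) := by
  rw [mem_polyLT]
  intro i hi
  rw [polyComp_tmul hf, if_neg (by omega)]

theorem polyComp_mem_polyLT (n : ℕ) (w : MvPolynomial ι F ⊗[F] N) :
    polyComp F ι N n w ∈ polyLT F ι N (n + 1) :=
  polyComp_mem (fun _ hf x => tmul_mem_polyLT hf x) w

theorem exists_mem_polyLT_sum (w : MvPolynomial ι F ⊗[F] N) :
    ∃ n, w ∈ polyLT F ι N n ∧ ∑ i ∈ Finset.range n, polyComp F ι N i w = w := by
  -- Asking for all large `m` allows a common bound for the two terms of a sum.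
  suffices h : ∃ n, ∀ m, n ≤ m →
      w ∈ polyLT F ι N m ∧ ∑ i ∈ Finset.range m, polyComp F ι N i w = w by
    obtain ⟨n, hn⟩ := h
    exact ⟨n, hn n le_rfl⟩
  induction w with
  | zero => exact ⟨0, fun m _ => by simp⟩
  | add x y hx hy =>
    obtain ⟨a, ha⟩ := hx
    obtain ⟨b, hb⟩ := hy
    refine ⟨max a b, fun m hm => ?_⟩
    have h1 := ha m ((le_max_left _ _).trans hm)
    have h2 := hb m ((le_max_right _ _).trans hm)
    refine ⟨Submodule.add_mem _ h1.1 h2.1, ?_⟩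
    simp only [map_add, Finset.sum_add_distrib, h1.2, h2.2]
  | tmul f x =>
    refine ⟨f.totalDegree + 1, fun m hm => ?_⟩
    have h0 : ∀ i, m ≤ i → homogeneousComponent i f = 0 := fun i hi =>
      homogeneousComponent_eq_zero i f (by omega)
    constructor
    · rw [mem_polyLT]
      intro i hi
      rw [polyComp, LinearMap.rTensor_tmul, h0 i hi, TensorProduct.zero_tmul]
    · simp only [polyComp, LinearMap.rTensor_tmul]
      rw [← TensorProduct.sum_tmul]
      congr 1
      conv_rhs => rw [← sum_homogeneousComponent f]
      symm
      refine Finset.sum_subset (Finset.range_mono hm) fun i _ hi => ?_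
      rw [Finset.mem_range, not_lt] at hi
      exact homogeneousComponent_eq_zero i f (by omega)

theorem sum_polyComp {n : ℕ} {w : MvPolynomial ι F ⊗[F] N} (hw : w ∈ polyLT F ι N n) :
    ∑ i ∈ Finset.range n, polyComp F ι N i w = w := by
  obtain ⟨m, hm, h⟩ := exists_mem_polyLT_sum w
  rw [mem_polyLT] at hm hw
  rcases le_total m n with hmn | hmn
  · rw [← Finset.sum_subset (Finset.range_mono hmn) fun i _ hi => hm i (by simpa using hi), h]
  · conv_rhs => rw [← h]
    exact Finset.sum_subset (Finset.range_mono hmn) fun i _ hi => hw i (by simpa using hi)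

theorem polyLT_zero : polyLT F ι N 0 = ⊥ := by
  rw [eq_bot_iff]
  intro w hw
  rw [Submodule.mem_bot, ← sum_polyComp hw]
  simp

theorem mem_polyLT_of_succ {n : ℕ} {w : MvPolynomial ι F ⊗[F] N} (hw : w ∈ polyLT F ι N (n + 1))
    (h : polyComp F ι N n w = 0) : w ∈ polyLT F ι N n := by
  rw [mem_polyLT] at hw ⊢
  intro i hi
  rcases hi.lt_or_eq with hi | rfl
  · exact hw i hi
  · exact h

theorem sub_polyComp_mem {n : ℕ} {w : MvPolynomial ι F ⊗[F] N} (hw : w ∈ polyLT F ι N (n + 1)) :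
    w - polyComp F ι N n w ∈ polyLT F ι N n := by
  apply mem_polyLT_of_succ
  · exact Submodule.sub_mem _ hw (polyComp_mem_polyLT n w)
  · rw [map_sub, polyComp_polyComp, if_pos rfl, sub_self]

theorem polyLT_le {S : Submodule F (MvPolynomial ι F ⊗[F] N)} {n : ℕ}
    (h : ∀ m < n, ∀ f : MvPolynomial ι F, f.IsHomogeneous m → ∀ x : N, f ⊗ₜ x ∈ S) :
    polyLT F ι N n ≤ S := by
  intro w hw
  rw [← sum_polyComp hw]
  exact Submodule.sum_mem _ fun i hi => polyComp_mem (h i (Finset.mem_range.mp hi)) w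

end PolyModule

/-! ### The PBW basis of symmetrized monomials -/

namespace HeckeAlg

open MvPolynomial

variable {F : Type*} [Field F] {H : Type*} [Ring H] [HopfAlgebra F H]
  {V : Type*} [AddCommGroup V] [Module F V]
  (ρ : H →ₐ[F] Module.End F V) (κ : V →ₗ[F] V →ₗ[F] H)
  {ι : Type*} [Fintype ι] (v : Module.Basis ι F V)

/-- The map `F[X] ⊗ H → A`, `f ⊗ h ↦ sym(f) h`. -/
def pbwMap : MvPolynomial ι F ⊗[F] H →ₗ[F] HeckeAlg ρ κ :=
  TensorProduct.lift ((LinearMap.mul F (HeckeAlg ρ κ)).compl₁₂ (sym ρ κ v)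
    (ofH ρ κ).toLinearMap)

@[simp]
theorem pbwMap_tmul (f : MvPolynomial ι F) (h : H) :
    pbwMap ρ κ v (f ⊗ₜ h) = sym ρ κ v f * ofH ρ κ h := rfl

/-- The projection from the tensor algebra of `V` to the polynomial algebra. -/
def polyOfTensor : TensorAlgebra F V →ₐ[F] MvPolynomial ι F :=
  (SymmetricAlgebra.equivMvPolynomial v : SymmetricAlgebra F V →ₐ[F] MvPolynomial ι F).comp
    (SymmetricAlgebra.algHom F V)

theorem polyOfTensor_ι (u : V) :
    polyOfTensor v (TensorAlgebra.ι F u) = ∑ k, v.repr u k • X k := by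
  conv_lhs => rw [← v.sum_repr u]
  simp only [map_sum, map_smul]
  refine Finset.sum_congr rfl fun k _ => ?_
  congr 1
  exact SymmetricAlgebra.equivMvPolynomial_ι_apply v k

theorem map_polyOfTensor_pow (n : ℕ) :
    (LinearMap.range (TensorAlgebra.ι F (M := V)) ^ n).map (polyOfTensor v).toLinearMap =
      homogeneousSubmodule ι F n := by
  rw [Submodule.map_pow, ← homogeneousSubmodule_one_pow]
  congr 1
  apply le_antisymm
  · rintro _ ⟨_, ⟨u, rfl⟩, rfl⟩
    rw [AlgHom.toLinearMap_apply, polyOfTensor_ι]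
    exact Submodule.sum_mem _ fun k _ => Submodule.smul_mem _ _ (isHomogeneous_X F k)
  · rw [homogeneousSubmodule_one_eq_span_X, Submodule.span_le]
    rintro _ ⟨k, rfl⟩
    refine ⟨TensorAlgebra.ι F (v k), ⟨v k, rfl⟩, ?_⟩
    exact SymmetricAlgebra.equivMvPolynomial_ι_apply v k

variable [CharZero F]

/-- Splitting off the left vector reduces this to `sym_X_mul_sub_mem`. It translates the PBW
property, which concerns tensors, into one about symmetrized polynomials. -/
theorem lift_ofV_sub_sym_mem {n : ℕ} {t : TensorAlgebra F V}
    (ht : t ∈ LinearMap.range (TensorAlgebra.ι F (M := V)) ^ n) :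
    TensorAlgebra.lift F (ofV ρ κ) t - sym ρ κ v (polyOfTensor v t) ∈ filtLT ρ κ n := by
  induction ht using Submodule.pow_induction_on_left' with
  | algebraMap a =>
    rw [AlgHom.commutes, AlgHom.commutes, algebraMap_eq, sym, symmetrize_C,
      Algebra.algebraMap_eq_smul_one, sub_self]
    exact Submodule.zero_mem _
  | add x y i hx hy ihx ihy =>
    rw [map_add, map_add, map_add, add_sub_add_comm]
    exact Submodule.add_mem _ ihx ihy
  | mem_mul m hm i x hx ih =>
    obtain ⟨u, rfl⟩ := hm
    have hh : (polyOfTensor v x).IsHomogeneous i := by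
      rw [← mem_homogeneousSubmodule, ← map_polyOfTensor_pow v]
      exact ⟨x, hx, rfl⟩
    have h1 : sym ρ κ v (polyOfTensor v (TensorAlgebra.ι F u * x)) =
        ∑ k, v.repr u k • sym ρ κ v (X k * polyOfTensor v x) := by
      rw [map_mul, polyOfTensor_ι, Finset.sum_mul, map_sum]
      simp only [smul_mul_assoc, map_smul]
    have h2 : ofV ρ κ u * sym ρ κ v (polyOfTensor v x) =
        ∑ k, v.repr u k • (ofV ρ κ (v k) * sym ρ κ v (polyOfTensor v x)) := by
      conv_lhs => rw [← v.sum_repr u]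
      simp only [map_sum, map_smul, Finset.sum_mul, smul_mul_assoc]
    have h3 : ofV ρ κ u * sym ρ κ v (polyOfTensor v x) -
        sym ρ κ v (polyOfTensor v (TensorAlgebra.ι F u * x)) ∈ filtLT ρ κ (i + 1) := by
      rw [h1, h2, ← Finset.sum_sub_distrib]
      refine Submodule.sum_mem _ fun k _ => ?_
      rw [← smul_sub, ← neg_sub, smul_neg]
      exact Submodule.neg_mem _ (Submodule.smul_mem _ _ (sym_X_mul_sub_mem ρ κ v k hh))
    have h4 := Submodule.add_mem _ (ofV_mul_mem ρ κ u ih) h3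
    rw [mul_sub, sub_add_sub_cancel] at h4
    rw [map_mul, TensorAlgebra.lift_ι_apply]
    exact h4

theorem pbwMap_mem {n : ℕ} {w : MvPolynomial ι F ⊗[F] H} (hw : w ∈ polyLT F ι H n) :
    pbwMap ρ κ v w ∈ filtLT ρ κ n := by
  have : polyLT F ι H n ≤ (filtLT ρ κ n).comap (pbwMap ρ κ v) :=
    polyLT_le fun m hm f hf x =>
      filtLT_mono ρ κ (Nat.succ_le_of_lt hm) (mul_ofH_mem ρ κ x (sym_mem ρ κ v hf))
  exact this hw

theorem filtLT_le_map_pbwMap (n : ℕ) :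
    filtLT ρ κ n ≤ (polyLT F ι H n).map (pbwMap ρ κ v) := by
  induction n with
  | zero => rw [filtLT_zero]; exact bot_le
  | succ n ih =>
    rw [filtLT_succ]
    have ih' := ih.trans (Submodule.map_mono (polyLT_mono n.le_succ))
    refine sup_le ih' ?_
    have h1 : LinearMap.range (ofV ρ κ) ^ n =
        (LinearMap.range (TensorAlgebra.ι F (M := V)) ^ n).map
          (TensorAlgebra.lift F (ofV ρ κ)).toLinearMap := by
      rw [Submodule.map_pow]
      congr 1
      ext a
      simp
    rw [h1, Submodule.mul_le]
    rintro _ ⟨t, ht, rfl⟩ _ ⟨h, rfl⟩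
    have h2 := lift_ofV_sub_sym_mem ρ κ v ht
    have hh : (polyOfTensor v t).IsHomogeneous n := by
      rw [← mem_homogeneousSubmodule, ← map_polyOfTensor_pow v]
      exact ⟨t, ht, rfl⟩
    have h3 := Submodule.add_mem _ (ih' (mul_ofH_mem ρ κ h h2))
      (Submodule.mem_map_of_mem (f := pbwMap ρ κ v) (tmul_mem_polyLT hh h))
    rw [pbwMap_tmul, ← add_mul, sub_add_cancel] at h3
    exact h3

variable {ρ κ}

/-- This is where the equality of kernels in `IsPBW` enters. A homogeneous element is lifted to
`T^n(V) ⊗ H`; its image has vanishing symbol in `A`, so the lift dies in `S^n(V) ⊗ H`, that is, the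
polynomial itself is zero. -/
theorem polyComp_eq_zero_of_pbwMap_mem (hA : IsPBW ρ κ) {n : ℕ} {w : MvPolynomial ι F ⊗[F] H}
    (hw : pbwMap ρ κ v (polyComp F ι H n w) ∈ filtLT ρ κ n) : polyComp F ι H n w = 0 := by
  let T := ↥(LinearMap.range (TensorAlgebra.ι F (M := V)) ^ n)
  let φ : T ⊗[F] H →ₗ[F] MvPolynomial ι F ⊗[F] H :=
    LinearMap.rTensor H ((polyOfTensor v).toLinearMap ∘ₗ Submodule.subtype _)
  have h1 : polyComp F ι H n w ∈ LinearMap.range φ := by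
    refine polyComp_mem (fun f hf x => ?_) w
    rw [← mem_homogeneousSubmodule, ← map_polyOfTensor_pow v] at hf
    obtain ⟨t, ht, rfl⟩ := hf
    exact ⟨(⟨t, ht⟩ : T) ⊗ₜ x, rfl⟩
  obtain ⟨t, ht⟩ := h1
  have h2 : ∀ t : T ⊗[F] H,
      tensorMap ρ κ (tensorPowIncl F H V n t) - pbwMap ρ κ v (φ t) ∈ filtLT ρ κ n := by
    intro t
    induction t with
    | zero => simp
    | add x y hx hy =>
      simp only [map_add]
      rw [add_sub_add_comm]
      exact Submodule.add_mem _ hx hy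
    | tmul t h =>
      have := mul_ofH_mem ρ κ h (lift_ofV_sub_sym_mem ρ κ v t.2)
      rw [sub_mul] at this
      exact this
  have h3 : t ∈ LinearMap.ker (symbolMap ρ κ n) := by
    rw [LinearMap.mem_ker]
    change (filtLT ρ κ n).mkQ (tensorMap ρ κ (tensorPowIncl F H V n t)) = 0
    rw [Submodule.mkQ_apply, Submodule.Quotient.mk_eq_zero]
    have := Submodule.add_mem _ (h2 t) (ht ▸ hw)
    rwa [sub_add_cancel] at this
  rw [hA n, LinearMap.mem_ker] at h3
  have h4 : ∀ t : T ⊗[F] H, φ t = LinearMap.rTensor H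
      (SymmetricAlgebra.equivMvPolynomial v).toLinearMap (symMap F H V n t) := by
    intro t
    induction t with
    | zero => simp
    | add x y hx hy => simp only [map_add, hx, hy]
    | tmul t h => rfl
  rw [← ht, h4, h3, map_zero]

/-- Injectivity: an element of the kernel has its top component mapped into lower degree, so that
component vanishes, and the degree drops until nothing is left. -/
theorem pbwMap_bijective (hA : IsPBW ρ κ) : Function.Bijective (pbwMap ρ κ v) := by
  constructor
  · rw [injective_iff_map_eq_zero]
    intro w hw
    obtain ⟨n, hn, -⟩ := exists_mem_polyLT_sum w
    induction n with
    | zero =>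
      rw [polyLT_zero] at hn
      exact hn
    | succ n ih =>
      refine ih (mem_polyLT_of_succ hn (polyComp_eq_zero_of_pbwMap_mem v hA ?_))
      have := Submodule.neg_mem _ (pbwMap_mem ρ κ v (sub_polyComp_mem hn))
      rwa [map_sub, hw, zero_sub, neg_neg] at this
  · intro a
    obtain ⟨n, hn⟩ := exists_mem_filtLT ρ κ a
    obtain ⟨w, -, hw⟩ := filtLT_le_map_pbwMap ρ κ v n hn
    exact ⟨w, hw⟩

end HeckeAlg

end

section

/-! ### Representations and convolution -/

section Representation

open WithConv

variable {F : Type*} [Field F] {K : Type*} [Ring K] [HopfAlgebra F K] [Coalgebra.IsCocomm F K]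
  {R : Type*} [Ring R] [Algebra F R] {V : Type*} [AddCommGroup V] [Module F V]

theorem toConv_mul_antipode (f : K →ₐ[F] R) :
    toConv f.toLinearMap * toConv (f.toLinearMap ∘ₗ HopfAlgebra.antipode F) = 1 := by
  have h := convPost_mul f (toConv LinearMap.id) (toConv (HopfAlgebra.antipode F (A := K)))
  rw [LinearMap.id_mul_antipode] at h
  refine Eq.trans h.symm ?_
  apply WithConv.ext
  ext x
  simp [LinearMap.convOne_def]

theorem antipode_mul_toConv (f : K →ₐ[F] R) :
    toConv (f.toLinearMap ∘ₗ HopfAlgebra.antipode F) * toConv f.toLinearMap = 1 := by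
  have h := convPost_mul f (toConv (HopfAlgebra.antipode F (A := K))) (toConv LinearMap.id)
  rw [LinearMap.antipode_mul_id] at h
  refine Eq.trans h.symm ?_
  apply WithConv.ext
  ext x
  simp [LinearMap.convOne_def]

theorem toConv_conj (f : K →ₐ[F] R) (x : R) :
    toConv (conj f x) = toConv f.toLinearMap * convConst F K x *
      toConv (f.toLinearMap ∘ₗ HopfAlgebra.antipode F) := by
  apply WithConv.ext
  ext k
  let r := Coalgebra.Repr.arbitrary F k
  rw [r.convMul_apply]
  change conj f x k = _
  rw [conj, LinearMap.comp_apply, ← r.eq]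
  simp only [convMul_const_apply]
  simp

/-- Both sides are convolution inverses of `π`, a left one and a right one. -/
theorem bialgHom_antipode {H : Type*} [Ring H] [HopfAlgebra F H] (π : K →ₐc[F] H) (k : K) :
    π (HopfAlgebra.antipode F k) = HopfAlgebra.antipode F (π k) := by
  have h1 := toConv_mul_antipode (π : K →ₐ[F] H)
  have h2 : toConv (HopfAlgebra.antipode F (A := H) ∘ₗ (π : K →ₗc[F] H).toLinearMap) *
      toConv (π : K →ₐ[F] H).toLinearMap = 1 := by
    have h := LinearMap.convMul_comp_coalgHom_distrib
      (toConv (HopfAlgebra.antipode F (A := H))) (toConv LinearMap.id) (π : K →ₗc[F] H)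
    rw [LinearMap.antipode_mul_id] at h
    apply WithConv.ext
    refine Eq.trans h.symm ?_
    ext x
    simp [LinearMap.convOne_def]
  have h3 := left_inv_eq_right_inv h2 h1
  exact (congrArg (fun f => f.ofConv k) h3).symm

/-- The action of `K` on a vector `u`, followed by a linear map `g`. -/
def convAct (σ : K →ₐ[F] Module.End F V) (g : V →ₗ[F] R) (u : V) : WithConv (K →ₗ[F] R) :=
  toConv (g ∘ₗ LinearMap.applyₗ u ∘ₗ σ.toLinearMap)

theorem convAct_apply (σ : K →ₐ[F] Module.End F V) (g : V →ₗ[F] R) (u : V) (k : K) :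
    (convAct σ g u).ofConv k = g (σ k u) := rfl

/-- The matrix coefficients of a representation with respect to a basis. -/
def convCoeff {ι : Type*} (σ : K →ₐ[F] Module.End F V) (v : Module.Basis ι F V) (l k : ι) :
    WithConv (K →ₗ[F] F) :=
  toConv (v.coord l ∘ₗ LinearMap.applyₗ (v k) ∘ₗ σ.toLinearMap)

theorem convCoeff_apply {ι : Type*} (σ : K →ₐ[F] Module.End F V) (v : Module.Basis ι F V)
    (l k : ι) (x : K) : (convCoeff σ v l k).ofConv x = v.repr (σ x (v k)) l := rfl

theorem convAct_basis {ι : Type*} [Fintype ι] (σ : K →ₐ[F] Module.End F V)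
    (v : Module.Basis ι F V) (g : V →ₗ[F] R) (k : ι) :
    convAct σ g (v k) = ∑ l, convScalar R (convCoeff σ v l k) * convConst F K (g (v l)) := by
  apply WithConv.ext
  ext x
  rw [convAct_apply]
  conv_lhs => rw [← v.sum_repr (σ x (v k))]
  simp only [WithConv.ofConv_sum, LinearMap.sum_apply, convMul_const_apply, convScalar_apply,
    convCoeff_apply, map_sum, map_smul, smul_mul_assoc, one_mul]

variable {ρ : K →ₐ[F] Module.End F V} {B : LinearMap.BilinForm F V}

theorem sum_bilin_act (hB : IsOrthogonal ρ B) {x : K} {κ : Type*} (r : Coalgebra.Repr F x κ)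
    (u w : V) :
    ∑ i ∈ r.index, B (ρ (r.left i) u) (ρ (r.right i) w) =
      Coalgebra.counit (R := F) x * B u w := by
  simp only [hB.invariant, ← Module.End.mul_apply, ← map_mul]
  rw [← map_sum, ← LinearMap.sum_apply, ← map_sum,
    HopfAlgebra.sum_antipode_mul_eq_smul r, map_smul, map_one]
  simp

section DualBases

variable {ι : Type*} [Fintype ι] [DecidableEq ι] {v v' : Module.Basis ι F V}

theorem bilin_eq_sum (hv : ∀ i j, B (v i) (v' j) = if i = j then 1 else 0) (u w : V) :
    B u w = ∑ k, v.repr u k * v'.repr w k := by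
  conv_lhs => rw [← v.sum_repr u, ← v'.sum_repr w]
  simp only [map_sum, map_smul, LinearMap.sum_apply, LinearMap.smul_apply, hv, smul_eq_mul]
  refine Finset.sum_congr rfl fun k _ => ?_
  simp [mul_comm]

/-- Invariance of the form gives the product of the two coefficient matrices in the opposite order.
Their entries lie in a commutative ring because of cocommutativity, so a one-sided inverse is
two-sided. -/
theorem convCoeff_mul_eq_one (hB : IsOrthogonal ρ B)
    (hv : ∀ i j, B (v i) (v' j) = if i = j then 1 else 0) (l m : ι) :
    ∑ k, convCoeff ρ v l k * convCoeff ρ v' m k = if l = m then 1 else 0 := by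
  have h : (Matrix.of (convCoeff ρ v')).transpose * Matrix.of (convCoeff ρ v) = 1 := by
    apply Matrix.ext
    intro k l
    apply WithConv.ext
    ext x
    let r := Coalgebra.Repr.arbitrary F x
    simp only [Matrix.mul_apply, Matrix.transpose_apply, Matrix.of_apply, WithConv.ofConv_sum,
      LinearMap.sum_apply, r.convMul_apply, convCoeff_apply]
    rw [Finset.sum_comm]
    have h1 := sum_bilin_act hB r (v' k) (v l)
    have h2 : ∀ a b, B a b = ∑ k, v'.repr a k * v.repr b k := by
      intro a b
      rw [hB.symm.eq a b, bilin_eq_sum hv]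
      exact Finset.sum_congr rfl fun k _ => mul_comm _ _
    rw [hB.symm.eq (v' k) (v l), hv] at h1
    simp only [h2] at h1
    rw [h1, Matrix.one_apply]
    by_cases hkl : k = l
    · simp [hkl, LinearMap.convOne_def]
    · simp [hkl, Ne.symm hkl]
  have h0 := mul_eq_one_comm.mp h
  have h' := congrFun (congrFun h0 l) m
  simpa [Matrix.mul_apply, Matrix.one_apply] using h'

/-- The canonical tensor `∑ v_k ⊗ v'_k` is invariant, since dual bases transform by contragredient
matrices. The maps `g` and `g'` need not have commuting values, because the coefficients are
central. -/
theorem sum_convAct_mul_convAct (hB : IsOrthogonal ρ B)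
    (hv : ∀ i j, B (v i) (v' j) = if i = j then 1 else 0) (g g' : V →ₗ[F] R) :
    ∑ k, convAct ρ g (v k) * convAct ρ g' (v' k) =
      convConst F K (∑ k, g (v k) * g' (v' k)) := by
  have h1 : ∀ k, convAct ρ g (v k) * convAct ρ g' (v' k) = ∑ l, ∑ m,
      convScalar R (convCoeff ρ v l k * convCoeff ρ v' m k) *
        convConst F K (g (v l) * g' (v' m)) := by
    intro k
    rw [convAct_basis, convAct_basis, Finset.sum_mul_sum]
    refine Finset.sum_congr rfl fun l _ => Finset.sum_congr rfl fun m _ => ?_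
    rw [convScalar_mul, convConst_mul, mul_assoc, mul_assoc, ← mul_assoc (convConst F K _),
      ← convScalar_comm, mul_assoc]
  simp only [h1]
  rw [Finset.sum_comm, convConst_sum]
  refine Finset.sum_congr rfl fun l _ => ?_
  rw [Finset.sum_comm, Finset.sum_eq_single l]
  · rw [← Finset.sum_mul]
    have : ∑ k, convScalar R (convCoeff ρ v l k * convCoeff ρ v' l k) = 1 := by
      have h2 := convCoeff_mul_eq_one hB hv l l
      rw [if_pos rfl] at h2
      simp only [convScalar] at h2 ⊢
      rw [← convPost_sum, h2]
      exact convScalar_one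
    rw [this, one_mul]
  · intro m _ hm
    rw [← Finset.sum_mul]
    have : ∑ k, convScalar R (convCoeff ρ v l k * convCoeff ρ v' m k) = 0 := by
      have h2 := convCoeff_mul_eq_one hB hv l m
      rw [if_neg hm.symm] at h2
      simp only [convScalar] at h2 ⊢
      rw [← convPost_sum, h2]
      apply WithConv.ext
      ext
      simp
    rw [this, zero_mul]
  · simp

end DualBases

variable [FiniteDimensional F V]

/-- The parity automorphism thus becomes multiplication by a central element, whose square is `1`
for an orthogonal module. -/
theorem toConv_comp_twist (σ : K →ₐ[F] Module.End F V) (f : K →ₗ[F] R) :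
    toConv (f ∘ₗ twist σ) = toConv f * convScalar R (coeffMatrix σ).det := by
  apply WithConv.ext
  ext x
  let r := Coalgebra.Repr.arbitrary F x
  rw [r.convMul_apply]
  simp [twist, ← r.eq, convScalar_apply, detForm]

theorem convScalar_det_sq (hB : IsOrthogonal ρ B) :
    convScalar R (coeffMatrix ρ).det * convScalar R (coeffMatrix ρ).det = 1 := by
  rw [← convScalar_mul, detForm_sq hB, convScalar_one]

end Representation

end

section

/-! ### The diagonal map of a pin cover -/

open WithConv

variable {F : Type*} [Field F] {H : Type*} [Ring H] [HopfAlgebra F H]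
  {V : Type*} [AddCommGroup V] [Module F V] [FiniteDimensional F V]
  {ρ : H →ₐ[F] Module.End F V} {B : LinearMap.BilinForm F V}
  {K : Type*} [Ring K] [HopfAlgebra F K] [Coalgebra.IsCocomm F K]

theorem HeckeAlg.toConv_ofH_mul (κ : V →ₗ[F] V →ₗ[F] H) (π : K →ₐc[F] H) (u : V) :
    toConv ((ofH ρ κ).toLinearMap ∘ₗ (π : K →ₐ[F] H).toLinearMap) *
        convConst F K (ofV ρ κ u) =
      convAct (ρ.comp (π : K →ₐ[F] H)) (ofV ρ κ) u *
        toConv ((ofH ρ κ).toLinearMap ∘ₗ (π : K →ₐ[F] H).toLinearMap) := by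
  apply WithConv.ext
  ext k
  rw [convMul_const_apply]
  let r := Coalgebra.Repr.arbitrary F k
  rw [r.convMul_apply]
  have h : Coalgebra.comul (R := F) (π k) = TensorProduct.map (π : K →ₗc[F] H).toLinearMap
      (π : K →ₗc[F] H).toLinearMap (Coalgebra.comul k) :=
    (CoalgHomClass.map_comp_comul_apply (π : K →ₗc[F] H) k).symm
  refine (ofH_mul_ofV ρ κ (π k) u).trans ?_
  rw [h, ← r.eq]
  simp only [map_sum]
  rfl

namespace PinCover

variable (P : PinCover ρ B K)

/-- The action of `H̃` on `V`. -/
abbrev rep : K →ₐ[F] Module.End F V := ρ.comp (P.π : K →ₐ[F] H)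

theorem rep_orthogonal (hB : IsOrthogonal ρ B) : IsOrthogonal P.rep B where
  symm := hB.symm
  nondegenerate := hB.nondegenerate
  invariant h u w := by
    refine (hB.invariant (P.π h) u w).trans ?_
    rw [← bialgHom_antipode]
    rfl

theorem mem_of_forall_parity [CharZero F] (hB : IsOrthogonal ρ B) {S : Submodule F K}
    (h : ∀ i, P.parity i ≤ S) (k : K) : k ∈ S := by
  have := (isCompl_parityPart (P.rep_orthogonal hB)).sup_eq_top
  have hle : (⊤ : Submodule F K) ≤ S := by
    rw [← this]
    exact sup_le (h 0) (h 1)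
  exact hle trivial

theorem eq_of_forall_parity [CharZero F] (hB : IsOrthogonal ρ B) {N : Type*} [AddCommGroup N]
    [Module F N] {f g : K →ₗ[F] N} (h : ∀ i, ∀ k ∈ P.parity i, f k = g k) : f = g := by
  ext k
  exact P.mem_of_forall_parity hB (S := LinearMap.eqLocus f g) h k

/-- The parity automorphism of `H̃`. -/
abbrev sgn : K →ₗ[F] K := twist P.rep

theorem sgn_sgn (hB : IsOrthogonal ρ B) (k : K) : P.sgn (P.sgn k) = k :=
  twist_twist (P.rep_orthogonal hB) k

theorem sgn_of_mem {i : ZMod 2} {k : K} (hk : k ∈ P.parity i) :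
    P.sgn k = ((-1 : F) ^ i.val) • k := mem_parityPart.mp hk

theorem involute_γ [CharZero F] (hB : IsOrthogonal ρ B) (k : K) :
    CliffordAlgebra.involute (P.γ k) = P.γ (P.sgn k) := by
  suffices (CliffordAlgebra.involute (Q := quad B)).toLinearMap ∘ₗ P.γ.toLinearMap =
      P.γ.toLinearMap ∘ₗ P.sgn from congrArg (fun f => f k) this
  apply P.eq_of_forall_parity hB
  intro i k hk
  simp only [LinearMap.comp_apply, AlgHom.toLinearMap_apply, P.sgn_of_mem hk, map_smul]
  have h := P.graded i k hk
  have hi : ∀ i : ZMod 2, i = 0 ∨ i = 1 := by decide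
  rcases hi i with rfl | rfl
  · exact (CliffordAlgebra.involute_eq_of_mem_even h).trans (by simp)
  · exact (CliffordAlgebra.involute_eq_of_mem_odd h).trans (by simp [ZMod.val_one])

theorem conj_γ [CharZero F] (hB : IsOrthogonal ρ B) (u : V) :
    conj P.γ (CliffordAlgebra.ι (quad B) u) =
      CliffordAlgebra.ι (quad B) ∘ₗ LinearMap.applyₗ u ∘ₗ P.rep.toLinearMap ∘ₗ P.sgn := by
  apply P.eq_of_forall_parity hB
  intro i k hk
  rw [← P.conj_eq i k hk]
  simp [P.sgn_of_mem hk]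

/-- The determinant of `V` in the center of the convolution algebra of `H̃`. -/
abbrev convDet (R : Type*) [Ring R] [Algebra F R] : WithConv (K →ₗ[F] R) :=
  convScalar R (coeffMatrix P.rep).det

theorem toConv_involute_γ [CharZero F] (hB : IsOrthogonal ρ B) :
    toConv ((CliffordAlgebra.involute (Q := quad B)).toLinearMap ∘ₗ P.γ.toLinearMap) =
      toConv P.γ.toLinearMap * P.convDet (Cl B) := by
  rw [← toConv_comp_twist]
  congr 1
  ext k
  exact P.involute_γ hB k

/-- The relation `γ(h₍₁₎) u γ(S h₍₂₎) = (-1)^|h| h · u` is solved for `γ`. The involution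
contributes a second factor `det`, and since `det² = 1` the untwisted action remains. -/
theorem toConv_involute_γ_mul [CharZero F] (hB : IsOrthogonal ρ B) (u : V) :
    toConv ((CliffordAlgebra.involute (Q := quad B)).toLinearMap ∘ₗ P.γ.toLinearMap) *
        convConst F K (CliffordAlgebra.ι (quad B) u) =
      convAct P.rep (CliffordAlgebra.ι (quad B)) u * toConv P.γ.toLinearMap := by
  have h1 := congrArg toConv (P.conj_γ hB u)
  rw [toConv_conj] at h1
  have h2 : toConv (CliffordAlgebra.ι (quad B) ∘ₗ LinearMap.applyₗ u ∘ₗ P.rep.toLinearMap ∘ₗ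
      P.sgn) = convAct P.rep (CliffordAlgebra.ι (quad B)) u * P.convDet (Cl B) :=
    toConv_comp_twist P.rep
      (CliffordAlgebra.ι (quad B) ∘ₗ LinearMap.applyₗ u ∘ₗ P.rep.toLinearMap)
  rw [h2] at h1
  have h3 : toConv P.γ.toLinearMap * convConst F K (CliffordAlgebra.ι (quad B) u) =
      convAct P.rep (CliffordAlgebra.ι (quad B)) u * P.convDet (Cl B) *
        toConv P.γ.toLinearMap := by
    rw [← h1, mul_assoc _ _ (toConv P.γ.toLinearMap), antipode_mul_toConv, mul_one]
  rw [P.toConv_involute_γ hB, ← convScalar_comm, mul_assoc, h3, ← convScalar_comm, mul_assoc,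
    ← mul_assoc, convScalar_det_sq (P.rep_orthogonal hB), one_mul]

theorem toConv_diag {Q : Type*} [Ring Q] [Algebra F Q] (J : H ⊗[F] Cl B →ₐ[F] Q) :
    toConv (J.comp P.diag).toLinearMap =
      toConv ((J.comp (Algebra.TensorProduct.includeLeft.comp (P.π : K →ₐ[F] H))).toLinearMap) *
        toConv ((J.comp (Algebra.TensorProduct.includeRight.comp P.γ)).toLinearMap) := by
  apply WithConv.ext
  ext k
  let r := Coalgebra.Repr.arbitrary F k
  rw [r.convMul_apply]
  simp only [diag, AlgHom.toLinearMap_apply, AlgHom.comp_apply, Bialgebra.comulAlgHom_apply,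
    ← map_mul]
  rw [← r.eq]
  simp

section DiagA

variable (κ : V →ₗ[F] V →ₗ[F] H)

variable (ρ B) in
/-- The grading involution of `A ⊗ C`. -/
def invA : HeckeAlg ρ κ ⊗[F] Cl B →ₐ[F] HeckeAlg ρ κ ⊗[F] Cl B :=
  Algebra.TensorProduct.map (AlgHom.id F _) CliffordAlgebra.involute

variable (B) in
/-- The grading involution of `H ⊗ C`. -/
def invH : H ⊗[F] Cl B →ₐ[F] H ⊗[F] Cl B :=
  Algebra.TensorProduct.map (AlgHom.id F _) CliffordAlgebra.involute

variable (ρ B) in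
/-- The map `H ⊗ C → A ⊗ C`. -/
def inclA : H ⊗[F] Cl B →ₐ[F] HeckeAlg ρ κ ⊗[F] Cl B :=
  Algebra.TensorProduct.map (HeckeAlg.ofH ρ κ) (AlgHom.id F (Cl B))

theorem diagA_eq (k : K) : P.diagA κ k = inclA ρ B κ (P.diag k) := rfl

theorem invA_inclA (m : H ⊗[F] Cl B) : invA ρ B κ (inclA ρ B κ m) = inclA ρ B κ (invH B m) := by
  induction m with
  | zero => simp
  | add x y hx hy => simp only [map_add, hx, hy]
  | tmul h c => rfl

theorem invA_invA (x : HeckeAlg ρ κ ⊗[F] Cl B) : invA ρ B κ (invA ρ B κ x) = x := by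
  induction x with
  | zero => simp
  | add x y hx hy => simp only [map_add, hx, hy]
  | tmul h c => simp [invA]

theorem invH_diag [CharZero F] (hB : IsOrthogonal ρ B) (k : K) :
    invH B (P.diag k) = P.diag (P.sgn k) := by
  have h1 : toConv ((invH B).comp P.diag).toLinearMap =
      toConv ((AlgHom.id F _).comp P.diag).toLinearMap * P.convDet _ := by
    rw [toConv_diag, toConv_diag, mul_assoc]
    congr 1
    · congr 1
      ext k
      simp [invH]
    · rw [← toConv_comp_twist]
      congr 1
      ext k
      simp [invH, P.involute_γ hB]
  rw [← toConv_comp_twist] at h1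
  exact congrArg (fun f => f.ofConv k) h1

theorem invA_diagA [CharZero F] (hB : IsOrthogonal ρ B) (k : K) :
    invA ρ B κ (P.diagA κ k) = P.diagA κ (P.sgn k) := by
  rw [diagA_eq, invA_inclA, P.invH_diag hB, diagA_eq]

variable {ι : Type*} [Fintype ι] [DecidableEq ι] {v v' : Module.Basis ι F V}

/-- Passing `Δ_C` from left to right over `v_k ⊗ v'_k`, the `H` leg acts on `v_k` by the smash
product relation and the `γ` leg acts on `v'_k` by the pin relation. Invariance of `∑ v_k ⊗ v'_k`
removes both actions; what is left is the involution on the `γ` leg, which is `sgn` on the pin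
cover. -/
theorem dirac_mul_diagA [CharZero F] (hB : IsOrthogonal ρ B)
    (hv : ∀ i j, B (v i) (v' j) = if i = j then 1 else 0) (k : K) :
    dirac ρ B κ v v' * P.diagA κ k = P.diagA κ (P.sgn k) * dirac ρ B κ v v' := by
  let a₁ : HeckeAlg ρ κ →ₐ[F] HeckeAlg ρ κ ⊗[F] Cl B := Algebra.TensorProduct.includeLeft
  let a₂ : Cl B →ₐ[F] HeckeAlg ρ κ ⊗[F] Cl B := Algebra.TensorProduct.includeRight
  have hcomm : ∀ x y, Commute (a₁ x) (a₂ y) := fun x y => by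
    simp [a₁, a₂, Commute, SemiconjBy]
  let Φ := toConv (a₁.toLinearMap ∘ₗ (HeckeAlg.ofH ρ κ).toLinearMap ∘ₗ
    (P.π : K →ₐ[F] H).toLinearMap)
  let Γ := toConv (a₂.toLinearMap ∘ₗ P.γ.toLinearMap)
  let Γ' := toConv (a₂.toLinearMap ∘ₗ
    (CliffordAlgebra.involute (Q := quad B)).toLinearMap ∘ₗ P.γ.toLinearMap)
  have hΔ : toConv (P.diagA κ).toLinearMap = Φ * Γ := by
    refine (P.toConv_diag (inclA ρ B κ)).trans ?_
    congr 1
    congr 1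
    ext k
    simp [inclA, a₂]
  have hΔ' : toConv ((invA ρ B κ).comp (P.diagA κ)).toLinearMap = Φ * Γ' := by
    refine (P.toConv_diag ((invA ρ B κ).comp (inclA ρ B κ))).trans ?_
    congr 1 <;> congr 1 <;> ext k <;> simp [inclA, invA, a₁, a₂]
  have h1 : ∀ u, Γ' * convConst F K (a₂ (CliffordAlgebra.ι (quad B) u)) =
      convAct P.rep (a₂.toLinearMap ∘ₗ CliffordAlgebra.ι (quad B)) u * Γ := by
    intro u
    have := congrArg (convPost a₂.toLinearMap) (P.toConv_involute_γ_mul hB u)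
    rw [convPost_mul, convPost_mul, convPost_const] at this
    exact this
  have h2 : ∀ u, Φ * convConst F K (a₁ (HeckeAlg.ofV ρ κ u)) =
      convAct P.rep (a₁.toLinearMap ∘ₗ HeckeAlg.ofV ρ κ) u * Φ := by
    intro u
    have := congrArg (convPost a₁.toLinearMap) (HeckeAlg.toConv_ofH_mul (ρ := ρ) κ P.π u)
    rw [convPost_mul, convPost_mul, convPost_const] at this
    exact this
  have h3 : dirac ρ B κ v v' = ∑ i, (a₁.toLinearMap ∘ₗ HeckeAlg.ofV ρ κ) (v i) *
      (a₂.toLinearMap ∘ₗ CliffordAlgebra.ι (quad B)) (v' i) := by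
    simp [dirac, a₁, a₂]
  have h4 : convConst F K (dirac ρ B κ v v') * (Φ * Γ) =
      Φ * Γ' * convConst F K (dirac ρ B κ v v') := by
    rw [h3]
    -- Invariance is used backwards, to introduce the two actions that the exchange relations `h1`
    -- and `h2` then undo.
    nth_rw 1 [← sum_convAct_mul_convAct (P.rep_orthogonal hB) hv]
    rw [convConst_sum, Finset.sum_mul, Finset.mul_sum]
    refine Finset.sum_congr rfl fun i _ => ?_
    rw [convConst_mul]
    have e1 : Γ' * convConst F K (a₁ (HeckeAlg.ofV ρ κ (v i))) =
        convConst F K (a₁ (HeckeAlg.ofV ρ κ (v i))) * Γ' :=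
      (convConst_commute fun _ => hcomm _ _).symm
    have e2 : Φ * convAct P.rep (a₂.toLinearMap ∘ₗ CliffordAlgebra.ι (quad B)) (v' i) =
        convAct P.rep (a₂.toLinearMap ∘ₗ CliffordAlgebra.ι (quad B)) (v' i) * Φ :=
      convMul_comm_of_commute fun _ _ => hcomm _ _
    calc _ = convAct P.rep (a₁.toLinearMap ∘ₗ HeckeAlg.ofV ρ κ) (v i) *
          (convAct P.rep (a₂.toLinearMap ∘ₗ CliffordAlgebra.ι (quad B)) (v' i) * Φ) * Γ := by
            simp only [mul_assoc]
      _ = convAct P.rep (a₁.toLinearMap ∘ₗ HeckeAlg.ofV ρ κ) (v i) * Φ *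
          (convAct P.rep (a₂.toLinearMap ∘ₗ CliffordAlgebra.ι (quad B)) (v' i) * Γ) := by
            rw [← e2]; simp only [mul_assoc]
      _ = Φ * (convConst F K (a₁ (HeckeAlg.ofV ρ κ (v i))) * Γ') *
          convConst F K (a₂ (CliffordAlgebra.ι (quad B) (v' i))) := by
            rw [← h1, ← h2]; simp only [mul_assoc]
      _ = _ := by
            rw [← e1]; simp only [mul_assoc]; rfl
  rw [← hΔ, ← hΔ'] at h4
  have h5 := congrArg (fun f => f.ofConv k) h4
  rw [convConst_mul_apply, convMul_const_apply] at h5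
  rw [← P.invA_diagA κ hB]
  exact h5

end DiagA

end PinCover

end

section

/-! ### Koszul complexes -/

/-! ### Inverting an endomorphism by a polynomial in it -/

section NonzeroEigenvalues

variable {F : Type*} [Field F] {W : Type*} [AddCommGroup W] [Module F W]

/-- The vectors annihilated by a polynomial in `E` with nonzero constant coefficient. -/
def invertiblePart (E : Module.End F W) : Submodule F W where
  carrier := {w | ∃ q : Polynomial F, q.eval 0 ≠ 0 ∧ Polynomial.aeval E q w = 0}
  zero_mem' := ⟨1, by simp, by simp⟩
  add_mem' := by
    rintro x y ⟨p, hp, hx⟩ ⟨q, hq, hy⟩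
    refine ⟨p * q, by simp [hp, hq], ?_⟩
    rw [map_add, map_mul, Module.End.mul_apply, Module.End.mul_apply, hy, map_zero, add_zero,
      ← Module.End.mul_apply, ← map_mul, mul_comm, map_mul, Module.End.mul_apply, hx, map_zero]
  smul_mem' := by
    rintro a x ⟨p, hp, hx⟩
    exact ⟨p, hp, by rw [map_smul, hx, smul_zero]⟩

theorem mem_invertiblePart_of_eigen {E : Module.End F W} {w : W} {a : F} (ha : a ≠ 0)
    (h : E w = a • w) : w ∈ invertiblePart E :=
  ⟨Polynomial.X - Polynomial.C a, by simpa using ha, by simp [h, Algebra.algebraMap_eq_smul_one]⟩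

/-- If `p(E) w = 0` and `p = X p' + p(0)` with `p(0) ≠ 0`, then `-p(0)⁻¹ p'(E)` inverts `E` on `w`.
An inverse of this form preserves every `E`-stable subspace, which is what keeps later primitives
equivariant. -/
theorem exists_aeval_inverse {E : Module.End F W} {w : W} (hw : w ∈ invertiblePart E) :
    ∃ q : Polynomial F, E (Polynomial.aeval E q w) = w := by
  obtain ⟨p, hp, h⟩ := hw
  refine ⟨-Polynomial.C (p.eval 0)⁻¹ * p.divX, ?_⟩
  have h1 : Polynomial.aeval E (Polynomial.X * p.divX) w + p.eval 0 • w = 0 := by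
    rw [← h]
    conv_rhs => rw [← Polynomial.divX_mul_X_add p]
    rw [map_add, LinearMap.add_apply, mul_comm, Polynomial.aeval_C,
      Polynomial.coeff_zero_eq_eval_zero]
    simp [Algebra.algebraMap_eq_smul_one]
  rw [map_mul, Polynomial.aeval_X, Module.End.mul_apply] at h1
  rw [map_mul, map_neg, Polynomial.aeval_C, Module.End.mul_apply, LinearMap.neg_apply,
    Module.algebraMap_end_apply, map_neg, map_smul, eq_neg_of_add_eq_zero_left h1, smul_neg,
    neg_neg, inv_smul_smul₀ hp]

theorem eq_zero_of_mem_invertiblePart {E : Module.End F W} {w : W} (hw : w ∈ invertiblePart E)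
    (h : E w = 0) : w = 0 := by
  obtain ⟨q, hq⟩ := exists_aeval_inverse hw
  have : E * Polynomial.aeval E q = Polynomial.aeval E q * E := by
    have h1 : Polynomial.aeval E (Polynomial.X * q) = Polynomial.aeval E (q * Polynomial.X) := by
      rw [mul_comm]
    simpa using h1
  rw [← hq, ← Module.End.mul_apply, this, Module.End.mul_apply, h, map_zero]

theorem commute_aeval {E T : Module.End F W} (h : Commute E T) (q : Polynomial F) :
    Commute (Polynomial.aeval E q) T := by
  induction q using Polynomial.induction_on' with
  | add p q hp hq => rw [map_add]; exact hp.add_left hq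
  | monomial n a =>
    rw [Polynomial.aeval_monomial]
    exact (Algebra.commute_algebraMap_left a T).mul_left (h.pow_left n)

end NonzeroEigenvalues

/-! ### Koszul differential, homotopy and Laplacian over a Fock space -/

section Koszul

open MvPolynomial

variable {F : Type*} [Field F] [CharZero F] {M : Type*} [AddCommGroup M] [Module F M]
  {ι : Type*} [Fintype ι] [DecidableEq ι]

/-- The Koszul differential `∑ X_k ⊗ a_k`. -/
def koszulD (a : ι → Module.End F M) : Module.End F (MvPolynomial ι F ⊗[F] M) :=
  ∑ k, TensorProduct.map (LinearMap.mulLeft F (X k)) (a k)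

/-- The Koszul homotopy `∑ ∂_k ⊗ b_k`. -/
def koszulS (b : ι → Module.End F M) : Module.End F (MvPolynomial ι F ⊗[F] M) :=
  ∑ k, TensorProduct.map (pderiv k : Derivation F _ _).toLinearMap (b k)

theorem koszulD_tmul (a : ι → Module.End F M) (f : MvPolynomial ι F) (m : M) :
    koszulD a (f ⊗ₜ m) = ∑ k, (X k * f) ⊗ₜ a k m := by
  simp [koszulD]

theorem koszulS_tmul (b : ι → Module.End F M) (f : MvPolynomial ι F) (m : M) :
    koszulS b (f ⊗ₜ m) = ∑ k, pderiv k f ⊗ₜ b k m := by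
  simp only [koszulS, LinearMap.sum_apply, TensorProduct.map_tmul]
  rfl

theorem koszulD_polyComp (a : ι → Module.End F M) (n : ℕ) (w : MvPolynomial ι F ⊗[F] M) :
    koszulD a (polyComp F ι M n w) = polyComp F ι M (n + 1) (koszulD a w) := by
  induction w with
  | zero => simp
  | add x y hx hy => simp only [map_add, hx, hy]
  | tmul f m =>
    rw [koszulD_tmul, polyComp, LinearMap.rTensor_tmul, koszulD_tmul, map_sum]
    refine Finset.sum_congr rfl fun k _ => ?_
    rw [polyComp, LinearMap.rTensor_tmul]
    congr 1
    have h1 := sum_homogeneousComponent f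
    conv_rhs => rw [← h1, Finset.mul_sum, map_sum]
    have h2 : ∀ i, homogeneousComponent (n + 1) (X k * homogeneousComponent i f) =
        if i = n then X k * homogeneousComponent i f else 0 := by
      intro i
      have : (X k * homogeneousComponent i f).IsHomogeneous (1 + i) :=
        (isHomogeneous_X F k).mul (homogeneousComponent_isHomogeneous i f)
      rw [homogeneousComponent_of_mem this]
      simp only [add_comm 1 i, add_left_inj, eq_comm]
    simp only [h2]
    rw [Finset.sum_ite_eq']
    split_ifs with h
    · rfl
    · rw [homogeneousComponent_eq_zero n f (by simpa using h), mul_zero]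

variable {a b : ι → Module.End F M}

/-- The variables commute while the `a_k` anticommute, so twice the square is zero. -/
theorem koszulD_koszulD (haa : ∀ k l, a k * a l + a l * a k = 0) :
    koszulD a * koszulD a = 0 := by
  have h1 : koszulD a * koszulD a = ∑ k, ∑ l,
      TensorProduct.map (LinearMap.mulLeft F (X k * X l : MvPolynomial ι F)) (a k * a l) := by
    rw [koszulD, Finset.sum_mul_sum]
    refine Finset.sum_congr rfl fun k _ => Finset.sum_congr rfl fun l _ => ?_
    rw [LinearMap.mulLeft_mul]
    exact (TensorProduct.map_comp _ _ _ _).symm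
  have h2 : koszulD a * koszulD a + koszulD a * koszulD a = 0 := by
    nth_rw 2 [h1]
    rw [h1]
    nth_rw 2 [Finset.sum_comm]
    simp only [← Finset.sum_add_distrib]
    refine Finset.sum_eq_zero fun k _ => Finset.sum_eq_zero fun l _ => ?_
    rw [mul_comm (X l), ← TensorProduct.map_add_right, haa, TensorProduct.map_zero_right]
  rw [← two_smul F, smul_eq_zero] at h2
  exact h2.resolve_left two_ne_zero

/-- The Laplacian of the Koszul complex. -/
def koszulE (a b : ι → Module.End F M) : Module.End F (MvPolynomial ι F ⊗[F] M) :=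
  koszulD a * koszulS b + koszulS b * koszulD a

theorem commute_koszulE_koszulD (haa : ∀ k l, a k * a l + a l * a k = 0) :
    Commute (koszulE a b) (koszulD a) := by
  rw [Commute, SemiconjBy, koszulE, add_mul, mul_add, mul_assoc (koszulS b), koszulD_koszulD haa,
    ← mul_assoc (koszulD a) (koszulD a), koszulD_koszulD haa, mul_zero, zero_mul, zero_add,
    add_zero, mul_assoc]

/-- The anticommutators contract `∑ X_l ∂_k` to twice the Euler operator, whence `2 n`. The term
where `∂_k` hits the variable introduced by the differential gives the number operator `∑ b_k a_k`.
-/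
theorem koszulE_tmul (hab : ∀ k l, a k * b l + b l * a k = if k = l then 2 else 0) {n : ℕ}
    {f : MvPolynomial ι F} (hf : f.IsHomogeneous n) (m : M) :
    koszulE a b (f ⊗ₜ m) = (2 * n : F) • (f ⊗ₜ m) + f ⊗ₜ ((∑ k, b k * a k) m) := by
  have h1 : koszulE a b (f ⊗ₜ m) =
      ∑ k, ∑ l, (X l * pderiv k f) ⊗ₜ[F] ((a l * b k + b k * a l) m) +
        ∑ k, f ⊗ₜ[F] ((b k * a k) m) := by
    rw [koszulE, LinearMap.add_apply, Module.End.mul_apply, Module.End.mul_apply, koszulS_tmul,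
      koszulD_tmul, map_sum, map_sum]
    simp only [koszulS_tmul, koszulD_tmul]
    rw [Finset.sum_comm (f := fun l k => pderiv k (X l * f) ⊗ₜ[F] b k (a l m)),
      ← Finset.sum_add_distrib, ← Finset.sum_add_distrib]
    refine Finset.sum_congr rfl fun k _ => ?_
    have : ∑ l, pderiv k (X l * f) ⊗ₜ[F] b k (a l m) =
        ∑ l, (X l * pderiv k f) ⊗ₜ[F] b k (a l m) + f ⊗ₜ[F] b k (a k m) := by
      simp only [Derivation.leibniz, pderiv_X, smul_eq_mul, TensorProduct.add_tmul,
        Finset.sum_add_distrib]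
      congr 1
      rw [Finset.sum_eq_single k]
      · simp
      · intro l _ hl
        simp [hl]
      · simp
    rw [this, ← add_assoc, ← Finset.sum_add_distrib]
    simp only [LinearMap.add_apply, TensorProduct.tmul_add, Module.End.mul_apply]
  rw [h1, LinearMap.sum_apply, TensorProduct.tmul_sum]
  congr 1
  have h2 : ∀ k, ∑ l, (X l * pderiv k f) ⊗ₜ[F] ((a l * b k + b k * a l) m) =
      (2 : F) • ((X k * pderiv k f) ⊗ₜ[F] m) := by
    intro k
    rw [Finset.sum_eq_single k]
    · rw [hab, if_pos rfl, ← TensorProduct.tmul_smul]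
      congr 1
      rw [← one_add_one_eq_two, LinearMap.add_apply, ← one_add_one_eq_two (R := F), add_smul]
      simp
    · intro l _ hl
      rw [hab, if_neg hl]
      simp
    · simp
  simp only [h2]
  rw [← Finset.smul_sum, ← TensorProduct.sum_tmul, hf.sum_X_mul_pderiv,
    ← Nat.cast_smul_eq_nsmul F, ← TensorProduct.smul_tmul', smul_smul]

variable (b) in
/-- The span of the vectors `b_{k₁} ⋯ b_{k_j} m` with `m` in the submodule `M₀`. -/
def koszulLevel (M₀ : Submodule F M) : ℕ → Submodule F M
  | 0 => M₀
  | j + 1 => ⨆ k, (koszulLevel M₀ j).map (b k)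

variable {M₀ : Submodule F M}

/-- The number operator kills the vacuum space, and its commutator with each `b_l` is `2 b_l`, so
every creation operator raises the eigenvalue by `2`. -/
theorem number_op_level (hab : ∀ k l, a k * b l + b l * a k = if k = l then 2 else 0)
    (hbb : ∀ k l, b k * b l + b l * b k = 0) (h0 : ∀ k, ∀ m ∈ M₀, a k m = 0) (j : ℕ) :
    ∀ m ∈ koszulLevel b M₀ j, (∑ k, b k * a k) m = (2 * j : F) • m := by
  have hcomm : ∀ l, (∑ k, b k * a k) * b l = b l * (∑ k, b k * a k) + (2 : F) • b l := by
    intro l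
    have h1 : ∀ k, b k * a k * b l = b l * (b k * a k) + if k = l then (2 : F) • b l else 0 := by
      intro k
      have e1 : a k * b l = (if k = l then 2 else 0) - b l * a k := eq_sub_of_add_eq (hab k l)
      have e2 : b k * b l = -(b l * b k) := eq_neg_of_add_eq_zero_left (hbb k l)
      rw [mul_assoc, e1, mul_sub, ← mul_assoc (b k), e2, neg_mul, sub_neg_eq_add, add_comm,
        mul_assoc]
      congr 1
      split_ifs with h
      · rw [h, mul_two, two_smul]
      · simp
    rw [Finset.sum_mul, Finset.mul_sum]
    simp only [h1, Finset.sum_add_distrib, Finset.sum_ite_eq', Finset.mem_univ, if_true]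
  induction j with
  | zero =>
    intro m hm
    have hm' : m ∈ M₀ := hm
    simp [LinearMap.sum_apply, h0 _ m hm']
  | succ j ih =>
    have : koszulLevel b M₀ (j + 1) ≤
        LinearMap.eqLocus (∑ k, b k * a k) ((2 * (j + 1 : ℕ) : F) • LinearMap.id) := by
      refine iSup_le fun l => ?_
      rintro _ ⟨m, hm, rfl⟩
      rw [LinearMap.mem_eqLocus, ← Module.End.mul_apply, hcomm, LinearMap.add_apply,
        Module.End.mul_apply, ih m hm, map_smul]
      simp only [LinearMap.smul_apply, LinearMap.id_apply]
      rw [← add_smul]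
      push_cast
      ring_nf
    exact fun m hm => this hm

theorem lower_level (hab : ∀ k l, a k * b l + b l * a k = if k = l then 2 else 0)
    (h0 : ∀ k, ∀ m ∈ M₀, a k m = 0) (k : ι) (j : ℕ) :
    ∀ m ∈ koszulLevel b M₀ (j + 1), a k m ∈ koszulLevel b M₀ j := by
  have hab' : ∀ l m, a k (b l m) = (if k = l then (2 : F) else 0) • m - b l (a k m) := by
    intro l m
    have h := congrArg (fun T : Module.End F M => T m) (hab k l)
    simp only [LinearMap.add_apply, Module.End.mul_apply] at h
    rw [eq_sub_iff_add_eq, h]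
    split_ifs
    · rw [← one_add_one_eq_two, LinearMap.add_apply, ← one_add_one_eq_two (R := F), add_smul]
      simp
    · simp
  induction j with
  | zero =>
    have : koszulLevel b M₀ 1 ≤ M₀.comap (a k) := by
      refine iSup_le fun l => ?_
      rintro _ ⟨m, hm, rfl⟩
      rw [Submodule.mem_comap, hab', h0 k m hm, map_zero, sub_zero]
      exact Submodule.smul_mem _ _ hm
    exact fun m hm => this hm
  | succ j ih =>
    have : koszulLevel b M₀ (j + 1 + 1) ≤ (koszulLevel b M₀ (j + 1)).comap (a k) := by
      refine iSup_le fun l => ?_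
      rintro _ ⟨m, hm, rfl⟩
      rw [Submodule.mem_comap, hab']
      refine Submodule.sub_mem _ (Submodule.smul_mem _ _ hm) ?_
      exact Submodule.mem_iSup_of_mem l ⟨_, ih m hm, rfl⟩
    exact fun m hm => this hm

/-- Annihilators lower the level and creators raise it, so the sum of the levels is a stable
subspace containing the vacuum space. -/
theorem iSup_koszulLevel (hab : ∀ k l, a k * b l + b l * a k = if k = l then 2 else 0)
    (h0 : ∀ k, ∀ m ∈ M₀, a k m = 0)
    (hgen : ∀ S : Submodule F M, M₀ ≤ S → (∀ k, ∀ m ∈ S, a k m ∈ S) →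
      (∀ k, ∀ m ∈ S, b k m ∈ S) → S = ⊤) :
    ⨆ j, koszulLevel b M₀ j = ⊤ := by
  apply hgen
  · exact le_iSup (koszulLevel b M₀) 0
  · intro k
    have : ⨆ j, koszulLevel b M₀ j ≤ (⨆ j, koszulLevel b M₀ j).comap (a k) := by
      refine iSup_le fun j => ?_
      cases j with
      | zero =>
        intro m hm
        rw [Submodule.mem_comap, h0 k m hm]
        exact Submodule.zero_mem _
      | succ j =>
        intro m hm
        exact Submodule.mem_iSup_of_mem j (lower_level hab h0 k j m hm)
    exact fun m hm => this hm
  · intro k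
    have : ⨆ j, koszulLevel b M₀ j ≤ (⨆ j, koszulLevel b M₀ j).comap (b k) := by
      refine iSup_le fun j m hm => ?_
      exact Submodule.mem_iSup_of_mem (j + 1) (Submodule.mem_iSup_of_mem k ⟨m, hm, rfl⟩)
    exact fun m hm => this hm

/-- The Fock space argument: modulo the vacuum space, everything is a sum of vectors of level `j >
0`, where the number operator has the nonzero eigenvalue `2 j`. A vector killed by all annihilators
is killed by the number operator, so its part of positive level vanishes. -/
theorem mem_of_forall_annihilated
    (hab : ∀ k l, a k * b l + b l * a k = if k = l then 2 else 0)
    (hbb : ∀ k l, b k * b l + b l * b k = 0) (h0 : ∀ k, ∀ m ∈ M₀, a k m = 0)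
    (hgen : ∀ S : Submodule F M, M₀ ≤ S → (∀ k, ∀ m ∈ S, a k m ∈ S) →
      (∀ k, ∀ m ∈ S, b k m ∈ S) → S = ⊤) {m : M} (hm : ∀ k, a k m = 0) : m ∈ M₀ := by
  have h1 : M₀ ⊔ invertiblePart (∑ k, b k * a k) = ⊤ := by
    rw [eq_top_iff, ← iSup_koszulLevel hab h0 hgen]
    refine iSup_le fun j => ?_
    cases j with
    | zero => exact le_sup_left
    | succ j =>
      refine le_sup_of_le_right fun m hm => ?_
      refine mem_invertiblePart_of_eigen (a := (2 * (j + 1 : ℕ) : F)) ?_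
        (number_op_level hab hbb h0 (j + 1) m hm)
      exact mul_ne_zero two_ne_zero (by exact_mod_cast j.succ_ne_zero)
  obtain ⟨x, hx, y, hy, rfl⟩ := Submodule.mem_sup.mp (h1 ▸ Submodule.mem_top : m ∈ _)
  have h2 : y = 0 := by
    refine eq_zero_of_mem_invertiblePart hy ?_
    rw [LinearMap.sum_apply]
    refine Finset.sum_eq_zero fun k _ => ?_
    have := hm k
    rw [map_add, h0 k x hx, zero_add] at this
    rw [Module.End.mul_apply, this, map_zero]
  rw [h2, add_zero]
  exact hx

/-- In polynomial degree `n + 1` and level `j` the Laplacian has eigenvalue `2 (n + 1) + 2 j ≠ 0`,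
so `E q(E) w = w` for some polynomial `q`. As `q(E)` commutes with the differential, `q(E) w` is
again a cocycle and only the term `d s q(E) w` survives. The primitive is kept in this explicit form
so that its equivariance can be verified. -/
theorem exists_koszul_primitive (haa : ∀ k l, a k * a l + a l * a k = 0)
    (hab : ∀ k l, a k * b l + b l * a k = if k = l then 2 else 0)
    (hbb : ∀ k l, b k * b l + b l * b k = 0) (h0 : ∀ k, ∀ m ∈ M₀, a k m = 0)
    (hgen : ∀ S : Submodule F M, M₀ ≤ S → (∀ k, ∀ m ∈ S, a k m ∈ S) →
      (∀ k, ∀ m ∈ S, b k m ∈ S) → S = ⊤) {n : ℕ} {w : MvPolynomial ι F ⊗[F] M}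
    (hw : polyComp F ι M (n + 1) w = w) (hd : koszulD a w = 0) :
    ∃ q : Polynomial F, koszulD a (koszulS b (Polynomial.aeval (koszulE a b) q w)) = w := by
  have h1 : w ∈ invertiblePart (koszulE a b) := by
    rw [← hw]
    refine polyComp_mem (fun f hf m => ?_) w
    have h2 : ⨆ j, koszulLevel b M₀ j ≤ (invertiblePart (koszulE a b)).comap
        (TensorProduct.mk F (MvPolynomial ι F) M f) := by
      refine iSup_le fun j m hm => ?_
      rw [Submodule.mem_comap, TensorProduct.mk_apply]
      refine mem_invertiblePart_of_eigen (a := (2 * (n + 1 : ℕ) + 2 * j : F)) ?_ ?_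
      · have : (2 * (n + 1) + 2 * j : ℕ) ≠ 0 := by omega
        exact_mod_cast this
      · rw [koszulE_tmul hab hf, number_op_level hab hbb h0 j m hm, TensorProduct.tmul_smul,
          ← add_smul]
    rw [iSup_koszulLevel hab h0 hgen] at h2
    exact h2 (Submodule.mem_top (x := m))
  obtain ⟨q, hq⟩ := exists_aeval_inverse h1
  refine ⟨q, ?_⟩
  conv_rhs => rw [← hq]
  rw [koszulE, LinearMap.add_apply, Module.End.mul_apply, Module.End.mul_apply, ← koszulE]
  have h3 : koszulD a (Polynomial.aeval (koszulE a b) q w) = 0 := by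
    rw [← Module.End.mul_apply, ← (commute_aeval (commute_koszulE_koszulD haa) q).eq,
      Module.End.mul_apply, hd, map_zero]
  rw [h3, map_zero, add_zero]

end Koszul

end

section

open MvPolynomial WithConv

variable {F : Type*} [Field F] [CharZero F] {H : Type*} [Ring H] [HopfAlgebra F H]
  {V : Type*} [AddCommGroup V] [Module F V]
  {ρ : H →ₐ[F] Module.End F V} {B : LinearMap.BilinForm F V} {κ : V →ₗ[F] V →ₗ[F] H}
  {ι : Type*} [Fintype ι]

/-! ### The PBW isomorphism for `A ⊗ C` -/

section Equiv

variable (B) (v : Module.Basis ι F V) (hA : IsPBW ρ κ)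

/-- The isomorphism `F[X] ⊗ (H ⊗ C) ≃ A ⊗ C`, `f ⊗ m ↦ sym(f) m`. -/
def acEquiv : MvPolynomial ι F ⊗[F] (H ⊗[F] Cl B) ≃ₗ[F] HeckeAlg ρ κ ⊗[F] Cl B :=
  (TensorProduct.assoc F (MvPolynomial ι F) H (Cl B)).symm ≪≫ₗ
    TensorProduct.congr (LinearEquiv.ofBijective _ (HeckeAlg.pbwMap_bijective v hA))
      (LinearEquiv.refl F (Cl B))

theorem acEquiv_tmul (f : MvPolynomial ι F) (m : H ⊗[F] Cl B) :
    acEquiv B v hA (f ⊗ₜ m) = (HeckeAlg.sym ρ κ v f ⊗ₜ 1) * PinCover.inclA ρ B κ m := by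
  induction m with
  | zero => simp
  | add x y hx hy => rw [TensorProduct.tmul_add, map_add, map_add, hx, hy, mul_add]
  | tmul h c =>
    simp [acEquiv, PinCover.inclA]

theorem mul_inclA_mem {n : ℕ} {a : HeckeAlg ρ κ} (ha : a ∈ HeckeAlg.filtLT ρ κ n)
    (m : H ⊗[F] Cl B) :
    (acEquiv B v hA).symm ((a ⊗ₜ 1) * PinCover.inclA ρ B κ m) ∈ polyLT F ι (H ⊗[F] Cl B) n := by
  induction m with
  | zero => simp
  | add x y hx hy => rw [map_add, mul_add, map_add]; exact Submodule.add_mem _ hx hy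
  | tmul h c =>
    obtain ⟨w, hw, hw'⟩ := HeckeAlg.filtLT_le_map_pbwMap ρ κ v n (HeckeAlg.mul_ofH_mem ρ κ h ha)
    have h1 : (acEquiv B v hA).symm ((a ⊗ₜ 1) * PinCover.inclA ρ B κ (h ⊗ₜ c)) =
        TensorProduct.assoc F (MvPolynomial ι F) H (Cl B) (w ⊗ₜ c) := by
      rw [LinearEquiv.symm_apply_eq]
      simp [acEquiv, PinCover.inclA, hw']
    rw [h1]
    have h2 : polyLT F ι H n ≤ (polyLT F ι (H ⊗[F] Cl B) n).comap
        ((TensorProduct.assoc F (MvPolynomial ι F) H (Cl B)).toLinearMap ∘ₗ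
          (TensorProduct.mk F _ _).flip c) :=
      polyLT_le fun m hm f hf x => polyLT_mono (Nat.succ_le_of_lt hm) (tmul_mem_polyLT hf _)
    exact h2 hw

end Equiv

namespace PinCover

variable [FiniteDimensional F V] {K : Type*} [Ring K] [HopfAlgebra F K] [Coalgebra.IsCocomm F K]
  (P : PinCover ρ B K)

variable (H B) in
/-- The inclusion `C → H ⊗ C`. -/
abbrev clIncl : Cl B →ₐ[F] H ⊗[F] Cl B := Algebra.TensorProduct.includeRight

/-- The two legs of `Δ_C` commute, so the `γ` leg can be cancelled from the left by its convolution
inverse. -/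
theorem toConv_π_eq :
    toConv ((Algebra.TensorProduct.includeLeft.comp (P.π : K →ₐ[F] H)).toLinearMap) =
      toConv ((clIncl H B).toLinearMap ∘ₗ (P.γ.toLinearMap ∘ₗ HopfAlgebra.antipode F)) *
        toConv P.diag.toLinearMap := by
  have h1 := P.toConv_diag (AlgHom.id F _)
  simp only [AlgHom.id_comp] at h1
  have h2 : toConv ((Algebra.TensorProduct.includeLeft.comp (P.π : K →ₐ[F] H)).toLinearMap) *
      toConv ((clIncl H B).comp P.γ).toLinearMap =
      toConv ((clIncl H B).comp P.γ).toLinearMap *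
      toConv ((Algebra.TensorProduct.includeLeft.comp (P.π : K →ₐ[F] H)).toLinearMap) := by
    apply convMul_comm_of_commute
    intro x y
    simp [Commute, SemiconjBy]
  rw [h1, h2, ← mul_assoc]
  have h3 := antipode_mul_toConv ((clIncl H B).comp P.γ)
  refine (one_mul _).symm.trans ?_
  rw [← h3]
  rfl

/-- Since `π` is surjective and `π(k) ⊗ 1 = γ(S k₍₁₎) Δ_C(k₍₂₎)`, the products `c Δ_C(k)` span `H ⊗
C`. Operators on `H ⊗ C` are compared on these products throughout. -/
theorem hom_ext_diag {N : Type*} [AddCommGroup N] [Module F N] {f g : H ⊗[F] Cl B →ₗ[F] N}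
    (h : ∀ (c : Cl B) (k : K), f (clIncl H B c * P.diag k) = g (clIncl H B c * P.diag k)) :
    f = g := by
  apply TensorProduct.ext'
  intro x c
  obtain ⟨k, rfl⟩ := P.surjective x
  let r := Coalgebra.Repr.arbitrary F k
  have h1 : (P.π k ⊗ₜ[F] (1 : Cl B)) = ∑ i ∈ r.index,
      clIncl H B (P.γ (HopfAlgebra.antipode F (r.left i))) * P.diag (r.right i) := by
    have := congrArg (fun f => f.ofConv k) P.toConv_π_eq
    simp only [r.convMul_apply] at this
    exact this
  have h2 : P.π k ⊗ₜ[F] c = ∑ i ∈ r.index,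
      clIncl H B (c * P.γ (HopfAlgebra.antipode F (r.left i))) * P.diag (r.right i) := by
    have : P.π k ⊗ₜ[F] c = clIncl H B c * (P.π k ⊗ₜ[F] (1 : Cl B)) := by simp
    rw [this, h1, Finset.mul_sum]
    simp only [map_mul, mul_assoc]
  rw [h2, map_sum, map_sum]
  exact Finset.sum_congr rfl fun i _ => h _ _

/-! ### Multiplication operators on `H ⊗ C` -/

/-- The operators `R_u` on `H ⊗ C` with `R_u (c Δ_C(k)) = c^* u Δ_C(k)`, where `c^*` is the image
of `c` under the grading involution. -/
def IsTwistedRightMul (R : V →ₗ[F] Module.End F (H ⊗[F] Cl B)) : Prop :=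
  ∀ (u : V) (c : Cl B) (k : K), R u (clIncl H B c * P.diag k) =
    clIncl H B (CliffordAlgebra.involute c * CliffordAlgebra.ι (quad B) u) * P.diag k

variable (H B) in
/-- Left multiplication by vectors on `H ⊗ C`. -/
def leftMulV : V →ₗ[F] Module.End F (H ⊗[F] Cl B) :=
  LinearMap.mul F (H ⊗[F] Cl B) ∘ₗ (clIncl H B).toLinearMap ∘ₗ CliffordAlgebra.ι (quad B)

theorem leftMulV_apply (u : V) (m : H ⊗[F] Cl B) :
    leftMulV H B u m = clIncl H B (CliffordAlgebra.ι (quad B) u) * m := rfl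

theorem leftMulV_diag (u : V) (c : Cl B) (k : K) :
    leftMulV H B u (clIncl H B c * P.diag k) =
      clIncl H B (CliffordAlgebra.ι (quad B) u * c) * P.diag k := by
  rw [leftMulV_apply, map_mul, mul_assoc]

variable (H) in
/-- The annihilation operators. -/
def annih (R : V →ₗ[F] Module.End F (H ⊗[F] Cl B)) : V →ₗ[F] Module.End F (H ⊗[F] Cl B) :=
  leftMulV H B - R

variable (H) in
/-- The creation operators. -/
def creat (R : V →ₗ[F] Module.End F (H ⊗[F] Cl B)) : V →ₗ[F] Module.End F (H ⊗[F] Cl B) :=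
  (2⁻¹ : F) • (leftMulV H B + R)

section Relations

variable {P} {R : V →ₗ[F] Module.End F (H ⊗[F] Cl B)} (hR : P.IsTwistedRightMul R)

theorem ι_mul_ι_add (hB : B.IsSymm) (u w : V) :
    CliffordAlgebra.ι (quad B) u * CliffordAlgebra.ι (quad B) w +
      CliffordAlgebra.ι (quad B) w * CliffordAlgebra.ι (quad B) u =
        algebraMap F (Cl B) (2 * B u w) := by
  rw [CliffordAlgebra.ι_mul_ι_add_swap]
  congr 1
  simp only [QuadraticMap.polar, LinearMap.BilinMap.toQuadraticMap_apply, map_add,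
    LinearMap.add_apply, hB.eq w u]
  ring

theorem leftMulV_leftMulV (hB : B.IsSymm) (u w : V) :
    leftMulV H B u * leftMulV H B w + leftMulV H B w * leftMulV H B u =
      algebraMap F _ (2 * B u w) := by
  refine LinearMap.ext fun m => ?_
  simp only [LinearMap.add_apply, Module.End.mul_apply, leftMulV_apply, ← mul_assoc, ← map_mul,
    ← add_mul, ← map_add, ι_mul_ι_add hB]
  rw [AlgHom.commutes, ← Algebra.smul_def, Module.algebraMap_end_apply]

include hR

/-- In a product of two operators the first vector passes once through the involution. This leaves
one sign, so `R` obeys the Clifford relations of `-B`. -/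
theorem right_right (hB : B.IsSymm) (u w : V) :
    R u * R w + R w * R u = algebraMap F _ (-(2 * B u w)) := by
  apply P.hom_ext_diag
  intro c k
  have h1 : c * -CliffordAlgebra.ι (quad B) w * CliffordAlgebra.ι (quad B) u +
      c * -CliffordAlgebra.ι (quad B) u * CliffordAlgebra.ι (quad B) w =
        (-(2 * B u w)) • c := by
    rw [mul_assoc, mul_assoc, neg_mul, neg_mul, ← mul_add, ← neg_add, add_comm, ι_mul_ι_add hB,
      mul_neg, ← Algebra.commutes, ← Algebra.smul_def, neg_smul]
  rw [LinearMap.add_apply, Module.End.mul_apply, Module.End.mul_apply, hR w, hR u, hR u, hR w,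
    map_mul CliffordAlgebra.involute, map_mul CliffordAlgebra.involute,
    CliffordAlgebra.involute_involute, CliffordAlgebra.involute_ι, CliffordAlgebra.involute_ι,
    ← add_mul, ← map_add, h1, map_smul, smul_mul_assoc, Module.algebraMap_end_apply]

/-- Left and right multiplications commute; the involution built into `R` turns this into
anticommutation. -/
theorem left_right (u w : V) : leftMulV H B u * R w + R w * leftMulV H B u = 0 := by
  apply P.hom_ext_diag
  intro c k
  rw [LinearMap.add_apply, Module.End.mul_apply, Module.End.mul_apply, hR w, P.leftMulV_diag,
    P.leftMulV_diag, hR w, ← add_mul, ← map_add, map_mul CliffordAlgebra.involute,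
    CliffordAlgebra.involute_ι, neg_mul, neg_mul, mul_assoc, add_neg_cancel, map_zero, zero_mul,
    LinearMap.zero_apply]

theorem annih_annih (hB : B.IsSymm) (u w : V) :
    annih H R u * annih H R w + annih H R w * annih H R u = 0 := by
  have h1 := leftMulV_leftMulV (H := H) hB u w
  have h2 := right_right hR hB u w
  have h3 := left_right hR u w
  have h4 := left_right hR w u
  have : annih H R u * annih H R w + annih H R w * annih H R u =
      (leftMulV H B u * leftMulV H B w + leftMulV H B w * leftMulV H B u) +
      (R u * R w + R w * R u) - (leftMulV H B u * R w + R w * leftMulV H B u) -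
      (leftMulV H B w * R u + R u * leftMulV H B w) := by
    simp only [annih, LinearMap.sub_apply]
    simp only [sub_mul, mul_sub]
    abel
  rw [this, h1, h2, h3, h4, ← map_add]
  simp

/-- The mixed terms cancel, and the contributions of `L` and `R` add up because they are Clifford
for opposite forms: half of `2 B + 2 B`. -/
theorem annih_creat (hB : B.IsSymm) (u w : V) :
    annih H R u * creat H R w + creat H R w * annih H R u = algebraMap F _ (2 * B u w) := by
  have h1 := leftMulV_leftMulV (H := H) hB u w
  have h2 := right_right hR hB u w
  have h3 := left_right hR u w
  have h4 := left_right hR w u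
  have : annih H R u * creat H R w + creat H R w * annih H R u =
      (2⁻¹ : F) • ((leftMulV H B u * leftMulV H B w + leftMulV H B w * leftMulV H B u) -
      (R u * R w + R w * R u) + (leftMulV H B u * R w + R w * leftMulV H B u) -
      (leftMulV H B w * R u + R u * leftMulV H B w)) := by
    simp only [annih, creat, LinearMap.sub_apply, LinearMap.smul_apply, LinearMap.add_apply,
      mul_smul_comm, smul_mul_assoc, ← smul_add]
    congr 1
    simp only [sub_mul, mul_sub, add_mul, mul_add]
    abel
  rw [this, h1, h2, h3, h4, ← map_sub, sub_zero, add_zero, Algebra.smul_def, ← map_mul]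
  congr 1
  field_simp
  ring

theorem creat_creat (hB : B.IsSymm) (u w : V) :
    creat H R u * creat H R w + creat H R w * creat H R u = 0 := by
  have h1 := leftMulV_leftMulV (H := H) hB u w
  have h2 := right_right hR hB u w
  have h3 := left_right hR u w
  have h4 := left_right hR w u
  have : creat H R u * creat H R w + creat H R w * creat H R u =
      (2⁻¹ : F) • (2⁻¹ : F) • ((leftMulV H B u * leftMulV H B w + leftMulV H B w * leftMulV H B u) +
      (R u * R w + R w * R u) + (leftMulV H B u * R w + R w * leftMulV H B u) +
      (leftMulV H B w * R u + R u * leftMulV H B w)) := by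
    simp only [creat, LinearMap.smul_apply, LinearMap.add_apply,
      mul_smul_comm, smul_mul_assoc, ← smul_add]
    congr 2
    simp only [add_mul, mul_add]
    abel
  rw [this, h1, h2, h3, h4, ← map_add]
  simp

/-- For `c = 1` the operators `L_u` and `R_u` agree, so the image of `Δ_C` consists of vacuum
vectors. -/
theorem annih_diag (u : V) (k : K) : annih H R u (P.diag k) = 0 := by
  have h1 := hR u 1 k
  simp only [map_one, one_mul] at h1
  rw [annih, LinearMap.sub_apply, LinearMap.sub_apply, h1, leftMulV_apply, sub_self]

theorem right_mul_diag (u : V) (m : H ⊗[F] Cl B) (k : K) :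
    R u (m * P.diag k) = R u m * P.diag k := by
  suffices R u ∘ₗ LinearMap.mulRight F (P.diag k) = LinearMap.mulRight F (P.diag k) ∘ₗ R u from
    congrArg (fun f => f m) this
  apply P.hom_ext_diag
  intro c k'
  simp only [LinearMap.comp_apply, LinearMap.mulRight_apply, mul_assoc, ← map_mul P.diag]
  rw [hR, hR, mul_assoc, ← map_mul P.diag]

theorem creat_mul_diag (u : V) (m : H ⊗[F] Cl B) (k : K) :
    creat H R u (m * P.diag k) = creat H R u m * P.diag k := by
  simp only [creat, LinearMap.smul_apply, LinearMap.add_apply, right_mul_diag hR, leftMulV_apply,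
    smul_mul_assoc, add_mul, mul_assoc]

theorem annih_mul_diag (u : V) (m : H ⊗[F] Cl B) (k : K) :
    annih H R u (m * P.diag k) = annih H R u m * P.diag k := by
  simp only [annih, LinearMap.sub_apply, right_mul_diag hR, leftMulV_apply,
    sub_mul, mul_assoc]

theorem invH_right (hB : IsOrthogonal ρ B) (u : V) (m : H ⊗[F] Cl B) :
    invH B (R u m) = -R u (invH B m) := by
  suffices (invH B).toLinearMap ∘ₗ R u = -(R u ∘ₗ (invH B).toLinearMap) from
    congrArg (fun f => f m) this
  apply P.hom_ext_diag
  intro c k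
  have h1 : ∀ c, invH B (clIncl H B c) = clIncl H B (CliffordAlgebra.involute c) := by
    intro c; simp [invH]
  simp only [LinearMap.comp_apply, LinearMap.neg_apply, AlgHom.toLinearMap_apply, hR _ _ _, map_mul,
    h1, P.invH_diag hB, CliffordAlgebra.involute_involute, CliffordAlgebra.involute_ι]
  rw [map_neg, mul_neg, neg_mul]

theorem invH_creat (hB : IsOrthogonal ρ B) (u : V) (m : H ⊗[F] Cl B) :
    invH B (creat H R u m) = -creat H R u (invH B m) := by
  have h1 : ∀ m, invH B (leftMulV H B u m) = -leftMulV H B u (invH B m) := by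
    intro m
    rw [leftMulV_apply, leftMulV_apply, map_mul, ← neg_mul]
    congr 1
    simp [invH, TensorProduct.tmul_neg]
  simp only [creat, LinearMap.smul_apply, LinearMap.add_apply, map_smul, map_add, h1,
    invH_right hR hB, smul_add, smul_neg, neg_add]

theorem invH_annih (hB : IsOrthogonal ρ B) (u : V) (m : H ⊗[F] Cl B) :
    invH B (annih H R u m) = -annih H R u (invH B m) := by
  have h1 : ∀ m, invH B (leftMulV H B u m) = -leftMulV H B u (invH B m) := by
    intro m
    rw [leftMulV_apply, leftMulV_apply, map_mul, ← neg_mul]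
    congr 1
    simp [invH, TensorProduct.tmul_neg]
  simp only [annih, LinearMap.sub_apply, map_sub, h1, invH_right hR hB]
  abel

theorem leftMulV_eq (u : V) : leftMulV H B u = creat H R u + (2⁻¹ : F) • annih H R u := by
  simp only [annih, creat, LinearMap.sub_apply, LinearMap.smul_apply, LinearMap.add_apply,
    ← smul_add]
  rw [add_add_sub_cancel, ← two_smul F, smul_smul]
  simp

/-- Left multiplication by a vector is a combination of creation and annihilation, so `S` is stable
under `C`; and `C Δ_C(K)` spans `H ⊗ C`. -/
theorem eq_top_of_stable {S : Submodule F (H ⊗[F] Cl B)}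
    (h0 : LinearMap.range P.diag.toLinearMap ≤ S)
    (ha : ∀ u, ∀ m ∈ S, annih H R u m ∈ S) (hb : ∀ u, ∀ m ∈ S, creat H R u m ∈ S) : S = ⊤ := by
  have h1 : ∀ c : Cl B, ∀ m ∈ S, clIncl H B c * m ∈ S := by
    intro c
    induction c using CliffordAlgebra.induction with
    | algebraMap a =>
      intro m hm
      rw [AlgHom.commutes, ← Algebra.smul_def]
      exact S.smul_mem _ hm
    | ι u =>
      intro m hm
      rw [← leftMulV_apply, leftMulV_eq hR]
      exact S.add_mem (hb u m hm) (S.smul_mem _ (ha u m hm))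
    | mul x y hx hy =>
      intro m hm
      rw [map_mul, mul_assoc]
      exact hx _ (hy _ hm)
    | add x y hx hy =>
      intro m hm
      rw [map_add, add_mul]
      exact S.add_mem (hx _ hm) (hy _ hm)
  have h2 : S.mkQ = 0 := by
    apply P.hom_ext_diag
    intro c k
    rw [Submodule.mkQ_apply, LinearMap.zero_apply, Submodule.Quotient.mk_eq_zero]
    exact h1 c _ (h0 ⟨k, rfl⟩)
  rw [← Submodule.ker_mkQ S, h2, LinearMap.ker_zero]

end Relations

end PinCover

end

section

open MvPolynomial WithConv

theorem convPost_scalar {F : Type*} [Field F] {K : Type*} [AddCommGroup K] [Module F K]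
    [Coalgebra F K] {R : Type*} [Ring R] [Algebra F R] {R' : Type*} [Ring R'] [Algebra F R']
    (T : R →ₐ[F] R') (r : WithConv (K →ₗ[F] F)) :
    convPost T.toLinearMap (convScalar R r) = convScalar R' r := by
  apply WithConv.ext
  ext k
  simp only [convPost_apply, convScalar_apply, map_smul, AlgHom.toLinearMap_apply, map_one]

/-! ### The polynomial action as a family of endomorphisms -/

section PolyEnd

variable {F : Type*} [Field F] {ι : Type*} [Fintype ι] {K : Type*} [AddCommGroup K] [Module F K]
  [Coalgebra F K] [Coalgebra.IsCocomm F K]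

/-- The action of `K` on polynomials, as a family of endomorphisms. -/
def polyEnd (r : ι → ι → WithConv (K →ₗ[F] F)) :
    WithConv (K →ₗ[F] Module.End F (MvPolynomial ι F)) :=
  toConv ((WithConv.linearEquiv F (K →ₗ[F] MvPolynomial ι F)).toLinearMap ∘ₗ
    (polyAction r).toLinearMap).flip

theorem polyEnd_apply (r : ι → ι → WithConv (K →ₗ[F] F)) (x : K) (f : MvPolynomial ι F) :
    (polyEnd r).ofConv x f = (polyAction r f).ofConv x := rfl

theorem pderiv_mul_polyEnd (r : ι → ι → WithConv (K →ₗ[F] F)) (l : ι) :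
    convConst F K (pderiv l : Derivation F (MvPolynomial ι F) _).toLinearMap * polyEnd r =
      ∑ k, convScalar _ (r l k) *
        (polyEnd r * convConst F K (pderiv k : Derivation F (MvPolynomial ι F) _).toLinearMap) := by
  apply WithConv.ext
  refine LinearMap.ext fun x => LinearMap.ext fun f => ?_
  rw [convConst_mul_apply, WithConv.ofConv_sum, LinearMap.sum_apply, LinearMap.sum_apply]
  have h := congrArg (fun g => g.ofConv x) (pderiv_polyAction r l f)
  refine h.trans ?_
  rw [WithConv.ofConv_sum, LinearMap.sum_apply]
  refine Finset.sum_congr rfl fun k _ => ?_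
  let t := Coalgebra.Repr.arbitrary F x
  rw [t.convMul_apply, t.convMul_apply, LinearMap.sum_apply]
  refine Finset.sum_congr rfl fun i _ => ?_
  rw [convMul_const_apply, convScalar_apply, convScalar_apply]
  simp only [smul_mul_assoc, one_mul, LinearMap.smul_apply]
  rfl

end PolyEnd

namespace PinCover

variable {F : Type*} [Field F] [CharZero F] {H : Type*} [Ring H] [HopfAlgebra F H]
  {V : Type*} [AddCommGroup V] [Module F V] [FiniteDimensional F V]
  {ρ : H →ₐ[F] Module.End F V} {B : LinearMap.BilinForm F V} {κ : V →ₗ[F] V →ₗ[F] H}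
  {ι : Type*} [Fintype ι]
  {K : Type*} [Ring K] [HopfAlgebra F K] [Coalgebra.IsCocomm F K]
  (P : PinCover ρ B K)

theorem repr_eq [DecidableEq ι] {v v' : Module.Basis ι F V}
    (hv : ∀ i j, B (v i) (v' j) = if i = j then 1 else 0) (u : V) :
    ∑ k, B (v k) u • v' k = u := by
  conv_rhs => rw [← v'.sum_repr u]
  refine Finset.sum_congr rfl fun k _ => ?_
  rw [bilin_eq_sum hv]
  simp [Finsupp.single_apply]

/-! ### Twisted right multiplication, read off from the Dirac element -/

section Dirac

variable [DecidableEq ι] {v v' : Module.Basis ι F V}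

theorem ofV_eq_sym_X (k : ι) : HeckeAlg.sym ρ κ v (X k) = HeckeAlg.ofV ρ κ (v k) := by
  rw [HeckeAlg.sym, symmetrize_X]

/-- Because `Δ_C(k)^* D = Δ_C(sgn k) D = D Δ_C(k)`, the Dirac element can be moved to the left of
`Δ_C(k)`, and its factors `v_i` commute with `C`. -/
theorem inclA_mul_dirac (hB : IsOrthogonal ρ B)
    (hv : ∀ i j, B (v i) (v' j) = if i = j then 1 else 0) (c : Cl B) (k : K) :
    invA ρ B κ (inclA ρ B κ (clIncl H B c * P.diag k)) * dirac ρ B κ v v' =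
      ∑ i, (HeckeAlg.ofV ρ κ (v i) ⊗ₜ 1) * inclA ρ B κ (clIncl H B
        (CliffordAlgebra.involute c * CliffordAlgebra.ι (quad B) (v' i)) * P.diag k) := by
  have h1 : ∀ c, inclA ρ B κ (clIncl H B c) = 1 ⊗ₜ c := by
    intro c; simp [inclA]
  rw [map_mul, map_mul, ← diagA_eq, P.invA_diagA κ hB, mul_assoc, ← P.dirac_mul_diagA κ hB hv,
    ← mul_assoc, h1, dirac, Finset.mul_sum, Finset.sum_mul]
  refine Finset.sum_congr rfl fun i _ => ?_
  rw [map_mul, h1, ← diagA_eq, ← mul_assoc]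
  simp [invA]

/-- An element of `H ⊗ C` can be a sum of products `c Δ_C(k)` in many ways, so well-definedness of
`R_u` is the issue. It is settled in `A ⊗ C`: the map `m ↦ m^* D` is well defined, its values are
linear in the `X_k` by `inclA_mul_dirac`, and the PBW isomorphism extracts the coefficient of `X_k`,
which is `R` at `v'_k`. -/
theorem exists_twistedRightMul (hA : IsPBW ρ κ) (hB : IsOrthogonal ρ B)
    (hv : ∀ i j, B (v i) (v' j) = if i = j then 1 else 0) :
    ∃ R : V →ₗ[F] Module.End F (H ⊗[F] Cl B), P.IsTwistedRightMul R := by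
  let Rk : ι → Module.End F (H ⊗[F] Cl B) := fun k =>
    (TensorProduct.lid F (H ⊗[F] Cl B)).toLinearMap ∘ₗ
      LinearMap.rTensor _ (lcoeff F (Finsupp.single k 1)) ∘ₗ
      (acEquiv B v hA).symm.toLinearMap ∘ₗ LinearMap.mulRight F (dirac ρ B κ v v') ∘ₗ
      (invA ρ B κ).toLinearMap ∘ₗ (inclA ρ B κ).toLinearMap
  have hRk : ∀ k c x, Rk k (clIncl H B c * P.diag x) =
      clIncl H B (CliffordAlgebra.involute c * CliffordAlgebra.ι (quad B) (v' k)) * P.diag x := by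
    intro k c x
    have h1 : (acEquiv B v hA).symm (invA ρ B κ (inclA ρ B κ (clIncl H B c * P.diag x)) *
        dirac ρ B κ v v') = ∑ i, X i ⊗ₜ (clIncl H B
        (CliffordAlgebra.involute c * CliffordAlgebra.ι (quad B) (v' i)) * P.diag x) := by
      rw [LinearEquiv.symm_apply_eq, P.inclA_mul_dirac hB hv, map_sum]
      refine Finset.sum_congr rfl fun i _ => ?_
      rw [acEquiv_tmul, ofV_eq_sym_X]
    have h2 : Rk k (clIncl H B c * P.diag x) = TensorProduct.lid F (H ⊗[F] Cl B)
      (LinearMap.rTensor _ (lcoeff F (Finsupp.single k 1))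
        ((acEquiv B v hA).symm (invA ρ B κ (inclA ρ B κ (clIncl H B c * P.diag x)) *
        dirac ρ B κ v v'))) := rfl
    rw [h2, h1, map_sum, map_sum, Finset.sum_eq_single k]
    · simp [lcoeff]
    · intro i _ hi
      have : lcoeff F (Finsupp.single k 1) (X i : MvPolynomial ι F) = 0 := by
        simp [lcoeff, coeff_X, Finsupp.single_left_inj, hi]
      rw [LinearMap.rTensor_tmul, this, TensorProduct.zero_tmul, map_zero]
    · simp
  -- The operators for the dual basis vectors are combined according to `u = ∑ B(v_k, u) v'_k`.
  refine ⟨∑ k, (B (v k)).smulRight (Rk k), fun u c x => ?_⟩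
  simp only [LinearMap.sum_apply, LinearMap.smulRight_apply, LinearMap.smul_apply, hRk]
  conv_rhs => rw [← repr_eq hv u]
  simp only [map_sum, map_smul, Finset.mul_sum, mul_smul_comm, Finset.sum_mul, smul_mul_assoc]

variable {P} {R : V →ₗ[F] Module.End F (H ⊗[F] Cl B)} (hR : P.IsTwistedRightMul R)

include hR

theorem invA_inclA_mul_dirac (hB : IsOrthogonal ρ B)
    (hv : ∀ i j, B (v i) (v' j) = if i = j then 1 else 0) (m : H ⊗[F] Cl B) :
    invA ρ B κ (inclA ρ B κ m) * dirac ρ B κ v v' =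
      ∑ i, (HeckeAlg.ofV ρ κ (v i) ⊗ₜ 1) * inclA ρ B κ (R (v' i) m) := by
  let f : H ⊗[F] Cl B →ₗ[F] HeckeAlg ρ κ ⊗[F] Cl B :=
    LinearMap.mulRight F (dirac ρ B κ v v') ∘ₗ (invA ρ B κ).toLinearMap ∘ₗ
      (inclA ρ B κ).toLinearMap
  let g : H ⊗[F] Cl B →ₗ[F] HeckeAlg ρ κ ⊗[F] Cl B :=
    ∑ i, LinearMap.mulLeft F (HeckeAlg.ofV ρ κ (v i) ⊗ₜ 1) ∘ₗ
      (inclA ρ B κ).toLinearMap ∘ₗ R (v' i)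
  have : f = g := by
    apply P.hom_ext_diag
    intro c k
    refine (P.inclA_mul_dirac hB hv c k).trans ?_
    simp only [g, LinearMap.sum_apply, LinearMap.comp_apply, hR _ _ _]
    rfl
  have h := congrArg (fun f => f m) this
  refine h.trans ?_
  simp [g]

end Dirac

/-! ### Equivariance of the creation operators -/

/-- Left multiplication by `Δ_C` on `H ⊗ C`. -/
def diagEnd : WithConv (K →ₗ[F] Module.End F (H ⊗[F] Cl B)) :=
  convPost (Algebra.lmul F (H ⊗[F] Cl B)).toLinearMap (toConv P.diag.toLinearMap)

theorem clIncl_commute :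
    ∀ (x : H) (c : Cl B), Commute ((Algebra.TensorProduct.includeLeft : H →ₐ[F] H ⊗[F] Cl B) x)
      (clIncl H B c) := by
  intro x c
  simp [Commute, SemiconjBy]

/-- The relation for `γ^*` is transported to `H ⊗ C`: the `H` leg commutes with vectors of `C`, and
replacing `γ^*` by `γ det` produces the determinant. -/
theorem convAct_mul_diag (hB : IsOrthogonal ρ B) (u : V) :
    convAct P.rep ((clIncl H B).toLinearMap ∘ₗ CliffordAlgebra.ι (quad B)) u *
        toConv P.diag.toLinearMap =
      toConv P.diag.toLinearMap * P.convDet _ *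
        convConst F K (clIncl H B (CliffordAlgebra.ι (quad B) u)) := by
  have h1 := P.toConv_diag (AlgHom.id F _)
  simp only [AlgHom.id_comp] at h1
  have h2 := congrArg (convPost (clIncl H B).toLinearMap) (P.toConv_involute_γ_mul hB u)
  rw [convPost_mul, convPost_mul, convPost_const, P.toConv_involute_γ hB, convPost_mul] at h2
  have h3 : convPost (clIncl H B).toLinearMap (P.convDet (Cl B)) = P.convDet _ := convPost_scalar _ _
  rw [h3] at h2
  have h4 : ∀ f : WithConv (K →ₗ[F] Cl B),
      toConv ((Algebra.TensorProduct.includeLeft.comp (P.π : K →ₐ[F] H)).toLinearMap) *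
        convPost (clIncl H B).toLinearMap f =
      convPost (clIncl H B).toLinearMap f *
        toConv ((Algebra.TensorProduct.includeLeft.comp (P.π : K →ₐ[F] H)).toLinearMap) :=
    fun f => convMul_comm_of_commute fun _ _ => clIncl_commute _ _
  have h5 := h4 (convAct P.rep (CliffordAlgebra.ι (quad B)) u)
  have h6 : toConv P.diag.toLinearMap =
      toConv ((Algebra.TensorProduct.includeLeft.comp (P.π : K →ₐ[F] H)).toLinearMap) *
        convPost (clIncl H B).toLinearMap (toConv P.γ.toLinearMap) := h1
  rw [h6]
  change convPost (clIncl H B).toLinearMap (convAct P.rep (CliffordAlgebra.ι (quad B)) u) * _ = _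
  rw [← mul_assoc, ← h5, mul_assoc, ← h2]
  simp only [mul_assoc]
  rfl

/-- Only the `γ` leg notices `c`, so `Δ_C(h) c` is `γ(h₍₁₎) c γ(S h₍₂₎) Δ_C(h₍₃₎)`. This brings the
product into the form `c' Δ_C(k)` on which `R` is known. -/
theorem diag_mul_const (c : Cl B) :
    toConv P.diag.toLinearMap * convConst F K (clIncl H B c) =
      convPost (clIncl H B).toLinearMap (toConv P.γ.toLinearMap * convConst F K c *
        toConv (P.γ.toLinearMap ∘ₗ HopfAlgebra.antipode F)) * toConv P.diag.toLinearMap := by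
  have h1 := P.toConv_diag (AlgHom.id F _)
  simp only [AlgHom.id_comp] at h1
  have h4 : ∀ f : WithConv (K →ₗ[F] Cl B),
      toConv ((Algebra.TensorProduct.includeLeft.comp (P.π : K →ₐ[F] H)).toLinearMap) *
        convPost (clIncl H B).toLinearMap f =
      convPost (clIncl H B).toLinearMap f *
        toConv ((Algebra.TensorProduct.includeLeft.comp (P.π : K →ₐ[F] H)).toLinearMap) :=
    fun f => convMul_comm_of_commute fun _ _ => clIncl_commute _ _
  have h6 : toConv P.diag.toLinearMap =
      toConv ((Algebra.TensorProduct.includeLeft.comp (P.π : K →ₐ[F] H)).toLinearMap) *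
        convPost (clIncl H B).toLinearMap (toConv P.γ.toLinearMap) := h1
  have h7 := P.toConv_π_eq
  rw [convPost_mul, convPost_mul, mul_assoc _ _ (toConv P.diag.toLinearMap)]
  have h8 : convPost (clIncl H B).toLinearMap
      (toConv (P.γ.toLinearMap ∘ₗ HopfAlgebra.antipode F)) * toConv P.diag.toLinearMap =
      toConv ((Algebra.TensorProduct.includeLeft.comp (P.π : K →ₐ[F] H)).toLinearMap) := h7.symm
  rw [h8, ← convPost_mul, ← h4, h6, convPost_mul, convPost_const, mul_assoc]
  rfl

section Equivariance

variable {P} {R : V →ₗ[F] Module.End F (H ⊗[F] Cl B)} (v : Module.Basis ι F V)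

theorem leftMulV_diagEnd (hB : IsOrthogonal ρ B) (k : ι) :
    ∑ l, convScalar _ (convCoeff P.rep v l k) * (convConst F K (leftMulV H B (v l)) * P.diagEnd) =
      P.diagEnd * P.convDet _ * convConst F K (leftMulV H B (v k)) := by
  have h1 := P.convAct_mul_diag hB (v k)
  rw [convAct_basis] at h1
  have h2 := congrArg (convPost (Algebra.lmul F (H ⊗[F] Cl B)).toLinearMap) h1
  rw [convPost_mul, convPost_mul, convPost_mul, convPost_sum, Finset.sum_mul] at h2
  have h3 : convPost (Algebra.lmul F (H ⊗[F] Cl B)).toLinearMap (P.convDet _) = P.convDet _ := convPost_scalar _ _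
  simp only [convPost_scalar_mul, convPost_const, h3] at h2
  simp only [← mul_assoc]
  exact h2

variable (hR : P.IsTwistedRightMul R)

include hR

theorem convPost_right (u : V) (g : WithConv (K →ₗ[F] Cl B)) :
    convPost (R u) (convPost (clIncl H B).toLinearMap g * toConv P.diag.toLinearMap) =
      convPost (clIncl H B).toLinearMap (convPost
        (CliffordAlgebra.involute (Q := quad B)).toLinearMap g *
          convConst F K (CliffordAlgebra.ι (quad B) u)) * toConv P.diag.toLinearMap := by
  apply WithConv.ext
  ext x : 1
  let r := Coalgebra.Repr.arbitrary F x
  rw [convPost_apply, r.convMul_apply, r.convMul_apply, map_sum]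
  refine Finset.sum_congr rfl fun i _ => ?_
  rw [convPost_apply, convPost_apply, convMul_const_apply]
  exact hR u _ _

/-- The operator `R` inserts its vector between the Clifford factor and `Δ_C`. After writing `Δ_C(h)
c` as in `diag_mul_const`, the acted-on vector therefore meets `γ(S h)^*`, and the pin relation
turns it back into the original vector. -/
theorem right_diagEnd (hB : IsOrthogonal ρ B) (k : ι) :
    ∑ l, convScalar _ (convCoeff P.rep v l k) * (convConst F K (R (v l)) * P.diagEnd) =
      P.diagEnd * P.convDet _ * convConst F K (R (v k)) := by
  let Δ : WithConv (K →ₗ[F] H ⊗[F] Cl B) := toConv P.diag.toLinearMap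
  have e1 : ∀ (T : Module.End F (H ⊗[F] Cl B)) (m : H ⊗[F] Cl B),
      convPost (LinearMap.applyₗ m) (convConst F K T * P.diagEnd) =
        convPost T (Δ * convConst F K m) := by
    intro T m
    apply WithConv.ext
    ext x : 1
    rw [convPost_apply, convConst_mul_apply, convPost_apply, convMul_const_apply]
    rfl
  have e2 : ∀ (T : Module.End F (H ⊗[F] Cl B)) (m : H ⊗[F] Cl B),
      convPost (LinearMap.applyₗ m) (P.diagEnd * P.convDet _ * convConst F K T) =
        Δ * P.convDet _ * convConst F K (T m) := by
    intro T m
    rw [← convScalar_comm, ← convScalar_comm, mul_assoc, mul_assoc, convPost_scalar_mul]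
    congr 1
    apply WithConv.ext
    ext x : 1
    rw [convPost_apply, convMul_const_apply, convMul_const_apply]
    rfl
  have key : ∀ c, ∑ l, convScalar _ (convCoeff P.rep v l k) *
      convPost (R (v l)) (Δ * convConst F K (clIncl H B c)) =
        Δ * P.convDet _ * convConst F K (R (v k) (clIncl H B c)) := by
    intro c
    let Γ := toConv P.γ.toLinearMap
    let Γi := toConv (P.γ.toLinearMap ∘ₗ HopfAlgebra.antipode F)
    let J := convPost (K := K) (CliffordAlgebra.involute (Q := quad B)).toLinearMap
    have h1 : ∀ l, convPost (R (v l)) (Δ * convConst F K (clIncl H B c)) =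
        convPost (clIncl H B).toLinearMap (J (Γ * convConst F K c * Γi) *
          convConst F K (CliffordAlgebra.ι (quad B) (v l))) * Δ := by
      intro l
      rw [P.diag_mul_const, convPost_right hR]
    -- This is the pin relation `γ^* u = (h · u) γ` with `γ^*` and `γ` moved to the opposite sides
    -- by their convolution inverses.
    have h2 : J Γi * convAct P.rep (CliffordAlgebra.ι (quad B)) (v k) =
        convConst F K (CliffordAlgebra.ι (quad B) (v k)) * Γi := by
      have h3 := P.toConv_involute_γ_mul hB (v k)
      have h4 : J Γi * J Γ = 1 := antipode_mul_toConv ((CliffordAlgebra.involute (Q := quad B)).comp P.γ)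
      have h5 : Γ * Γi = 1 := toConv_mul_antipode P.γ
      calc _ = J Γi * (convAct P.rep (CliffordAlgebra.ι (quad B)) (v k) * Γ) * Γi := by
            rw [mul_assoc, mul_assoc, h5, mul_one]
        _ = J Γi * (J Γ * convConst F K (CliffordAlgebra.ι (quad B) (v k))) * Γi := by
            rw [← h3]; rfl
        _ = _ := by rw [← mul_assoc, h4, one_mul]
    have h6 : ∑ l, convScalar _ (convCoeff P.rep v l k) * (convPost (clIncl H B).toLinearMap
        (J (Γ * convConst F K c * Γi) * convConst F K (CliffordAlgebra.ι (quad B) (v l))) * Δ) =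
        convPost (clIncl H B).toLinearMap (J (Γ * convConst F K c * Γi) *
          convAct P.rep (CliffordAlgebra.ι (quad B)) (v k)) * Δ := by
      rw [convAct_basis, Finset.mul_sum, convPost_sum, Finset.sum_mul]
      refine Finset.sum_congr rfl fun l _ => ?_
      rw [← mul_assoc, ← convPost_scalar_mul, ← mul_assoc, ← mul_assoc, convScalar_comm]
    have h7 : J (Γ * convConst F K c * Γi) * convAct P.rep (CliffordAlgebra.ι (quad B)) (v k) =
        J Γ * convConst F K (CliffordAlgebra.involute c * CliffordAlgebra.ι (quad B) (v k)) * Γi := by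
      have : J (Γ * convConst F K c * Γi) = J Γ * convConst F K (CliffordAlgebra.involute c) * J Γi := by
        simp only [J]
        rw [convPost_mul, convPost_mul, convPost_const]
        rfl
      rw [this, mul_assoc, h2, convConst_mul]
      simp only [mul_assoc]
    have h8 : R (v k) (clIncl H B c) =
        clIncl H B (CliffordAlgebra.involute c * CliffordAlgebra.ι (quad B) (v k)) := by
      have := hR (v k) c 1
      simpa only [map_one, mul_one] using this
    simp only [h1]
    rw [h6, h7, h8]
    have h9 : Δ * P.convDet _ = convPost (clIncl H B).toLinearMap (J Γ) *
        toConv ((Algebra.TensorProduct.includeLeft.comp (P.π : K →ₐ[F] H)).toLinearMap) := by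
      have h10 : J Γ = Γ * P.convDet _ := P.toConv_involute_γ hB
      have h3 : convPost (clIncl H B).toLinearMap (P.convDet (Cl B)) = P.convDet _ := convPost_scalar _ _
      have h11 := P.toConv_diag (AlgHom.id F _)
      simp only [AlgHom.id_comp] at h11
      rw [h10, convPost_mul, h3]
      have h12 : Δ = convPost (clIncl H B).toLinearMap Γ *
        toConv ((Algebra.TensorProduct.includeLeft.comp (P.π : K →ₐ[F] H)).toLinearMap) :=
        h11.trans (convMul_comm_of_commute fun _ _ => clIncl_commute _ _)
      rw [h12, ← convScalar_comm, ← convScalar_comm, mul_assoc]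
    have h13 : convPost (clIncl H B).toLinearMap Γi * Δ =
        toConv ((Algebra.TensorProduct.includeLeft.comp (P.π : K →ₐ[F] H)).toLinearMap) :=
      P.toConv_π_eq.symm
    rw [h9, convPost_mul, mul_assoc, h13, convPost_mul, convPost_const, mul_assoc, mul_assoc]
    congr 1
    exact convConst_commute fun _ => (clIncl_commute _ _).symm
  apply WithConv.ext
  refine LinearMap.ext fun x => ?_
  apply P.hom_ext_diag
  intro c y
  have h1 : ∀ (T : WithConv (K →ₗ[F] Module.End F (H ⊗[F] Cl B))) (m : H ⊗[F] Cl B),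
      T.ofConv x m = (convPost (LinearMap.applyₗ m) T).ofConv x := fun _ _ => rfl
  rw [h1, h1, e2, convPost_sum]
  simp only [convPost_scalar_mul, e1]
  rw [right_mul_diag hR]
  -- Right linearity of `R` over the image of `Δ_C` reduces the general spanning vector `c Δ_C(y)`
  -- to `c`, which is `key`.
  have h2 : ∀ l, convPost (R (v l)) (Δ * convConst F K (clIncl H B c * P.diag y)) =
      convPost (R (v l)) (Δ * convConst F K (clIncl H B c)) * convConst F K (P.diag y) := by
    intro l
    apply WithConv.ext
    ext z : 1
    rw [convPost_apply, convMul_const_apply, convMul_const_apply, convPost_apply,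
      convMul_const_apply, ← mul_assoc, right_mul_diag hR]
  simp only [h2]
  rw [convConst_mul, ← mul_assoc, ← key c, Finset.sum_mul]
  simp only [mul_assoc]

theorem creat_diagEnd (hB : IsOrthogonal ρ B) (k : ι) :
    ∑ l, convScalar _ (convCoeff P.rep v l k) * (convConst F K (creat H R (v l)) * P.diagEnd) =
      P.diagEnd * P.convDet _ * convConst F K (creat H R (v k)) := by
  have h1 := leftMulV_diagEnd (P := P) v hB k
  have h2 := right_diagEnd v hR hB k
  simp only [creat, LinearMap.smul_apply, LinearMap.add_apply, convConst_smul, convConst_add,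
    smul_mul_assoc, mul_smul_comm, add_mul, mul_add, smul_add, Finset.sum_add_distrib,
    ← Finset.smul_sum, h1, h2]

end Equivariance

end PinCover

end

section

open MvPolynomial WithConv

section PolyEnd

variable {F : Type*} [Field F] {ι : Type*} [Fintype ι] {K : Type*} [AddCommGroup K] [Module F K]
  [Coalgebra F K] [Coalgebra.IsCocomm F K]

theorem polyEnd_mul_X (r : ι → ι → WithConv (K →ₗ[F] F)) (k : ι) :
    polyEnd r * convConst F K (LinearMap.mulLeft F (X k : MvPolynomial ι F)) =
      ∑ l, convScalar (Module.End F (MvPolynomial ι F)) (r l k) *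
        (convConst F K (LinearMap.mulLeft F (X l : MvPolynomial ι F)) * polyEnd r) := by
  apply WithConv.ext
  refine LinearMap.ext fun x => LinearMap.ext fun f => ?_
  rw [convMul_const_apply, WithConv.ofConv_sum, LinearMap.sum_apply, LinearMap.sum_apply,
    Module.End.mul_apply, LinearMap.mulLeft_apply, polyEnd_apply, map_mul, polyAction_X,
    Finset.sum_mul, WithConv.ofConv_sum, LinearMap.sum_apply]
  refine Finset.sum_congr rfl fun l _ => ?_
  let t := Coalgebra.Repr.arbitrary F x
  rw [mul_assoc, t.convMul_apply, t.convMul_apply, LinearMap.sum_apply]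
  refine Finset.sum_congr rfl fun i _ => ?_
  rw [convConst_mul_apply, convConst_mul_apply, convScalar_apply, convScalar_apply]
  simp only [smul_mul_assoc, one_mul, LinearMap.smul_apply]
  rfl

theorem polyAction_homogeneousComponent [CharZero F] (r : ι → ι → WithConv (K →ₗ[F] F)) (n : ℕ)
    (f : MvPolynomial ι F) (x : K) :
    (polyAction r (homogeneousComponent n f)).ofConv x =
      homogeneousComponent n ((polyAction r f).ofConv x) := by
  change (polyEnd r).ofConv x (homogeneousComponent n f) =
    homogeneousComponent n ((polyEnd r).ofConv x f)
  conv_rhs => rw [← sum_homogeneousComponent f, map_sum, map_sum]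
  have h : ∀ i, homogeneousComponent n ((polyEnd r).ofConv x (homogeneousComponent i f)) =
      if n = i then (polyEnd r).ofConv x (homogeneousComponent i f) else 0 := fun i =>
    homogeneousComponent_of_mem
      (polyAction_isHomogeneous r (homogeneousComponent_isHomogeneous i f) x)
  simp only [h]
  rw [Finset.sum_ite_eq]
  split_ifs with hn
  · rfl
  · rw [homogeneousComponent_eq_zero n f (by simpa using hn), map_zero]

end PolyEnd

/-! ### Equivariance of contracted sums of operators -/

section Commutation

variable {E : Type*} [Ring E] {ι : Type*} [Fintype ι]

/-- Meant for `∑ ∂_l ⊗ b_l`, with `p` the action on polynomials, `q` the action on `H ⊗ C` and `χ`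
the determinant. Derivatives and creators transform by the same matrix in opposite indices, so the
matrix is absorbed directly. -/
theorem sum_mul_mul_of_dual_relations {d b : ι → E} {p q χ : E} {s : ι → ι → E}
    (hs : ∀ l k x, s l k * x = x * s l k) (hχ : ∀ x, χ * x = x * χ)
    (hd : ∀ l, d l * p = ∑ k, s l k * (p * d k))
    (hb : ∀ k, ∑ l, s l k * (b l * q) = q * χ * b k)
    (hbp : ∀ l, b l * p = p * b l) (hdq : ∀ l, d l * q = q * d l) :
    (∑ l, d l * b l) * (p * q) = p * q * χ * ∑ l, d l * b l := by
  have h1 : ∀ l, d l * b l * (p * q) = ∑ k, p * d k * (s l k * (b l * q)) := by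
    intro l
    rw [mul_assoc, ← mul_assoc (b l), hbp, mul_assoc, ← mul_assoc, hd, Finset.sum_mul]
    refine Finset.sum_congr rfl fun k _ => ?_
    rw [hs, mul_assoc]
  rw [Finset.sum_mul, Finset.mul_sum]
  simp only [h1]
  rw [Finset.sum_comm]
  refine Finset.sum_congr rfl fun k _ => ?_
  rw [← Finset.mul_sum, hb]
  calc p * d k * (q * χ * b k) = p * (d k * q) * χ * b k := by simp only [mul_assoc]
    _ = p * q * (d k * χ) * b k := by rw [hdq]; simp only [mul_assoc]
    _ = _ := by rw [← hχ]; simp only [mul_assoc]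

/-- Meant for `∑ X_l ⊗ a_l`, where variables and annihilators are indexed by dual bases. Each
transforms by its own matrix, and these contract by the contragredience relation `hss`. -/
theorem sum_mul_mul_of_inverse_relations [DecidableEq ι] {x a : ι → E} {p q χ : E}
    {s s' : ι → ι → E} (hs' : ∀ l k y, s' l k * y = y * s' l k) (hχ : ∀ y, χ * y = y * χ)
    (hx : ∀ k, p * x k = ∑ l, s l k * (x l * p))
    (ha : ∀ k, ∑ l, s' l k * (a l * q) = q * χ * a k)
    (hss : ∀ l m, ∑ k, s l k * s' m k = if l = m then 1 else 0)
    (hap : ∀ l, a l * p = p * a l) (hxq : ∀ l, x l * q = q * x l) :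
    (∑ l, x l * a l) * (p * q) = p * q * χ * ∑ l, x l * a l := by
  have h1 : ∀ k, p * q * χ * (x k * a k) =
      ∑ l, ∑ m, (s l k * s' m k) * (x l * p * (a m * q)) := by
    intro k
    have : p * q * χ * (x k * a k) = p * x k * (q * χ * a k) :=
      calc _ = p * q * (χ * x k) * a k := by simp only [mul_assoc]
        _ = p * (q * x k) * χ * a k := by rw [hχ]; simp only [mul_assoc]
        _ = _ := by rw [← hxq]; simp only [mul_assoc]
    rw [this, hx, ← ha, Finset.sum_mul_sum]
    refine Finset.sum_congr rfl fun l _ => Finset.sum_congr rfl fun m _ => ?_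
    rw [mul_assoc, mul_assoc (s l k), ← mul_assoc (x l * p), ← hs', mul_assoc (s' m k)]
  rw [Finset.sum_mul, Finset.mul_sum]
  simp only [h1]
  rw [Finset.sum_comm]
  refine Finset.sum_congr rfl fun l _ => ?_
  rw [Finset.sum_comm]
  simp only [← Finset.sum_mul, hss, ite_mul, one_mul, zero_mul]
  rw [Finset.sum_ite_eq, if_pos (Finset.mem_univ _), mul_assoc, ← mul_assoc (a l), hap]
  simp only [mul_assoc]

end Commutation

/-! ### Families of endomorphisms acting on one tensor factor -/

section TensorEnd

variable {F : Type*} [Field F] {K : Type*} [AddCommGroup K] [Module F K] [Coalgebra F K]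
  {M N : Type*} [AddCommGroup M] [Module F M] [AddCommGroup N] [Module F N]

/-- Families of endomorphisms of `M`, acting on the first factor of `M ⊗ N`. -/
def convR (N : Type*) [AddCommGroup N] [Module F N] (f : WithConv (K →ₗ[F] Module.End F M)) :
    WithConv (K →ₗ[F] Module.End F (M ⊗[F] N)) :=
  convPost (Module.End.rTensorAlgHom F M N).toLinearMap f

/-- Families of endomorphisms of `N`, acting on the second factor of `M ⊗ N`. -/
def convL (M : Type*) [AddCommGroup M] [Module F M] (f : WithConv (K →ₗ[F] Module.End F N)) :
    WithConv (K →ₗ[F] Module.End F (M ⊗[F] N)) :=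
  convPost (Module.End.lTensorAlgHom F N M).toLinearMap f

theorem convR_mul (f g : WithConv (K →ₗ[F] Module.End F M)) :
    convR N (f * g) = convR N f * convR N g := convPost_mul _ _ _

theorem convL_mul (f g : WithConv (K →ₗ[F] Module.End F N)) :
    convL M (f * g) = convL M f * convL M g := convPost_mul _ _ _

theorem convR_sum {ι : Type*} (s : Finset ι) (f : ι → WithConv (K →ₗ[F] Module.End F M)) :
    convR N (∑ i ∈ s, f i) = ∑ i ∈ s, convR N (f i) := convPost_sum _ _ _

theorem convL_sum {ι : Type*} (s : Finset ι) (f : ι → WithConv (K →ₗ[F] Module.End F N)) :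
    convL M (∑ i ∈ s, f i) = ∑ i ∈ s, convL M (f i) := convPost_sum _ _ _

theorem convL_scalar (r : WithConv (K →ₗ[F] F)) :
    convL M (convScalar (Module.End F N) r) = convScalar _ r := convPost_scalar _ _

theorem convR_scalar_mul (r : WithConv (K →ₗ[F] F)) (f : WithConv (K →ₗ[F] Module.End F M)) :
    convR N (convScalar _ r * f) = convScalar _ r * convR N f := convPost_scalar_mul _ _ _

theorem convL_scalar_mul (r : WithConv (K →ₗ[F] F)) (f : WithConv (K →ₗ[F] Module.End F N)) :
    convL M (convScalar _ r * f) = convScalar _ r * convL M f := convPost_scalar_mul _ _ _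

theorem convConst_map (S : Module.End F M) (T : Module.End F N) :
    convConst F K (TensorProduct.map S T : Module.End F (M ⊗[F] N)) =
      convR N (convConst F K S) * convL M (convConst F K T) := by
  rw [convR, convL, convPost_const, convPost_const, ← convConst_mul]
  congr 1
  ext
  rfl

theorem convR_mul_convL [Coalgebra.IsCocomm F K] (f : WithConv (K →ₗ[F] Module.End F M))
    (g : WithConv (K →ₗ[F] Module.End F N)) : convR N f * convL M g = convL M g * convR N f := by
  apply convMul_comm_of_commute
  intro a b
  change _ * _ = _ * _
  ext
  rfl

end TensorEnd

theorem mul_ofConv_of_twist {F : Type*} [Field F] {K : Type*} [Ring K] [HopfAlgebra F K]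
    [Coalgebra.IsCocomm F K] {V : Type*} [AddCommGroup V] [Module F V] [FiniteDimensional F V]
    {R : Type*} [Ring R] [Algebra F R] (σ : K →ₐ[F] Module.End F V) {T : R}
    {f : WithConv (K →ₗ[F] R)}
    (h : convConst F K T * f = f * convScalar R (coeffMatrix σ).det * convConst F K T) (x : K) :
    T * f.ofConv x = f.ofConv (twist σ x) * T := by
  have h1 := toConv_comp_twist σ f.ofConv
  rw [toConv_ofConv] at h1
  rw [← h1] at h
  have h2 := congrArg (fun f => f.ofConv x) h
  rw [convConst_mul_apply, convMul_const_apply] at h2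
  exact h2

namespace PinCover

variable {F : Type*} [Field F] [CharZero F] {H : Type*} [Ring H] [HopfAlgebra F H]
  {V : Type*} [AddCommGroup V] [Module F V] [FiniteDimensional F V]
  {ρ : H →ₐ[F] Module.End F V} {B : LinearMap.BilinForm F V} {κ : V →ₗ[F] V →ₗ[F] H}
  {ι : Type*} [Fintype ι]
  {K : Type*} [Ring K] [HopfAlgebra F K] [Coalgebra.IsCocomm F K]
  (P : PinCover ρ B K)

/-! ### The left action of `H̃` on `F[X] ⊗ (H ⊗ C)` -/

section LeftAction

variable (v : Module.Basis ι F V)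

/-- The left action of `H̃` on `F[X] ⊗ (H ⊗ C)`, which corresponds to left multiplication by
`Δ_C` on `A ⊗ C`. -/
def leftAct : WithConv (K →ₗ[F] Module.End F (MvPolynomial ι F ⊗[F] (H ⊗[F] Cl B))) :=
  convR (H ⊗[F] Cl B) (polyEnd (convCoeff P.rep v)) * convL (MvPolynomial ι F) P.diagEnd

theorem leftAct_tmul {x : K} {κ : Type*} (r : Coalgebra.Repr F x κ) (f : MvPolynomial ι F)
    (m : H ⊗[F] Cl B) : (P.leftAct v).ofConv x (f ⊗ₜ m) = ∑ i ∈ r.index,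
      (polyAction (convCoeff P.rep v) f).ofConv (r.left i) ⊗ₜ (P.diag (r.right i) * m) := by
  rw [leftAct, r.convMul_apply, LinearMap.sum_apply]
  rfl

theorem polyComp_leftAct (n : ℕ) (x : K) (w : MvPolynomial ι F ⊗[F] (H ⊗[F] Cl B)) :
    polyComp F ι _ n ((P.leftAct v).ofConv x w) = (P.leftAct v).ofConv x (polyComp F ι _ n w) := by
  induction w with
  | zero => simp
  | add x y hx hy => simp only [map_add, hx, hy]
  | tmul f m =>
    let r := Coalgebra.Repr.arbitrary F x
    rw [polyComp, LinearMap.rTensor_tmul, P.leftAct_tmul v r, P.leftAct_tmul v r, map_sum]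
    refine Finset.sum_congr rfl fun i _ => ?_
    rw [LinearMap.rTensor_tmul, polyAction_homogeneousComponent]

/-- The `C` leg of `Δ_C` commutes with `A`, and the `H` leg passes each vector by the smash product
relation, so `convMul_symmetrize` applies in every degree. -/
theorem diagA_mul_sym (f : MvPolynomial ι F) :
    toConv (P.diagA κ).toLinearMap *
        convConst F K ((HeckeAlg.sym ρ κ v f ⊗ₜ 1 : HeckeAlg ρ κ ⊗[F] Cl B)) =
      convPost ((Algebra.TensorProduct.includeLeft : HeckeAlg ρ κ →ₐ[F] _).toLinearMap ∘ₗ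
        HeckeAlg.sym ρ κ v) (polyAction (convCoeff P.rep v) f) *
          toConv (P.diagA κ).toLinearMap := by
  obtain ⟨n, c, hc, hf⟩ : ∃ (n : ℕ) (c : ℕ → MvPolynomial ι F),
      (∀ i, (c i).IsHomogeneous i) ∧ f = ∑ i ∈ Finset.range n, c i :=
    ⟨_, _, fun i => homogeneousComponent_isHomogeneous i f, (sum_homogeneousComponent f).symm⟩
  rw [hf]
  simp only [map_sum, TensorProduct.sum_tmul, convConst_sum, convPost_sum, Finset.mul_sum,
    Finset.sum_mul]
  refine Finset.sum_congr rfl fun i _ => ?_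
  let a₁ : HeckeAlg ρ κ →ₐ[F] HeckeAlg ρ κ ⊗[F] Cl B := Algebra.TensorProduct.includeLeft
  let a₂ : Cl B →ₐ[F] HeckeAlg ρ κ ⊗[F] Cl B := Algebra.TensorProduct.includeRight
  let φ := toConv ((HeckeAlg.ofH ρ κ).toLinearMap ∘ₗ (P.π : K →ₐ[F] H).toLinearMap)
  let Γ := toConv (a₂.toLinearMap ∘ₗ P.γ.toLinearMap)
  have hΔ : toConv (P.diagA κ).toLinearMap = convPost a₁.toLinearMap φ * Γ := by
    refine (P.toConv_diag (inclA ρ B κ)).trans ?_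
    congr 1
    congr 1
    ext k
    simp [inclA, a₂]
  have h1 := convMul_symmetrize (convCoeff P.rep v) (fun k => HeckeAlg.ofV ρ κ (v k)) φ
    (fun k => by rw [HeckeAlg.toConv_ofH_mul, convAct_basis, Finset.sum_mul]) (hc i)
  have h2 := congrArg (convPost a₁.toLinearMap) h1
  rw [convPost_mul, convPost_mul, convPost_const] at h2
  have h3 : Γ * convConst F K (a₁ (HeckeAlg.sym ρ κ v (c i))) =
      convConst F K (a₁ (HeckeAlg.sym ρ κ v (c i))) * Γ := by
    refine (convConst_commute fun k => ?_).symm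
    change _ * _ = _ * _
    simp [a₁, a₂, Γ]
  rw [hΔ, mul_assoc]
  refine (congrArg (convPost a₁.toLinearMap φ * ·) h3).trans ?_
  rw [← mul_assoc, ← mul_assoc]
  exact congrArg (· * Γ) h2

theorem acEquiv_leftAct (hA : IsPBW ρ κ) (x : K) (w : MvPolynomial ι F ⊗[F] (H ⊗[F] Cl B)) :
    acEquiv B v hA ((P.leftAct v).ofConv x w) = P.diagA κ x * acEquiv B v hA w := by
  induction w with
  | zero => simp
  | add x y hx hy => simp only [map_add, hx, hy, mul_add]
  | tmul f m =>
    let r := Coalgebra.Repr.arbitrary F x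
    have h := congrArg (fun g => g.ofConv x) (P.diagA_mul_sym (κ := κ) v f)
    rw [convMul_const_apply, r.convMul_apply] at h
    rw [P.leftAct_tmul v r, map_sum, acEquiv_tmul, ← mul_assoc]
    refine Eq.trans ?_ (congrArg (· * inclA ρ B κ m) h.symm)
    rw [Finset.sum_mul]
    refine Finset.sum_congr rfl fun i _ => ?_
    rw [acEquiv_tmul, map_mul, mul_assoc]
    rfl

end LeftAction

section Equivariance

variable {P} [DecidableEq ι] {v v' : Module.Basis ι F V}
  {R : V →ₗ[F] Module.End F (H ⊗[F] Cl B)} (hR : P.IsTwistedRightMul R)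

theorem leftAct_convDet (v : Module.Basis ι F V)
    (T : Module.End F (MvPolynomial ι F ⊗[F] (H ⊗[F] Cl B)))
    (h : convConst F K T * P.leftAct v =
      P.leftAct v * P.convDet (Module.End F (MvPolynomial ι F ⊗[F] (H ⊗[F] Cl B))) *
        convConst F K T)
    (x : K) (w : MvPolynomial ι F ⊗[F] (H ⊗[F] Cl B)) :
    T ((P.leftAct v).ofConv x w) = (P.leftAct v).ofConv (P.sgn x) (T w) := by
  exact congrArg (fun f => f w) (mul_ofConv_of_twist P.rep h x)

include hR

theorem annih_diagEnd (v : Module.Basis ι F V) (hB : IsOrthogonal ρ B) (k : ι) :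
    ∑ l, convScalar _ (convCoeff P.rep v l k) * (convConst F K (annih H R (v l)) * P.diagEnd) =
      P.diagEnd * P.convDet _ * convConst F K (annih H R (v k)) := by
  have h1 := leftMulV_diagEnd (P := P) v hB k
  have h2 := right_diagEnd v hR hB k
  have h3 : ∀ u, annih H R u = leftMulV H B u + (-1 : F) • R u := by
    intro u
    refine LinearMap.ext fun m => ?_
    simp [annih, sub_eq_add_neg]
  simp only [h3, convConst_smul, convConst_add,
    smul_mul_assoc, mul_smul_comm, add_mul, mul_add, Finset.sum_add_distrib,
    ← Finset.smul_sum, h1, h2]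

theorem koszulS_mul_leftAct (hB : IsOrthogonal ρ B) :
    convConst F K (koszulS fun k => creat H R (v k)) * P.leftAct v =
      P.leftAct v * P.convDet (Module.End F (MvPolynomial ι F ⊗[F] (H ⊗[F] Cl B))) *
        convConst F K (koszulS fun k => creat H R (v k)) := by
  have hS : convConst F K (koszulS fun k => creat H R (v k)) =
      ∑ k, convR (H ⊗[F] Cl B) (convConst F K
        (pderiv k : Derivation F (MvPolynomial ι F) _).toLinearMap) *
        convL (MvPolynomial ι F) (convConst F K (creat H R (v k))) := by
    rw [koszulS, convConst_sum]
    exact Finset.sum_congr rfl fun k _ => convConst_map _ _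
  rw [hS, leftAct]
  refine sum_mul_mul_of_dual_relations (s := fun l k => convScalar _ (convCoeff P.rep v l k))
    (fun _ _ _ => convScalar_comm _ _) (fun _ => convScalar_comm _ _) (fun l => ?_) (fun k => ?_)
    (fun _ => (convR_mul_convL _ _).symm) (fun _ => convR_mul_convL _ _)
  · rw [← convR_mul, pderiv_mul_polyEnd, convR_sum]
    exact Finset.sum_congr rfl fun k _ => by rw [convR_scalar_mul, convR_mul]
  · have := congrArg (convL (MvPolynomial ι F)) (creat_diagEnd v hR hB k)
    rw [convL_sum, convL_mul, convL_mul, convL_scalar] at this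
    rw [← this]
    exact Finset.sum_congr rfl fun k _ => by rw [convL_scalar_mul, convL_mul]

theorem koszulD_mul_leftAct (hB : IsOrthogonal ρ B)
    (hv : ∀ i j, B (v i) (v' j) = if i = j then 1 else 0) :
    convConst F K (koszulD fun k => annih H R (v' k)) * P.leftAct v =
      P.leftAct v * P.convDet (Module.End F (MvPolynomial ι F ⊗[F] (H ⊗[F] Cl B))) *
        convConst F K (koszulD fun k => annih H R (v' k)) := by
  have hD : convConst F K (koszulD fun k => annih H R (v' k)) =
      ∑ k, convR (H ⊗[F] Cl B) (convConst F K (LinearMap.mulLeft F (X k : MvPolynomial ι F))) *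
        convL (MvPolynomial ι F) (convConst F K (annih H R (v' k))) := by
    rw [koszulD, convConst_sum]
    exact Finset.sum_congr rfl fun k _ => convConst_map _ _
  rw [hD, leftAct]
  refine sum_mul_mul_of_inverse_relations (s := fun l k => convScalar _ (convCoeff P.rep v l k))
    (s' := fun l k => convScalar _ (convCoeff P.rep v' l k))
    (fun _ _ _ => convScalar_comm _ _) (fun _ => convScalar_comm _ _) (fun k => ?_) (fun k => ?_)
    (fun l m => ?_) (fun _ => (convR_mul_convL _ _).symm) (fun _ => convR_mul_convL _ _)
  · rw [← convR_mul, polyEnd_mul_X, convR_sum]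
    exact Finset.sum_congr rfl fun k _ => by rw [convR_scalar_mul, convR_mul]
  · have := congrArg (convL (MvPolynomial ι F)) (annih_diagEnd hR v' hB k)
    rw [convL_sum, convL_mul, convL_mul, convL_scalar] at this
    rw [← this]
    exact Finset.sum_congr rfl fun k _ => by rw [convL_scalar_mul, convL_mul]
  · have h := congrArg (convScalar (Module.End F (MvPolynomial ι F ⊗[F] (H ⊗[F] Cl B))))
      (convCoeff_mul_eq_one (P.rep_orthogonal hB) hv l m)
    simp only [← convScalar_mul]
    refine ((convPost_sum _ _ _).symm.trans h).trans ?_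
    split_ifs
    · exact convScalar_one
    · apply WithConv.ext
      refine LinearMap.ext fun x => ?_
      rw [convScalar_apply]
      exact zero_smul _ _

theorem koszulS_leftAct (hB : IsOrthogonal ρ B) (x : K)
    (w : MvPolynomial ι F ⊗[F] (H ⊗[F] Cl B)) :
    koszulS (fun k => creat H R (v k)) ((P.leftAct v).ofConv x w) =
      (P.leftAct v).ofConv (P.sgn x) (koszulS (fun k => creat H R (v k)) w) :=
  leftAct_convDet v _ (koszulS_mul_leftAct hR hB) x w

theorem koszulD_leftAct (hB : IsOrthogonal ρ B)
    (hv : ∀ i j, B (v i) (v' j) = if i = j then 1 else 0) (x : K)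
    (w : MvPolynomial ι F ⊗[F] (H ⊗[F] Cl B)) :
    koszulD (fun k => annih H R (v' k)) ((P.leftAct v).ofConv x w) =
      (P.leftAct v).ofConv (P.sgn x) (koszulD (fun k => annih H R (v' k)) w) :=
  leftAct_convDet v _ (koszulD_mul_leftAct hR hB hv) x w

end Equivariance

end PinCover

end

section

open MvPolynomial WithConv

namespace PinCover

variable {F : Type*} [Field F] [CharZero F] {H : Type*} [Ring H] [HopfAlgebra F H]
  {V : Type*} [AddCommGroup V] [Module F V] [FiniteDimensional F V]
  {ρ : H →ₐ[F] Module.End F V} {B : LinearMap.BilinForm F V} {κ : V →ₗ[F] V →ₗ[F] H}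
  {ι : Type*} [Fintype ι]
  {K : Type*} [Ring K] [HopfAlgebra F K] [Coalgebra.IsCocomm F K]
  (P : PinCover ρ B K)

/-! ### The Dirac differential -/

section Differential

variable (ρ B κ) in
/-- The super-commutator with the Dirac element, `x ↦ D x - x^* D`. -/
def diracD (v v' : ι → V) : Module.End F (HeckeAlg ρ κ ⊗[F] Cl B) :=
  LinearMap.mulLeft F (dirac ρ B κ v v') -
    LinearMap.mulRight F (dirac ρ B κ v v') ∘ₗ (invA ρ B κ).toLinearMap

theorem diracD_apply (v v' : ι → V) (x : HeckeAlg ρ κ ⊗[F] Cl B) :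
    diracD ρ B κ v v' x = dirac ρ B κ v v' * x - invA ρ B κ x * dirac ρ B κ v v' := rfl

theorem invA_dirac (v v' : ι → V) : invA ρ B κ (dirac ρ B κ v v') = -dirac ρ B κ v v' := by
  rw [dirac, map_sum, ← Finset.sum_neg_distrib]
  refine Finset.sum_congr rfl fun k _ => ?_
  simp [invA, TensorProduct.tmul_neg]

theorem invA_diracD (v v' : ι → V) (x : HeckeAlg ρ κ ⊗[F] Cl B) :
    invA ρ B κ (diracD ρ B κ v v' x) = -diracD ρ B κ v v' (invA ρ B κ x) := by
  rw [diracD_apply, diracD_apply, map_sub, map_mul, map_mul, invA_dirac]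
  simp only [neg_mul, mul_neg, sub_neg_eq_add, neg_sub]
  abel

/-- `D` is odd, so the second application takes the opposite sign on the mixed term `D x^* D`, which
cancels. -/
theorem diracD_diracD (v v' : ι → V) (x : HeckeAlg ρ κ ⊗[F] Cl B) :
    diracD ρ B κ v v' (diracD ρ B κ v v' x) =
      dirac ρ B κ v v' ^ 2 * x - x * dirac ρ B κ v v' ^ 2 := by
  rw [diracD_apply v v' (diracD ρ B κ v v' x), invA_diracD, diracD_apply, diracD_apply, invA_invA]
  noncomm_ring

variable (κ) in
/-- The elements of parity `p` of `A ⊗ C` on which `H̃` acts by the `p`-th power of the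
determinant. -/
def detPart (p : ℕ) : Submodule F (HeckeAlg ρ κ ⊗[F] Cl B) where
  carrier := {x | invA ρ B κ x = (-1 : F) ^ p • x ∧
    ∀ k, P.diagA κ k * x = x * P.diagA κ (P.sgn^[p] k)}
  zero_mem' := by simp
  add_mem' := by
    rintro x y ⟨hx, hx'⟩ ⟨hy, hy'⟩
    exact ⟨by rw [map_add, hx, hy, smul_add], fun k => by rw [mul_add, hx', hy', add_mul]⟩
  smul_mem' := by
    rintro a x ⟨hx, hx'⟩
    exact ⟨by rw [map_smul, hx, smul_comm], fun k => by
      rw [mul_smul_comm, hx', smul_mul_assoc]⟩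

theorem mem_detPart {p : ℕ} {x : HeckeAlg ρ κ ⊗[F] Cl B} :
    x ∈ P.detPart κ p ↔ invA ρ B κ x = (-1 : F) ^ p • x ∧
      ∀ k, P.diagA κ k * x = x * P.diagA κ (P.sgn^[p] k) := Iff.rfl

/-- Both the sign and `sgn` are involutive, so only the parity of the index matters. It is kept as a
natural number so that odd operators simply add one. -/
theorem detPart_add_two (hB : IsOrthogonal ρ B) (p : ℕ) :
    P.detPart κ (p + 2) = P.detPart κ p := by
  ext x
  rw [mem_detPart, mem_detPart, pow_add]
  simp only [Function.iterate_succ_apply', P.sgn_sgn hB]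
  simp

theorem mul_mem_detPart {p q : ℕ} {x y : HeckeAlg ρ κ ⊗[F] Cl B} (hx : x ∈ P.detPart κ p)
    (hy : y ∈ P.detPart κ q) : x * y ∈ P.detPart κ (p + q) := by
  rw [mem_detPart] at *
  refine ⟨?_, fun k => ?_⟩
  · rw [map_mul, hx.1, hy.1, smul_mul_smul_comm, pow_add]
  · rw [← mul_assoc, hx.2, mul_assoc, hy.2, ← mul_assoc, ← Function.iterate_add_apply, add_comm q]

theorem tmul_one_mul_comm {z : HeckeAlg ρ κ} (hz : z ∈ Subalgebra.center F (HeckeAlg ρ κ))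
    (x : HeckeAlg ρ κ ⊗[F] Cl B) : (z ⊗ₜ[F] (1 : Cl B)) * x = x * (z ⊗ₜ[F] (1 : Cl B)) := by
  induction x with
  | zero => simp
  | add x y hx hy => rw [mul_add, add_mul, hx, hy]
  | tmul a c =>
    rw [Subalgebra.mem_center_iff] at hz
    rw [Algebra.TensorProduct.tmul_mul_tmul, Algebra.TensorProduct.tmul_mul_tmul, hz, one_mul,
      mul_one]

theorem invA_tmul_one (z : HeckeAlg ρ κ) :
    invA ρ B κ (z ⊗ₜ[F] (1 : Cl B)) = z ⊗ₜ[F] (1 : Cl B) := by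
  simp [invA]

theorem tmul_one_mem_detPart {z : HeckeAlg ρ κ}
    (hz : z ∈ Subalgebra.center F (HeckeAlg ρ κ)) : z ⊗ₜ[F] (1 : Cl B) ∈ P.detPart κ 0 := by
  rw [mem_detPart, invA_tmul_one]
  exact ⟨by simp, fun k => (tmul_one_mul_comm hz _).symm⟩

theorem diracD_tmul_one {z : HeckeAlg ρ κ} (hz : z ∈ Subalgebra.center F (HeckeAlg ρ κ))
    (v v' : ι → V) : diracD ρ B κ v v' (z ⊗ₜ[F] (1 : Cl B)) = 0 := by
  rw [diracD_apply, invA_tmul_one, tmul_one_mul_comm hz, sub_self]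

theorem diracD_mul_tmul_one {z : HeckeAlg ρ κ} (hz : z ∈ Subalgebra.center F (HeckeAlg ρ κ))
    (v v' : ι → V) (x : HeckeAlg ρ κ ⊗[F] Cl B) :
    diracD ρ B κ v v' (x * z ⊗ₜ[F] (1 : Cl B)) = diracD ρ B κ v v' x * z ⊗ₜ[F] (1 : Cl B) := by
  rw [diracD_apply, diracD_apply, map_mul, invA_tmul_one, mul_assoc (invA ρ B κ x),
    tmul_one_mul_comm hz, sub_mul, mul_assoc, mul_assoc]

variable [DecidableEq ι] {v v' : Module.Basis ι F V}

theorem diracD_diagA (hB : IsOrthogonal ρ B)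
    (hv : ∀ i j, B (v i) (v' j) = if i = j then 1 else 0) (k : K) :
    diracD ρ B κ v v' (P.diagA κ k) = 0 := by
  rw [diracD_apply, P.invA_diagA κ hB, P.dirac_mul_diagA κ hB hv, sub_self]

theorem diracD_mem_detPart (hB : IsOrthogonal ρ B)
    (hv : ∀ i j, B (v i) (v' j) = if i = j then 1 else 0) {p : ℕ} {x : HeckeAlg ρ κ ⊗[F] Cl B}
    (hx : x ∈ P.detPart κ p) : diracD ρ B κ v v' x ∈ P.detPart κ (p + 1) := by
  rw [mem_detPart] at *
  refine ⟨?_, fun k => ?_⟩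
  · rw [invA_diracD, hx.1, map_smul, pow_succ, mul_neg_one, neg_smul]
  · have h1 : ∀ k, P.diagA κ k * dirac ρ B κ v v' = dirac ρ B κ v v' * P.diagA κ (P.sgn k) := by
      intro k
      rw [P.dirac_mul_diagA κ hB hv, P.sgn_sgn hB]
    rw [diracD_apply, hx.1, mul_sub, sub_mul, ← mul_assoc, h1, mul_assoc, hx.2, smul_mul_assoc,
      smul_mul_assoc, mul_smul_comm, ← mul_assoc, ← mul_assoc (P.diagA κ k), hx.2, mul_assoc x,
      h1, ← Function.iterate_succ_apply (⇑P.sgn) p, ← Function.iterate_succ_apply' (⇑P.sgn) p]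
    simp only [mul_assoc]

/-- In `D² = c + Δ_C(h)` the first term is central. As `h` is even it is fixed by `sgn`, so `Δ_C(h)`
commutes with `detPart p` for every `p`. -/
theorem diracD_diracD_eq_zero (hD : Parthasarathy P κ (dirac ρ B κ v v')) {p : ℕ} {x : HeckeAlg ρ κ ⊗[F] Cl B}
    (hx : x ∈ P.detPart κ p) : diracD ρ B κ v v' (diracD ρ B κ v v' x) = 0 := by
  obtain ⟨c, hc, h, hh, hD⟩ := hD
  have h1 : P.sgn h = h := by
    rw [P.sgn_of_mem hh]
    simp
  rw [diracD_diracD, hD, add_mul, mul_add, hx.2, Function.iterate_fixed h1,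
    (Subalgebra.mem_center_iff.mp hc x).symm, sub_self]

theorem diracD_diagA_mul (hB : IsOrthogonal ρ B)
    (hv : ∀ i j, B (v i) (v' j) = if i = j then 1 else 0) {k : K}
    (hk : P.diagA κ k ∈ P.detPart κ 0) (x : HeckeAlg ρ κ ⊗[F] Cl B) :
    diracD ρ B κ v v' (P.diagA κ k * x) = P.diagA κ k * diracD ρ B κ v v' x := by
  have h1 := hk.1
  have h2 := P.dirac_mul_diagA κ hB hv k
  rw [pow_zero, one_smul] at h1
  rw [← P.invA_diagA κ hB, h1] at h2
  rw [diracD_apply, diracD_apply, map_mul, h1, ← mul_assoc, h2, mul_sub]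
  simp only [mul_assoc]

/-- Oddness is the `-1` eigenspace of the involution because `2` is invertible. The condition on
conjugation by `Δ_C` becomes the commutation rule upon cancelling the convolution-invertible factor
`Δ_C ∘ S`, the sign character being `ε ∘ sgn`. -/
theorem mem_detPart_one_iff (hB : IsOrthogonal ρ B) (x : HeckeAlg ρ κ ⊗[F] Cl B) :
    x ∈ P.oddDet κ ↔ x ∈ P.detPart κ 1 := by
  have h1 : x ∈ LinearMap.range (LinearMap.lTensor (HeckeAlg ρ κ)
      (CliffordAlgebra.evenOdd (quad B) 1).subtype) ↔ invA ρ B κ x = (-1 : F) ^ 1 • x := by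
    rw [pow_one, neg_smul, one_smul]
    constructor
    · rintro ⟨y, rfl⟩
      induction y with
      | zero => simp
      | add y z hy hz => rw [map_add, map_add, hy, hz, neg_add]
      | tmul a c =>
        rw [LinearMap.lTensor_tmul, Submodule.subtype_apply, invA,
          Algebra.TensorProduct.map_tmul, CliffordAlgebra.involute_eq_of_mem_odd c.2,
          TensorProduct.tmul_neg]
        rfl
    · intro hx
      -- The element `y - y^*` is twice the odd part of `y`, so for `x^* = -x` half of it recovers
      -- `x`.
      have h2 : ∀ y : HeckeAlg ρ κ ⊗[F] Cl B, y - invA ρ B κ y ∈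
          LinearMap.range (LinearMap.lTensor (HeckeAlg ρ κ)
            (CliffordAlgebra.evenOdd (quad B) 1).subtype) := by
        intro y
        induction y with
        | zero => simp
        | add y z hy hz =>
          rw [map_add, add_sub_add_comm]
          exact Submodule.add_mem _ hy hz
        | tmul a c =>
          obtain ⟨c₀, h₀, c₁, h₁, rfl⟩ := Submodule.mem_sup.mp
            ((CliffordAlgebra.evenOdd_isCompl (quad B)).sup_eq_top ▸ Submodule.mem_top : c ∈ _)
          refine ⟨a ⊗ₜ ⟨c₁ + c₁, Submodule.add_mem _ h₁ h₁⟩, ?_⟩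
          rw [invA, Algebra.TensorProduct.map_tmul, map_add,
            CliffordAlgebra.involute_eq_of_mem_even h₀, CliffordAlgebra.involute_eq_of_mem_odd h₁]
          change a ⊗ₜ (c₁ + c₁) = _
          rw [AlgHom.id_apply, ← TensorProduct.tmul_sub]
          congr 1
          abel
      have h3 := Submodule.smul_mem _ (2⁻¹ : F) (h2 x)
      rw [hx, sub_neg_eq_add, ← two_smul F, smul_smul, inv_mul_cancel₀ two_ne_zero,
        one_smul] at h3
      exact h3
  have h2 : (∀ (i : ZMod 2), ∀ h ∈ P.parity i,
      conj (P.diagA κ) x h = ((-1 : F) ^ i.val * Coalgebra.counit (R := F) h) • x) ↔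
      conj (P.diagA κ) x = LinearMap.toSpanSingleton F _ x ∘ₗ Coalgebra.counit ∘ₗ P.sgn := by
    have h3 : ∀ (i : ZMod 2), ∀ h ∈ P.parity i,
        (LinearMap.toSpanSingleton F _ x ∘ₗ Coalgebra.counit ∘ₗ P.sgn) h =
          ((-1 : F) ^ i.val * Coalgebra.counit (R := F) h) • x := by
      intro i h hh
      simp [P.sgn_of_mem hh]
    constructor
    · intro h
      exact P.eq_of_forall_parity hB fun i k hk => (h i k hk).trans (h3 i k hk).symm
    · intro h i k hk
      rw [h, h3 i k hk]
  have h3 : toConv (LinearMap.toSpanSingleton F (HeckeAlg ρ κ ⊗[F] Cl B) x ∘ₗ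
      Coalgebra.counit ∘ₗ P.sgn) = convConst F K x * P.convDet _ :=
    toConv_comp_twist P.rep (LinearMap.toSpanSingleton F _ x ∘ₗ Coalgebra.counit)
  have h4 : toConv ((P.diagA κ).toLinearMap ∘ₗ P.sgn) =
      toConv (P.diagA κ).toLinearMap * P.convDet _ := toConv_comp_twist P.rep _
  have h5 : conj (P.diagA κ) x = LinearMap.toSpanSingleton F _ x ∘ₗ Coalgebra.counit ∘ₗ P.sgn ↔
      toConv (P.diagA κ).toLinearMap * convConst F K x =
        convConst F K x * toConv ((P.diagA κ).toLinearMap ∘ₗ P.sgn) := by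
    have e1 := toConv_mul_antipode (P.diagA κ)
    have e2 := antipode_mul_toConv (P.diagA κ)
    constructor
    · intro h
      have h6 := congrArg toConv h
      rw [toConv_conj, h3] at h6
      rw [h4, ← convScalar_comm, ← mul_assoc, ← h6, mul_assoc, e2, mul_one]
    · intro h
      apply WithConv.toConv_injective
      rw [toConv_conj, h3, h, h4, ← convScalar_comm, mul_assoc, mul_assoc, e1, mul_one]
  have h6 : toConv (P.diagA κ).toLinearMap * convConst F K x =
        convConst F K x * toConv ((P.diagA κ).toLinearMap ∘ₗ P.sgn) ↔
      ∀ k, P.diagA κ k * x = x * P.diagA κ (P.sgn^[1] k) := by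
    constructor
    · intro h k
      have := congrArg (fun f => f.ofConv k) h
      rw [convMul_const_apply, convConst_mul_apply] at this
      exact this
    · intro h
      apply WithConv.ext
      refine LinearMap.ext fun k => ?_
      rw [convMul_const_apply, convConst_mul_apply]
      exact h k
  rw [mem_detPart]
  change _ ∧ _ ↔ _
  rw [h1, h2, h5, h6]

end Differential

end PinCover

end

section

open MvPolynomial WithConv

namespace PinCover

variable {F : Type*} [Field F] [CharZero F] {H : Type*} [Ring H] [HopfAlgebra F H]
  {V : Type*} [AddCommGroup V] [Module F V] [FiniteDimensional F V]
  {ρ : H →ₐ[F] Module.End F V} {B : LinearMap.BilinForm F V} {κ : V →ₗ[F] V →ₗ[F] H}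
  {ι : Type*} [Fintype ι] [DecidableEq ι] {v v' : Module.Basis ι F V}
  {K : Type*} [Ring K] [HopfAlgebra F K] [Coalgebra.IsCocomm F K]
  {P : PinCover ρ B K} {R : V →ₗ[F] Module.End F (H ⊗[F] Cl B)}

/-! ### The Koszul complex of `H ⊗ C` -/

section KoszulRelations

theorem annih_creat_basis (hR : P.IsTwistedRightMul R) (hB : IsOrthogonal ρ B)
    (hv : ∀ i j, B (v i) (v' j) = if i = j then 1 else 0) (k l : ι) :
    annih H R (v' k) * creat H R (v l) + creat H R (v l) * annih H R (v' k) =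
      if k = l then 2 else 0 := by
  rw [annih_creat hR hB.symm, hB.symm.eq, hv]
  by_cases h : k = l
  · rw [if_pos h, if_pos h.symm, mul_one, map_ofNat]
  · rw [if_neg h, if_neg (Ne.symm h), mul_zero, map_zero]

theorem eq_top_of_stable_basis (hR : P.IsTwistedRightMul R) (v v' : Module.Basis ι F V)
    (S : Submodule F (H ⊗[F] Cl B))
    (h0 : LinearMap.range P.diag.toLinearMap ≤ S)
    (ha : ∀ k, ∀ m ∈ S, annih H R (v' k) m ∈ S) (hb : ∀ k, ∀ m ∈ S, creat H R (v k) m ∈ S) :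
    S = ⊤ := by
  refine eq_top_of_stable hR h0 (fun u m hm => ?_) (fun u m hm => ?_)
  · rw [← v'.sum_repr u]
    simp only [map_sum, map_smul, LinearMap.sum_apply, LinearMap.smul_apply]
    exact Submodule.sum_mem _ fun k _ => Submodule.smul_mem _ _ (ha k m hm)
  · rw [← v.sum_repr u]
    simp only [map_sum, map_smul, LinearMap.sum_apply, LinearMap.smul_apply]
    exact Submodule.sum_mem _ fun k _ => Submodule.smul_mem _ _ (hb k m hm)

theorem annih_range (hR : P.IsTwistedRightMul R) (u : V) :
    ∀ m ∈ LinearMap.range P.diag.toLinearMap, annih H R u m = 0 := by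
  rintro _ ⟨k, rfl⟩
  exact annih_diag hR u k

end KoszulRelations

/-! ### The symbol of the Dirac differential -/

section Symbol

/-- `D x` contributes `v_k sym(f)` with the operator `L`, and `x^* D` contributes `sym(f) v_k` with
`R`. Both products equal `sym(X_k f)` up to lower degree, which leaves the Koszul term with `L - R`.
For `w` of degree at most `n` the error again has degree at most `n`, one below the expected leading
degree. -/
theorem symm_diracD_sub_koszulD_mem (hR : P.IsTwistedRightMul R) (hA : IsPBW ρ κ)
    (hB : IsOrthogonal ρ B)
    (hv : ∀ i j, B (v i) (v' j) = if i = j then 1 else 0) {n : ℕ}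
    {w : MvPolynomial ι F ⊗[F] (H ⊗[F] Cl B)} (hw : w ∈ polyLT F ι _ (n + 1)) :
    (acEquiv B v hA).symm (diracD ρ B κ v v' (acEquiv B v hA w)) -
      koszulD (fun k => annih H R (v' k)) w ∈ polyLT F ι _ (n + 1) := by
  suffices h : polyLT F ι (H ⊗[F] Cl B) (n + 1) ≤ (polyLT F ι (H ⊗[F] Cl B) (n + 1)).comap
      ((acEquiv B v hA).symm.toLinearMap ∘ₗ diracD ρ B κ v v' ∘ₗ (acEquiv B v hA).toLinearMap -
        koszulD (fun k => annih H R (v' k))) from h hw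
  refine polyLT_le fun m hm f hf x => ?_
  refine polyLT_mono (Nat.succ_le_of_lt hm) ?_
  have h1 : diracD ρ B κ v v' (acEquiv B v hA (f ⊗ₜ x)) -
      acEquiv B v hA (koszulD (fun k => annih H R (v' k)) (f ⊗ₜ x)) = ∑ k,
        (((HeckeAlg.ofV ρ κ (v k) * HeckeAlg.sym ρ κ v f - HeckeAlg.sym ρ κ v (X k * f)) ⊗ₜ 1) *
            inclA ρ B κ (leftMulV H B (v' k) x) -
          ((HeckeAlg.sym ρ κ v f * HeckeAlg.ofV ρ κ (v k) - HeckeAlg.sym ρ κ v (X k * f)) ⊗ₜ 1) *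
            inclA ρ B κ (R (v' k) x)) := by
    have e1 : dirac ρ B κ v v' * acEquiv B v hA (f ⊗ₜ x) = ∑ k,
        ((HeckeAlg.ofV ρ κ (v k) * HeckeAlg.sym ρ κ v f) ⊗ₜ 1) *
            inclA ρ B κ (leftMulV H B (v' k) x) := by
      rw [acEquiv_tmul, dirac, Finset.sum_mul]
      refine Finset.sum_congr rfl fun k _ => ?_
      rw [leftMulV_apply, map_mul, ← mul_assoc, ← mul_assoc]
      congr 1
      simp [inclA]
    have e2 : invA ρ B κ (acEquiv B v hA (f ⊗ₜ x)) * dirac ρ B κ v v' = ∑ k,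
        ((HeckeAlg.sym ρ κ v f * HeckeAlg.ofV ρ κ (v k)) ⊗ₜ 1) *
            inclA ρ B κ (R (v' k) x) := by
      rw [acEquiv_tmul, map_mul, invA_tmul_one, mul_assoc,
        invA_inclA_mul_dirac hR hB hv, Finset.mul_sum]
      refine Finset.sum_congr rfl fun k _ => ?_
      rw [← mul_assoc]
      congr 1
      simp
    rw [diracD_apply, e1, e2, koszulD_tmul, map_sum, ← Finset.sum_sub_distrib,
      ← Finset.sum_sub_distrib]
    refine Finset.sum_congr rfl fun k _ => ?_
    rw [acEquiv_tmul, annih, LinearMap.sub_apply, LinearMap.sub_apply, map_sub, mul_sub,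
      TensorProduct.sub_tmul, TensorProduct.sub_tmul, sub_mul, sub_mul]
    abel
  have h2 : (acEquiv B v hA).symm (diracD ρ B κ v v' (acEquiv B v hA (f ⊗ₜ x))) -
      koszulD (fun k => annih H R (v' k)) (f ⊗ₜ x) =
      (acEquiv B v hA).symm (diracD ρ B κ v v' (acEquiv B v hA (f ⊗ₜ x)) -
      acEquiv B v hA (koszulD (fun k => annih H R (v' k)) (f ⊗ₜ x))) := by
    rw [map_sub, LinearEquiv.symm_apply_apply]
  change (acEquiv B v hA).symm (diracD ρ B κ v v' (acEquiv B v hA (f ⊗ₜ x))) -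
      koszulD (fun k => annih H R (v' k)) (f ⊗ₜ x) ∈ _
  rw [h2, h1, map_sum]
  refine Submodule.sum_mem _ fun k _ => ?_
  have h3 := HeckeAlg.sym_X_mul_sub_mem ρ κ v k hf
  have h4 := HeckeAlg.sym_mul_sub_mem ρ κ v (v k) hf
  rw [map_sub]
  refine Submodule.sub_mem _ (mul_inclA_mem B v hA ?_ _) (mul_inclA_mem B v hA ?_ _)
  · rw [← neg_sub]
    exact Submodule.neg_mem _ h3
  · have := Submodule.sub_mem _ h4 h3
    rwa [sub_sub_sub_cancel_right] at this

end Symbol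

end PinCover

end

section

open MvPolynomial WithConv

namespace PinCover

variable {F : Type*} [Field F] [CharZero F] {H : Type*} [Ring H] [HopfAlgebra F H]
  {V : Type*} [AddCommGroup V] [Module F V] [FiniteDimensional F V]
  {ρ : H →ₐ[F] Module.End F V} {B : LinearMap.BilinForm F V} {κ : V →ₗ[F] V →ₗ[F] H}
  {ι : Type*} [Fintype ι] [DecidableEq ι] {v v' : Module.Basis ι F V}
  {K : Type*} [Ring K] [HopfAlgebra F K] [Coalgebra.IsCocomm F K]
  {P : PinCover ρ B K} {R : V →ₗ[F] Module.End F (H ⊗[F] Cl B)}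

/-! ### The subspaces `detPart` in polynomial coordinates -/

section Transport

theorem acEquiv_lTensor_mulRight (hA : IsPBW ρ κ) (k : K)
    (w : MvPolynomial ι F ⊗[F] (H ⊗[F] Cl B)) :
    acEquiv B v hA (LinearMap.lTensor _ (LinearMap.mulRight F (P.diag k)) w) =
      acEquiv B v hA w * P.diagA κ k := by
  induction w with
  | zero => simp
  | add x y hx hy => simp only [map_add, hx, hy, add_mul]
  | tmul f m =>
    rw [LinearMap.lTensor_tmul, acEquiv_tmul, acEquiv_tmul, LinearMap.mulRight_apply, map_mul,
      ← mul_assoc]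
    rfl

theorem acEquiv_lTensor_invH (hA : IsPBW ρ κ) (w : MvPolynomial ι F ⊗[F] (H ⊗[F] Cl B)) :
    acEquiv B v hA (LinearMap.lTensor _ (invH B).toLinearMap w) =
      invA ρ B κ (acEquiv B v hA w) := by
  induction w with
  | zero => simp
  | add x y hx hy => simp only [map_add, hx, hy]
  | tmul f m =>
    rw [LinearMap.lTensor_tmul, acEquiv_tmul, acEquiv_tmul, map_mul, invA_tmul_one, invA_inclA]
    rfl

variable (P v) in
/-- The subspace of `F[X] ⊗ (H ⊗ C)` corresponding to `detPart`. -/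
def polyDetPart (hA : IsPBW ρ κ) (p : ℕ) : Submodule F (MvPolynomial ι F ⊗[F] (H ⊗[F] Cl B)) :=
  (P.detPart κ p).comap (acEquiv B v hA).toLinearMap

theorem mem_polyDetPart (hA : IsPBW ρ κ) {p : ℕ} {w : MvPolynomial ι F ⊗[F] (H ⊗[F] Cl B)} :
    w ∈ polyDetPart v P hA p ↔
      LinearMap.lTensor _ (invH B).toLinearMap w = (-1 : F) ^ p • w ∧
      ∀ k, (P.leftAct v).ofConv k w =
        LinearMap.lTensor _ (LinearMap.mulRight F (P.diag (P.sgn^[p] k))) w := by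
  rw [polyDetPart, Submodule.mem_comap, LinearEquiv.coe_coe, mem_detPart]
  simp only [← acEquiv_lTensor_invH hA, ← map_smul, ← P.acEquiv_leftAct v hA,
    ← acEquiv_lTensor_mulRight hA, EmbeddingLike.apply_eq_iff_eq]

/-- In polynomial coordinates the defining conditions involve only operators that preserve the
polynomial degree, so the subspace is graded although `A ⊗ C` is merely filtered. -/
theorem polyComp_mem_polyDetPart (hA : IsPBW ρ κ) (n : ℕ) {p : ℕ}
    {w : MvPolynomial ι F ⊗[F] (H ⊗[F] Cl B)} (hw : w ∈ polyDetPart v P hA p) :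
    polyComp F ι _ n w ∈ polyDetPart v P hA p := by
  have h : ∀ (T : Module.End F (H ⊗[F] Cl B)) (w : MvPolynomial ι F ⊗[F] (H ⊗[F] Cl B)),
      LinearMap.lTensor _ T (polyComp F ι _ n w) = polyComp F ι _ n (LinearMap.lTensor _ T w) := by
    intro T w
    induction w with
    | zero => simp
    | add x y hx hy => simp only [map_add, hx, hy]
    | tmul f m => rfl
  rw [mem_polyDetPart] at *
  refine ⟨?_, fun k => ?_⟩
  · rw [h, hw.1, map_smul]
  · rw [h, ← hw.2, P.polyComp_leftAct]

/-- An odd operator that is linear on the right over `Δ_C`, and on the left up to `sgn`, shifts the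
index by one. This is the common pattern for the Koszul differential and the homotopy. -/
theorem mem_polyDetPart_of_anticommute (hA : IsPBW ρ κ)
    {T : Module.End F (MvPolynomial ι F ⊗[F] (H ⊗[F] Cl B))}
    (h1 : ∀ w, T (LinearMap.lTensor _ (invH B).toLinearMap w) =
      -LinearMap.lTensor _ (invH B).toLinearMap (T w))
    (h2 : ∀ k w, T (LinearMap.lTensor _ (LinearMap.mulRight F (P.diag k)) w) =
      LinearMap.lTensor _ (LinearMap.mulRight F (P.diag k)) (T w))
    (h3 : ∀ k w, T ((P.leftAct v).ofConv k w) = (P.leftAct v).ofConv (P.sgn k) (T w))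
    (hB : IsOrthogonal ρ B) {p : ℕ} {w : MvPolynomial ι F ⊗[F] (H ⊗[F] Cl B)}
    (hw : w ∈ polyDetPart v P hA p) : T w ∈ polyDetPart v P hA (p + 1) := by
  rw [mem_polyDetPart] at *
  refine ⟨?_, fun k => ?_⟩
  · rw [← neg_eq_iff_eq_neg.mpr (h1 w), hw.1, map_smul, pow_succ, mul_neg_one]
    exact (neg_smul _ _).symm
  · rw [Function.iterate_succ_apply, ← h2, ← hw.2, h3, P.sgn_sgn hB]

theorem koszulS_mem_polyDetPart (hR : P.IsTwistedRightMul R) (hA : IsPBW ρ κ)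
    (hB : IsOrthogonal ρ B) {p : ℕ} {w : MvPolynomial ι F ⊗[F] (H ⊗[F] Cl B)}
    (hw : w ∈ polyDetPart v P hA p) :
    koszulS (fun k => creat H R (v k)) w ∈ polyDetPart v P hA (p + 1) := by
  refine mem_polyDetPart_of_anticommute hA (fun w => ?_) (fun k w => ?_)
    (koszulS_leftAct hR hB) hB hw
  · induction w with
    | zero => simp
    | add x y hx hy => simp only [map_add, hx, hy, neg_add]
    | tmul f m =>
      rw [LinearMap.lTensor_tmul, koszulS_tmul, koszulS_tmul, map_sum, ← Finset.sum_neg_distrib]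
      refine Finset.sum_congr rfl fun k _ => ?_
      rw [LinearMap.lTensor_tmul, AlgHom.toLinearMap_apply, AlgHom.toLinearMap_apply,
        invH_creat hR hB, TensorProduct.tmul_neg, neg_neg]
  · induction w with
    | zero => simp
    | add x y hx hy => simp only [map_add, hx, hy]
    | tmul f m =>
      rw [LinearMap.lTensor_tmul, koszulS_tmul, koszulS_tmul, map_sum]
      refine Finset.sum_congr rfl fun l _ => ?_
      rw [LinearMap.lTensor_tmul, LinearMap.mulRight_apply, LinearMap.mulRight_apply,
        creat_mul_diag hR]

theorem koszulD_mem_polyDetPart (hR : P.IsTwistedRightMul R) (hA : IsPBW ρ κ)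
    (hB : IsOrthogonal ρ B) (hv : ∀ i j, B (v i) (v' j) = if i = j then 1 else 0) {p : ℕ}
    {w : MvPolynomial ι F ⊗[F] (H ⊗[F] Cl B)} (hw : w ∈ polyDetPart v P hA p) :
    koszulD (fun k => annih H R (v' k)) w ∈ polyDetPart v P hA (p + 1) := by
  refine mem_polyDetPart_of_anticommute hA (fun w => ?_) (fun k w => ?_)
    (koszulD_leftAct hR hB hv) hB hw
  · induction w with
    | zero => simp
    | add x y hx hy => simp only [map_add, hx, hy, neg_add]
    | tmul f m =>
      rw [LinearMap.lTensor_tmul, koszulD_tmul, koszulD_tmul, map_sum, ← Finset.sum_neg_distrib]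
      refine Finset.sum_congr rfl fun k _ => ?_
      rw [LinearMap.lTensor_tmul, AlgHom.toLinearMap_apply, AlgHom.toLinearMap_apply,
        invH_annih hR hB, TensorProduct.tmul_neg, neg_neg]
  · induction w with
    | zero => simp
    | add x y hx hy => simp only [map_add, hx, hy]
    | tmul f m =>
      rw [LinearMap.lTensor_tmul, koszulD_tmul, koszulD_tmul, map_sum]
      refine Finset.sum_congr rfl fun l _ => ?_
      rw [LinearMap.lTensor_tmul, LinearMap.mulRight_apply, LinearMap.mulRight_apply,
        annih_mul_diag hR]

/-- Each term of the Laplacian shifts the index by two, which is no shift at all, so all polynomials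
in it preserve the subspace. -/
theorem aeval_koszulE_mem_polyDetPart (hR : P.IsTwistedRightMul R) (hA : IsPBW ρ κ)
    (hB : IsOrthogonal ρ B) (hv : ∀ i j, B (v i) (v' j) = if i = j then 1 else 0) {p : ℕ}
    {w : MvPolynomial ι F ⊗[F] (H ⊗[F] Cl B)} (hw : w ∈ polyDetPart v P hA p)
    (q : Polynomial F) :
    Polynomial.aeval (koszulE (fun k => annih H R (v' k)) fun k => creat H R (v k)) q w ∈
      polyDetPart v P hA p := by
  have hE : ∀ w ∈ polyDetPart v P hA p,
      koszulE (fun k => annih H R (v' k)) (fun k => creat H R (v k)) w ∈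
        polyDetPart v P hA p := by
    intro w hw
    have h2 : polyDetPart v P hA (p + 1 + 1) = polyDetPart v P hA p := by
      rw [polyDetPart, P.detPart_add_two hB, polyDetPart]
    rw [← h2]
    exact Submodule.add_mem _
      (koszulD_mem_polyDetPart hR hA hB hv (koszulS_mem_polyDetPart hR hA hB hw))
      (koszulS_mem_polyDetPart hR hA hB (koszulD_mem_polyDetPart hR hA hB hv hw))
  induction q using Polynomial.induction_on' with
  | add q r hq hr =>
    rw [map_add]
    exact Submodule.add_mem _ hq hr
  | monomial n a =>
    rw [Polynomial.aeval_monomial, Module.End.mul_apply, Module.algebraMap_end_apply]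
    refine Submodule.smul_mem _ _ ?_
    induction n with
    | zero => simpa using hw
    | succ n ih =>
      rw [pow_succ', Module.End.mul_apply]
      exact hE _ ih

end Transport

/-! ### The cohomology of the Dirac differential -/

section Cohomology

/-- Since `d x` has no component of degree `n + 2`, the component of `x` of degree `n + 1` is a
Koszul cocycle. Its explicit primitive lies in `detPart (p + 1)`, and subtracting its Dirac
differential removes this component of `x` while adding only terms of lower degree. -/
theorem exists_sub_diracD_mem (hA : IsPBW ρ κ)
    (hB : IsOrthogonal ρ B) (hv : ∀ i j, B (v i) (v' j) = if i = j then 1 else 0) {p n : ℕ}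
    {x : HeckeAlg ρ κ ⊗[F] Cl B} (hx : x ∈ P.detPart κ p)
    (hx' : (acEquiv B v hA).symm x ∈ polyLT F ι _ (n + 2))
    (hd : (acEquiv B v hA).symm (diracD ρ B κ v v' x) ∈ polyLT F ι _ (n + 2)) :
    ∃ y ∈ P.detPart κ (p + 1),
      (acEquiv B v hA).symm (x - diracD ρ B κ v v' y) ∈ polyLT F ι _ (n + 1) := by
  obtain ⟨R, hR⟩ := P.exists_twistedRightMul hA hB hv
  set w := polyComp F ι _ (n + 1) ((acEquiv B v hA).symm x) with hw
  have hwp : w ∈ polyDetPart v P hA p := by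
    refine polyComp_mem_polyDetPart hA _ ?_
    rw [polyDetPart, Submodule.mem_comap, LinearEquiv.coe_coe, LinearEquiv.apply_symm_apply]
    exact hx
  have hww : polyComp F ι _ (n + 1) w = w := by
    rw [hw, polyComp_polyComp, if_pos rfl]
  have hdw : koszulD (fun k => annih H R (v' k)) w = 0 := by
    have h1 := symm_diracD_sub_koszulD_mem hR hA hB hv hx'
    rw [LinearEquiv.apply_symm_apply] at h1
    have h2 := Submodule.sub_mem _ hd h1
    rw [sub_sub_cancel] at h2
    rw [hw, koszulD_polyComp]
    exact mem_polyLT.mp h2 _ le_rfl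
  obtain ⟨q, hq⟩ := exists_koszul_primitive (fun k l => annih_annih hR hB.symm _ _)
    (annih_creat_basis hR hB hv) (fun k l => creat_creat hR hB.symm _ _)
    (fun k => annih_range hR (v' k)) (eq_top_of_stable_basis hR v v') hww hdw
  -- Only the component of degree `n` of the primitive matters, because the Koszul differential
  -- raises the degree by exactly one. Projecting makes its homogeneity immediate.
  set u := polyComp F ι _ n (koszulS (fun k => creat H R (v k)) (Polynomial.aeval
    (koszulE (fun k => annih H R (v' k)) fun k => creat H R (v k)) q w)) with hu
  have hup : u ∈ polyDetPart v P hA (p + 1) :=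
    polyComp_mem_polyDetPart hA _ (koszulS_mem_polyDetPart hR hA hB
      (aeval_koszulE_mem_polyDetPart hR hA hB hv hwp q))
  refine ⟨acEquiv B v hA u, hup, ?_⟩
  have h1 := symm_diracD_sub_koszulD_mem hR hA hB hv (polyComp_mem_polyLT n _ : u ∈ _)
  have h2 : koszulD (fun k => annih H R (v' k)) u = w := by
    rw [hu, koszulD_polyComp, hq, hww]
  rw [h2] at h1
  have h3 := Submodule.sub_mem _ (sub_polyComp_mem hx') h1
  rw [← hw, sub_sub_sub_cancel_right] at h3
  rw [map_sub]
  exact h3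

/-- An element of polynomial degree zero is `1 ⊗ m`. If `d x` has no linear term, then `∑ X_k ⊗ (L -
R)(v'_k) m = 0`, so `m` is a vacuum vector. -/
theorem exists_eq_diagA (hA : IsPBW ρ κ)
    (hB : IsOrthogonal ρ B) (hv : ∀ i j, B (v i) (v' j) = if i = j then 1 else 0)
    {x : HeckeAlg ρ κ ⊗[F] Cl B} (hx' : (acEquiv B v hA).symm x ∈ polyLT F ι _ 1)
    (hd : (acEquiv B v hA).symm (diracD ρ B κ v v' x) ∈ polyLT F ι _ 1) :
    ∃ k, x = P.diagA κ k := by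
  obtain ⟨R, hR⟩ := P.exists_twistedRightMul hA hB hv
  set w := (acEquiv B v hA).symm x with hw
  obtain ⟨m, hm⟩ : ∃ m, w = 1 ⊗ₜ m := by
    have h : polyLT F ι (H ⊗[F] Cl B) 1 ≤ LinearMap.range (TensorProduct.mk F _ _ 1) := by
      refine polyLT_le fun i hi f hf y => ?_
      obtain rfl : i = 0 := by omega
      rw [← mem_homogeneousSubmodule, homogeneousSubmodule_zero] at hf
      obtain ⟨a, rfl⟩ := Submodule.mem_one.mp hf
      exact ⟨a • y, by
        rw [TensorProduct.mk_apply, Algebra.algebraMap_eq_smul_one, TensorProduct.smul_tmul]⟩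
    obtain ⟨m, hm⟩ := h hx'
    exact ⟨m, hm.symm⟩
  have h1 := symm_diracD_sub_koszulD_mem hR hA hB hv (n := 0) hx'
  have hxw : acEquiv B v hA w = x := LinearEquiv.apply_symm_apply _ _
  rw [hxw] at h1
  have h2 := Submodule.sub_mem _ hd h1
  rw [sub_sub_cancel, hm, koszulD_tmul] at h2
  have h3 : ∀ k, annih H R (v' k) m = 0 := by
    intro k
    have h4 := mem_polyLT.mp h2 1 le_rfl
    simp only [mul_one, map_sum, polyComp_tmul (isHomogeneous_X F _), if_true] at h4
    have h5 := congrArg (fun t => TensorProduct.lid F (H ⊗[F] Cl B)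
      (LinearMap.rTensor _ (lcoeff F (Finsupp.single k 1)) t)) h4
    simp only [map_sum, map_zero] at h5
    rw [Finset.sum_eq_single k] at h5
    · simpa [lcoeff] using h5
    · intro i _ hi
      have : lcoeff F (Finsupp.single k 1) (X i : MvPolynomial ι F) = 0 := by
        simp [lcoeff, coeff_X, Finsupp.single_left_inj, hi]
      rw [LinearMap.rTensor_tmul, this, TensorProduct.zero_tmul, map_zero]
    · simp
  obtain ⟨k, hk⟩ := mem_of_forall_annihilated (annih_creat_basis hR hB hv)
    (fun k l => creat_creat hR hB.symm _ _)
    (fun k => annih_range hR (v' k)) (eq_top_of_stable_basis hR v v') h3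
  refine ⟨k, ?_⟩
  rw [← hxw, hm, acEquiv_tmul, ← hk, HeckeAlg.sym, symmetrize_one]
  exact one_mul _

/-- Leading terms are removed until degree zero is reached. Requiring only that `d x` have degree
zero, rather than vanish, is what makes the result usable for uniqueness; the requirement survives
the induction because `d²` kills the correction. -/
theorem exists_eq_diagA_add (hA : IsPBW ρ κ)
    (hB : IsOrthogonal ρ B) (hv : ∀ i j, B (v i) (v' j) = if i = j then 1 else 0)
    (hD : Parthasarathy P κ (dirac ρ B κ v v')) {p : ℕ}
    {x : HeckeAlg ρ κ ⊗[F] Cl B} (hx : x ∈ P.detPart κ p)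
    (hd : (acEquiv B v hA).symm (diracD ρ B κ v v' x) ∈ polyLT F ι _ 1) :
    ∃ k, ∃ y ∈ P.detPart κ (p + 1), x = P.diagA κ k + diracD ρ B κ v v' y := by
  obtain ⟨n, hn, -⟩ := exists_mem_polyLT_sum ((acEquiv B v hA).symm x)
  -- The bound is raised by one so that the base case is polynomial degree at most zero instead of
  -- the zero element.
  replace hn := polyLT_mono n.le_succ hn
  induction n generalizing x with
  | zero =>
    obtain ⟨k, rfl⟩ := exists_eq_diagA (P := P) hA hB hv hn hd
    exact ⟨k, 0, Submodule.zero_mem _, by rw [map_zero, add_zero]⟩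
  | succ n ih =>
    obtain ⟨y, hy, hxy⟩ := exists_sub_diracD_mem hA hB hv hx hn (polyLT_mono (by omega) hd)
    have h1 : x - diracD ρ B κ v v' y ∈ P.detPart κ p := by
      refine Submodule.sub_mem _ hx ?_
      rw [← P.detPart_add_two hB]
      exact P.diracD_mem_detPart hB hv hy
    obtain ⟨k, z, hz, h2⟩ := ih h1
      (by rw [map_sub, P.diracD_diracD_eq_zero hD hy, sub_zero]; exact hd) hxy
    exact ⟨k, y + z, Submodule.add_mem _ hy hz, by
      rw [map_add, add_left_comm, ← h2, add_sub_cancel]⟩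

theorem inclA_injective (hA : IsPBW ρ κ) (v : Module.Basis ι F V) :
    Function.Injective (inclA ρ B κ) := by
  rw [injective_iff_map_eq_zero]
  intro m hm
  have h1 : acEquiv B v hA (1 ⊗ₜ m) = 0 := by
    rw [acEquiv_tmul, hm, mul_zero]
  rw [LinearEquiv.map_eq_zero_iff] at h1
  have h2 := congrArg (fun t => TensorProduct.lid F (H ⊗[F] Cl B)
      (LinearMap.rTensor _ (lcoeff F 0) t)) h1
  simpa [lcoeff] using h2

/-- The differential of `a` is `Δ_C(k)`, of polynomial degree zero, so `a` is itself of the form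
`Δ_C(l) + d y`, and this is killed by `d`. -/
theorem diagA_eq_zero_of_eq_diracD (hA : IsPBW ρ κ)
    (hB : IsOrthogonal ρ B) (hv : ∀ i j, B (v i) (v' j) = if i = j then 1 else 0)
    (hD : Parthasarathy P κ (dirac ρ B κ v v')) {k : K} {a : HeckeAlg ρ κ ⊗[F] Cl B}
    (ha : a ∈ P.detPart κ 1) (h : P.diagA κ k = diracD ρ B κ v v' a) : P.diagA κ k = 0 := by
  have h1 : (acEquiv B v hA).symm (diracD ρ B κ v v' a) ∈ polyLT F ι _ 1 := by
    have : (acEquiv B v hA).symm (diracD ρ B κ v v' a) = 1 ⊗ₜ P.diag k := by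
      rw [← h, LinearEquiv.symm_apply_eq, acEquiv_tmul, HeckeAlg.sym, symmetrize_one]
      exact (one_mul _).symm
    rw [this]
    exact tmul_mem_polyLT (isHomogeneous_one _ _) _
  obtain ⟨l, y, hy, rfl⟩ := exists_eq_diagA_add hA hB hv hD ha h1
  rw [h, map_add, P.diracD_diagA hB hv, P.diracD_diracD_eq_zero hD hy, add_zero]

end Cohomology

end PinCover

end

section

namespace PinCover

variable {F : Type*} [Field F] [CharZero F] {H : Type*} [Ring H] [HopfAlgebra F H]
  {V : Type*} [AddCommGroup V] [Module F V] [FiniteDimensional F V]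
  {ρ : H →ₐ[F] Module.End F V} {B : LinearMap.BilinForm F V} {κ : V →ₗ[F] V →ₗ[F] H}
  {ι : Type*} [Fintype ι] [DecidableEq ι] {v v' : Module.Basis ι F V}
  {K : Type*} [Ring K] [HopfAlgebra F K] [Coalgebra.IsCocomm F K]
  {P : PinCover ρ B K}

/-! ### The homomorphism `ζ` -/

theorem diagQuot_mk (k : K) :
    P.diagQuot κ (Ideal.Quotient.mk (RingHom.ker P.diag) k) = P.diagA κ k := rfl

theorem diagQuot_injective (hA : IsPBW ρ κ) (v : Module.Basis ι F V) :
    Function.Injective (P.diagQuot κ) :=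
  (inclA_injective hA v).comp (RingHom.kerLift_injective P.diag.toRingHom)

variable (P κ v v') in
/-- The relation `z ⊗ 1 = Δ_C(w) + D a + a D` between `z ∈ A` and `w ∈ H'`. -/
def VoganRel (z : HeckeAlg ρ κ) (w : P.Quot) : Prop :=
  ∃ a ∈ P.detPart κ 1, z ⊗ₜ[F] (1 : Cl B) = P.diagQuot κ w + diracD ρ B κ v v' a

theorem voganRel_iff (hB : IsOrthogonal ρ B) (z : HeckeAlg ρ κ) (w : P.Quot) :
    VoganRel κ v v' P z w ↔ ∃ a ∈ P.oddDet κ, z ⊗ₜ[F] (1 : Cl B) =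
      P.diagQuot κ w + (dirac ρ B κ v v' * a + a * dirac ρ B κ v v') := by
  refine exists_congr fun a => ?_
  rw [P.mem_detPart_one_iff hB]
  refine and_congr_right fun ha => ?_
  rw [diracD_apply, ha.1, pow_one, neg_smul, one_smul, neg_mul, sub_neg_eq_add]

/-- `Δ_C(w)` is the difference of `z ⊗ 1` and `d a`, and both are even invariants. -/
theorem VoganRel.mem_detPart (hB : IsOrthogonal ρ B)
    (hv : ∀ i j, B (v i) (v' j) = if i = j then 1 else 0)
    {z : HeckeAlg ρ κ} (hz : z ∈ Subalgebra.center F (HeckeAlg ρ κ)) {w : P.Quot}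
    (h : VoganRel κ v v' P z w) : P.diagQuot κ w ∈ P.detPart κ 0 := by
  obtain ⟨a, ha, h⟩ := h
  rw [eq_sub_of_add_eq h.symm]
  refine Submodule.sub_mem _ (P.tmul_one_mem_detPart hz) ?_
  rw [← P.detPart_add_two hB]
  exact P.diracD_mem_detPart hB hv ha

/-- Invariance of `Δ_C(w)` means that it commutes with the image of `Δ_C`, and `H'` embeds into `A ⊗
C`. -/
theorem VoganRel.mem_center (hA : IsPBW ρ κ) (hB : IsOrthogonal ρ B)
    (hv : ∀ i j, B (v i) (v' j) = if i = j then 1 else 0)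
    {z : HeckeAlg ρ κ} (hz : z ∈ Subalgebra.center F (HeckeAlg ρ κ)) {w : P.Quot}
    (h : VoganRel κ v v' P z w) : w ∈ Subalgebra.center F P.Quot := by
  rw [Subalgebra.mem_center_iff]
  intro u
  obtain ⟨k, rfl⟩ := Ideal.Quotient.mk_surjective u
  apply diagQuot_injective hA v
  rw [map_mul, map_mul, diagQuot_mk]
  exact (h.mem_detPart hB hv hz).2 k

theorem exists_voganRel (hA : IsPBW ρ κ) (hB : IsOrthogonal ρ B)
    (hv : ∀ i j, B (v i) (v' j) = if i = j then 1 else 0)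
    (hD : Parthasarathy P κ (dirac ρ B κ v v'))
    {z : HeckeAlg ρ κ} (hz : z ∈ Subalgebra.center F (HeckeAlg ρ κ)) :
    ∃ w, VoganRel κ v v' P z w := by
  obtain ⟨k, y, hy, h⟩ := exists_eq_diagA_add hA hB hv hD (P.tmul_one_mem_detPart hz)
    (by rw [diracD_tmul_one hz, map_zero]; exact Submodule.zero_mem _)
  exact ⟨Ideal.Quotient.mk _ k, y, hy, h⟩

theorem VoganRel.unique (hA : IsPBW ρ κ) (hB : IsOrthogonal ρ B)
    (hv : ∀ i j, B (v i) (v' j) = if i = j then 1 else 0)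
    (hD : Parthasarathy P κ (dirac ρ B κ v v')) {z : HeckeAlg ρ κ} {w₁ w₂ : P.Quot}
    (h₁ : VoganRel κ v v' P z w₁) (h₂ : VoganRel κ v v' P z w₂) : w₁ = w₂ := by
  obtain ⟨a₁, ha₁, h₁⟩ := h₁
  obtain ⟨a₂, ha₂, h₂⟩ := h₂
  rw [← sub_eq_zero]
  obtain ⟨k, hk⟩ := Ideal.Quotient.mk_surjective (w₁ - w₂)
  apply diagQuot_injective hA v
  have h3 : P.diagA κ k = diracD ρ B κ v v' (a₂ - a₁) := by
    rw [← diagQuot_mk, hk, map_sub, map_sub, sub_eq_sub_iff_add_eq_add, ← h₁, h₂, add_comm]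
  rw [map_zero, ← hk, diagQuot_mk]
  exact diagA_eq_zero_of_eq_diracD hA hB hv hD (Submodule.sub_mem _ ha₂ ha₁) h3

theorem voganRel_algebraMap (a : F) :
    VoganRel κ v v' P (algebraMap F _ a) (algebraMap F _ a) := by
  refine ⟨0, Submodule.zero_mem _, ?_⟩
  rw [map_zero, add_zero, AlgHom.commutes]
  rfl

theorem VoganRel.add {z₁ z₂ : HeckeAlg ρ κ} {w₁ w₂ : P.Quot}
    (h₁ : VoganRel κ v v' P z₁ w₁) (h₂ : VoganRel κ v v' P z₂ w₂) :
    VoganRel κ v v' P (z₁ + z₂) (w₁ + w₂) := by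
  obtain ⟨a₁, ha₁, h₁⟩ := h₁
  obtain ⟨a₂, ha₂, h₂⟩ := h₂
  refine ⟨a₁ + a₂, Submodule.add_mem _ ha₁ ha₂, ?_⟩
  rw [TensorProduct.add_tmul, h₁, h₂, map_add, map_add]
  abel

/-- Expand `(Δ_C(w₁) + d a₁)(z₂ ⊗ 1)` and substitute for `z₂ ⊗ 1` in the first term only. The
differential is linear over `z₂ ⊗ 1` on the right and over the even invariant `Δ_C(w₁)` on the left,
so the remainder is `d (Δ_C(w₁) a₂ + a₁ (z₂ ⊗ 1))`. -/
theorem VoganRel.mul (hB : IsOrthogonal ρ B)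
    (hv : ∀ i j, B (v i) (v' j) = if i = j then 1 else 0) {z₁ z₂ : HeckeAlg ρ κ}
    (hz₁ : z₁ ∈ Subalgebra.center F (HeckeAlg ρ κ))
    (hz₂ : z₂ ∈ Subalgebra.center F (HeckeAlg ρ κ)) {w₁ w₂ : P.Quot}
    (h₁ : VoganRel κ v v' P z₁ w₁) (h₂ : VoganRel κ v v' P z₂ w₂) :
    VoganRel κ v v' P (z₁ * z₂) (w₁ * w₂) := by
  have hw₁ := h₁.mem_detPart hB hv hz₁
  obtain ⟨a₁, ha₁, h₁⟩ := h₁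
  obtain ⟨a₂, ha₂, h₂⟩ := h₂
  obtain ⟨k, rfl⟩ := Ideal.Quotient.mk_surjective w₁
  rw [diagQuot_mk] at h₁ hw₁
  refine ⟨P.diagA κ k * a₂ + a₁ * z₂ ⊗ₜ 1, Submodule.add_mem _ ?_ ?_, ?_⟩
  · have := P.mul_mem_detPart hw₁ ha₂
    rwa [zero_add] at this
  · have := P.mul_mem_detPart ha₁ (P.tmul_one_mem_detPart hz₂)
    rwa [add_zero] at this
  · have h3 : (z₁ * z₂) ⊗ₜ[F] (1 : Cl B) = z₁ ⊗ₜ 1 * z₂ ⊗ₜ 1 := by simp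
    rw [h3, map_add, P.diracD_diagA_mul hB hv hw₁, diracD_mul_tmul_one hz₂, h₁, add_mul, map_mul,
      diagQuot_mk, ← add_assoc, ← mul_add, ← h₂]

/-- Values are chosen arbitrarily; the relation is compatible with the algebra operations, so
uniqueness forces the chosen map to be a homomorphism. -/
theorem exists_vogan_algHom (hA : IsPBW ρ κ) (hB : IsOrthogonal ρ B)
    (hv : ∀ i j, B (v i) (v' j) = if i = j then 1 else 0)
    (hD : Parthasarathy P κ (dirac ρ B κ v v')) :
    ∃ ζ : Subalgebra.center F (HeckeAlg ρ κ) →ₐ[F] Subalgebra.center F P.Quot,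
      ∀ z : Subalgebra.center F (HeckeAlg ρ κ), VoganRel κ v v' P (z : HeckeAlg ρ κ) (ζ z) := by
  choose f hf using fun z : Subalgebra.center F (HeckeAlg ρ κ) =>
    exists_voganRel hA hB hv hD z.2
  refine ⟨{ toFun := fun z => ⟨f z, (hf z).mem_center hA hB hv z.2⟩
            map_one' := Subtype.ext ?_
            map_mul' := fun x y => Subtype.ext ?_
            map_zero' := Subtype.ext ?_
            map_add' := fun x y => Subtype.ext ?_
            commutes' := fun a => Subtype.ext ?_ }, hf⟩
  · refine (hf 1).unique hA hB hv hD ?_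
    have := voganRel_algebraMap (P := P) (κ := κ) (v := v) (v' := v') 1
    rwa [map_one, map_one] at this
  · exact (hf _).unique hA hB hv hD ((hf x).mul hB hv x.2 y.2 (hf y))
  · refine (hf 0).unique hA hB hv hD ?_
    have := voganRel_algebraMap (P := P) (κ := κ) (v := v) (v' := v') 0
    rwa [map_zero, map_zero] at this
  · exact (hf _).unique hA hB hv hD ((hf x).add (hf y))
  · exact (hf _).unique hA hB hv hD (voganRel_algebraMap a)

end PinCover

end

end BarbaschSahi

end

open BarbaschSahi in
theorem proposition4p1 {F : Type*} [Field F] [CharZero F]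
    {H : Type*} [Ring H] [HopfAlgebra F H] [Coalgebra.IsCocomm F H] (hH : IsPointed F H)
    {V : Type*} [AddCommGroup V] [Module F V] [FiniteDimensional F V]
    (ρ : H →ₐ[F] Module.End F V) (B : LinearMap.BilinForm F V) (κ : V →ₗ[F] V →ₗ[F] H)
    (hA : IsHopfHecke ρ B κ)
    {K : Type*} [Ring K] [HopfAlgebra F K] [Coalgebra.IsCocomm F K] (P : PinCover ρ B K)
    {ι : Type*} [Fintype ι] [DecidableEq ι] (v v' : Module.Basis ι F V)
    (hv : ∀ i j, B (v i) (v' j) = if i = j then 1 else 0)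
    (hD : Parthasarathy P κ (dirac ρ B κ v v')) :
    ∃ ζ : Subalgebra.center F (HeckeAlg ρ κ) →ₐ[F] Subalgebra.center F P.Quot,
      ∀ z : Subalgebra.center F (HeckeAlg ρ κ),
        (∃ a ∈ P.oddDet κ,
          (z : HeckeAlg ρ κ) ⊗ₜ[F] (1 : Cl B) =
            P.diagQuot κ (ζ z) + (dirac ρ B κ v v' * a + a * dirac ρ B κ v v')) ∧
        ∀ w : Subalgebra.center F P.Quot,
          (∃ a ∈ P.oddDet κ,
            (z : HeckeAlg ρ κ) ⊗ₜ[F] (1 : Cl B) =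
              P.diagQuot κ w + (dirac ρ B κ v v' * a + a * dirac ρ B κ v v')) →
          w = ζ z := by
  obtain ⟨ζ, hζ⟩ := PinCover.exists_vogan_algHom (P := P) hA.pbw hA.orthogonal hv hD
  refine ⟨ζ, fun z => ⟨(PinCover.voganRel_iff hA.orthogonal _ _).mp (hζ z), fun w hw => ?_⟩⟩
  exact Subtype.ext (((PinCover.voganRel_iff hA.orthogonal _ _).mpr hw).unique hA.pbw
    hA.orthogonal hv hD (hζ z))
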